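/- Let $0<r_i<r_e$ and identify $\mathbb R^2$ with $\mathbb C$. Let $\Omega=\{|x-r_e|<r_e\}$ and, for $0<\epsilon<r_e-r_i$, let $D=D_\epsilon=\{|x-(r_i+\epsilon)|<r_i\}$. Let $g_d:\partial\Omega\to\mathbb R$ be mean-zero and of class $C^{2,\delta}$ for some $\delta>1/2$. For $k>0$ let $v$ be the solution of $$\Delta v=0\ \text{in } D\cup(\Omega\setminus\overline D),\qquad v|_+=v|_-,\quad \partial_\nu v|_+=k\,\partial_\nu v|_-\ \text{on }\partial D,\qquad v=g_d\ \text{on }\partial\Omega,$$ where $\nu$ is the outward unit normal to $D$ and solutions are classical: continuous on $\overline\Omega$, harmonic in $D$ and in $\Omega\setminus\overline D$, with one-sided normal derivatives at every point of $\partial D$. Notation. Put $$c_i=\frac{r_e^2-r_i^2-(r_e-r_i-\epsilon)^2}{2(r_e-r_i-\epsilon)},\quad c_e=c_i+r_e-r_i-\epsilon,\quad x_0=c_e-r_e,$$ $$\alpha=\frac{\sqrt{\epsilon(2r_i+\epsilon)(2r_e-\epsilon)(2r_e-2r_i-\epsilon)}}{2(r_e-r_i-\epsilon)},\quad \xi_e=\tfrac12\ln\frac{c_e+\alpha}{c_e-\alpha},\quad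 \xi_i=\tfrac12\ln\frac{c_i+\alpha}{c_i-\alpha},$$ $$r_*=\sqrt{\frac{2r_ir_e}{r_e-r_i}},\qquad \tau=\frac{k-1}{k+1},\qquad \beta=\frac{r_*(-\ln|\tau|)}{4\sqrt\epsilon}.$$ Bipolar coordinates $(\xi,\theta)\in\mathbb R\times(-\pi,\pi]$ of a point $z$ are given by $e^{\xi+i\theta}=(\alpha+z)/(\alpha-z)$; the translated disks $x_0+\Omega$ and $x_0+D$ are $\{\xi>\xi_e\}$ and $\{\xi>\xi_i\}$ (with the pole $z=\alpha$, where $\xi=+\infty$, included). For $|z|<1$, $\beta>0$ let $L(z;\beta)=-\int_0^\infty \frac{z e^{-(\beta+1)t}}{1+ze^{-t}}\,dt$ (Lerch transcendent), and for $k>1$ let $$q_d(z;\beta)=\begin{cases}L(e^{-(2\xi_i-2\xi_e+\xi)-i\theta};\beta)-L(e^{-(2\xi_i-\xi)-i\theta};\beta)&\xi_e<\xi<\xi_i,\\ L(e^{-(2\xi_i-2\xi_e+\xi)-i\theta};\beta)-L(e^{-\xi-i\theta};\beta)&\xi>\xi_i,\end{cases}$$ with the limit value $q_d(\alpha;\beta)=0$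 at the pole. Let $$H_d(x)=\frac1\pi\int_{\partial\Omega}\frac{\partial}{\partial\nu_\zeta}\big(\ln|x-\zeta|\big)\,g_d(\zeta)\,d\sigma(\zeta),\qquad x\in\Omega,$$ with $\nu_\zeta$ the outward unit normal to $\partial\Omega$ at $\zeta$ (this is the harmonic extension of $g_d$). Lemma. The problem has a solution $v$ for all $0<\epsilon<r_e-r_i$ and $k>0$, and every solution satisfies the following. (a) There is a constant $C$, independent of $\epsilon$ and $k$, such that for all $0<\epsilon<r_e-r_i$ and $0<k<1$, $v$ is differentiable on $\Omega\setminus\partial D$ and $|\nabla v|\le C$ there; in particular $\|\nabla v\|_{L^\infty(\Omega)}\le C$. (b) The limit $(C_1,C_2)=\lim_{x\to0,\,x\in\Omega}\nabla H_d(x)$ exists, and there is a constant $C$, independent of $\epsilon$ and $k$, such that for all $0<\epsilon<r_e-r_i$ and $k>1$, $$v(x)=\frac{r_*^2\tau}{2}\big[C_1\,\Re\, q_d(x+x_0;\beta)+C_2\,\Im\, q_d(x+x_0;\beta)\big]+r(x),\qquad x\in\Omega\setminus\partial D,$$ where $r$ is differentiable on $\Omega\setminus\partial D$ and $|\nabla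 r|\le C$ there; in particular $\|\nabla r\|_{L^\infty(\Omega)}\le C$. -/

import Mathlib

open Complex Set Filter Topology MeasureTheory InnerProductSpace

/- The plane `ℝ²` is identified with `ℂ`, a point `(x₁, x₂)` being `x₁ + i x₂`. -/

namespace NearlyTouchingDisks

noncomputable section

/-! ### Geometry -/

/-- The fixed outer disk `Ω`, centred at `(r_e, 0)`; the origin lies on its boundary. -/
def outerDisk (re : ℝ) : Set ℂ := Metric.ball (re : ℂ) re

/-- The inclusion `D`, at distance `ε` from `∂Ω`. -/
def inclusion (ri ε : ℝ) : Set ℂ := Metric.ball ((ri + ε : ℝ) : ℂ) ri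

/-- The interface `∂D`. -/
def interface (ri ε : ℝ) : Set ℂ := Metric.sphere ((ri + ε : ℝ) : ℂ) ri

/-- Abscissa of the centre of the translated inclusion. -/
def ci (ri re ε : ℝ) : ℝ :=
  (re ^ 2 - ri ^ 2 - (re - ri - ε) ^ 2) / (2 * (re - ri - ε))

/-- Abscissa of the centre of the translated outer disk. -/
def ce (ri re ε : ℝ) : ℝ := ci ri re ε + re - ri - ε

/-- The translation `x ↦ x + (x₀, 0)` makes both circles level curves of `ξ`. -/
def x0 (ri re ε : ℝ) : ℝ := ce ri re ε - re

/-- Position of the poles `(±α, 0)` of the bipolar coordinates. -/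
def poleDist (ri re ε : ℝ) : ℝ :=
  √(ε * (2 * ri + ε) * (2 * re - ε) * (2 * re - 2 * ri - ε)) / (2 * (re - ri - ε))

def xiE (ri re ε : ℝ) : ℝ :=
  1 / 2 * Real.log
    ((ce ri re ε + poleDist ri re ε) / (ce ri re ε - poleDist ri re ε))

def xiI (ri re ε : ℝ) : ℝ :=
  1 / 2 * Real.log
    ((ci ri re ε + poleDist ri re ε) / (ci ri re ε - poleDist ri re ε))

/-- The bipolar coordinate `ξ`, from `e ^ (ξ + iθ) = (α + z) / (α - z)`. -/
def bipolarXi (α : ℝ) (z : ℂ) : ℝ := Real.log ‖((α : ℂ) + z) / ((α : ℂ) - z)‖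

/-- The bipolar coordinate `θ ∈ (-π, π]`, from `e ^ (ξ + iθ) = (α + z) / (α - z)`. -/
def bipolarTheta (α : ℝ) (z : ℂ) : ℝ := Complex.arg (((α : ℂ) + z) / ((α : ℂ) - z))

def rStar (ri re : ℝ) : ℝ := √(2 * ri * re / (re - ri))

/-! ### The singular function -/

def tau (k : ℝ) : ℝ := (k - 1) / (k + 1)

def betaParam (ri re ε k : ℝ) : ℝ :=
  rStar ri re * (-Real.log |tau k|) / (4 * √ε)

/-- The Lerch transcendent function `L(z; β)`, for `|z| < 1` and `β > 0`. -/
def lerchL (z : ℂ) (β : ℝ) : ℂ :=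
  -∫ t in Ioi (0 : ℝ),
    z * (Real.exp (-(β + 1) * t) : ℂ) / (1 + z * (Real.exp (-t) : ℂ))

/-- The singular function `q_d`, in the translated coordinate `z`. At the pole `z = α`,
which corresponds to `ξ = +∞`, it takes its limit value `0`. -/
def qd (ri re ε β : ℝ) (z : ℂ) : ℂ :=
  let α := poleDist ri re ε
  let ξi := xiI ri re ε
  let ξe := xiE ri re ε
  let ξ := bipolarXi α z
  let θ := bipolarTheta α z
  if z = (α : ℂ) then 0
  else if ξ < ξi then
    lerchL (Complex.exp (-((2 * ξi - 2 * ξe + ξ : ℝ) : ℂ) - I * (θ : ℂ))) β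
      - lerchL (Complex.exp (-((2 * ξi - ξ : ℝ) : ℂ) - I * (θ : ℂ))) β
  else
    lerchL (Complex.exp (-((2 * ξi - 2 * ξe + ξ : ℝ) : ℂ) - I * (θ : ℂ))) β
      - lerchL (Complex.exp (-(ξ : ℂ) - I * (θ : ℂ))) β

/-! ### The boundary value problem -/

/-- `g ∈ C^{2,δ}` on the circle of centre `c` and radius `r`, in the angular variable. -/
def IsC2Holder (δ : ℝ) (c : ℂ) (r : ℝ) (g : ℂ → ℝ) : Prop :=
  ContDiff ℝ 2 (fun t : ℝ => g (circleMap c r t)) ∧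
    ∃ K : ℝ, ∀ s t : ℝ,
      |iteratedDeriv 2 (fun t : ℝ => g (circleMap c r t)) s
        - iteratedDeriv 2 (fun t : ℝ => g (circleMap c r t)) t| ≤ K * |s - t| ^ δ

/-- The double layer potential of the density `φ` on the circle of centre `c` and radius `r`:
`(1 / 2π) ∫ ∂/∂ν_ζ (ln |x - ζ|) φ(ζ) dσ(ζ)`, with outward unit normal `ν_ζ = (ζ - c) / r` and
`∂/∂ν_ζ (ln |x - ζ|) = ⟪ζ - x, ν_ζ⟫ / |ζ - x|²`. -/
def doubleLayer (c : ℂ) (r : ℝ) (φ : ℂ → ℝ) (x : ℂ) : ℝ :=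
  1 / (2 * Real.pi) * ∫ t in (0 : ℝ)..(2 * Real.pi),
    inner ℝ (circleMap c r t - x) (r⁻¹ • (circleMap c r t - c))
      / ‖circleMap c r t - x‖ ^ 2 * φ (circleMap c r t) * r

/-- `v` solves the Dirichlet problem: it is continuous on the closure of `Ω` (so the traces from
both sides of `∂D` agree), harmonic in `D` and in `Ω \ closure D`, equal to `g` on `∂Ω`, and at
each point of `∂D` the one-sided normal derivatives (`ν` outward to `D`) exist and satisfy
`∂v/∂ν|₊ = k ∂v/∂ν|₋`. -/
structure IsSolution (ri re ε k : ℝ) (g : ℂ → ℝ) (v : ℂ → ℝ) : Prop where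
  continuousOn : ContinuousOn v (closure (outerDisk re))
  harmonic_inside : HarmonicOnNhd v (inclusion ri ε)
  harmonic_outside : HarmonicOnNhd v (outerDisk re \ closure (inclusion ri ε))
  boundary : ∀ x ∈ Metric.sphere (re : ℂ) re, v x = g x
  transmission : ∀ x ∈ interface ri ε, ∃ a : ℝ,
    HasDerivWithinAt
      (fun t : ℝ => v (x + t • (ri⁻¹ • (x - ((ri + ε : ℝ) : ℂ))))) (k * a) (Ici 0) 0 ∧
    HasDerivWithinAt
      (fun t : ℝ => v (x + t • (ri⁻¹ • (x - ((ri + ε : ℝ) : ℂ))))) a (Iic 0) 0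

/-- The remainder `r = v - (r_*² τ / 2) (C₁ Re q_d + C₂ Im q_d)`. -/
def remainder (ri re ε k C₁ C₂ : ℝ) (v : ℂ → ℝ) (x : ℂ) : ℝ :=
  v x - rStar ri re ^ 2 * tau k / 2 *
    (C₁ * (qd ri re ε (betaParam ri re ε k) (x + (x0 ri re ε : ℂ))).re
      + C₂ * (qd ri re ε (betaParam ri re ε k) (x + (x0 ri re ε : ℂ))).im)

end

end NearlyTouchingDisks

/-! The proof is the method of images, written with holomorphic functions. Let `F` be holomorphic in
Ω with real part `H_d`, and let T be the inversion in ∂Ω followed by the inversion in ∂D. In bipolar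
coordinates T is the shift ξ ↦ ξ + 2(ξᵢ - ξₑ): a hyperbolic translation with fixed points ±α. The
series G = Σ τ^m F ∘ T^m satisfies G = F + τ G ∘ T. The function equal to (1 - τ) Re G in D, and to
Re G minus τ times its reflection in ∂D outside D, then solves the problem
(`isSolution_imageSolution`). On ∂Ω the map T reduces to the reflection, which leaves Re F = g; on
∂D the reflection reverses the normal derivative, which gives the ratio (1 + τ)/(1 - τ) = k. A
maximum principle with a barrier gives uniqueness (`IsSolution.eqOn`), so only G' has to be
estimated.

Here G' = Σ τ^m F'(T^m z) (T^m)'(z). Cauchy integrals of the Hölder continuous second derivative of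
g are bounded, hence F' is Lipschitz up to the boundary and has a limit f₀ at the touching point
(`exists_isHolomorphicExtension`). The sum Σ |(T^m)'| may be as large as 1/κ with κ = tanh(ξᵢ - ξₑ),
which blows up as ε → 0. Weighted by the distance of T^m z to the touching point, however, it is
only of size α/κ, which stays bounded (`sum_norm_mob_mul_succ_le`, `poleDist_div_iterParam_le`). So
F' may be replaced by f₀ (`norm_imageSeriesDeriv_sub_le`).

What remains is f₀ Λ with Λ = Σ τ^m (T^m)'(z). As a function of the translation parameter, the
derivative of a translation has total variation bounded independently of z and α
(`norm_mobDeriv_sub_le`). For k < 1 the signs alternate and Abel summation bounds Λ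
(`norm_linSeriesDeriv_le_of_nonpos`). For k > 1, Λ is, up to its step 2(ξᵢ - ξₑ), a Riemann sum of a
Laplace integral, and this integral is 2α times the derivative of the Lerch function in bipolar
coordinates (`norm_linSeriesDeriv_sub_laplace_le`, `hasDerivAt_lerchL_comp`). Putting r_*/(2√ε) and
r_*²/(2α) for the inverse gap costs O(1) (`exists_gap_asymptotics`). Finally `q_d` arises from the
Lerch function by the same gluing that produces v from G, so subtracting the singular term from v
amounts to subtracting a multiple of the Lerch function from G (`remainder_imageSolution`). When ε ≥
(r_e - r_i)/2, both 1/κ and 1/α are bounded and no cancellation is needed. -/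

namespace NearlyTouchingDisks

noncomputable section

open scoped ComplexConjugate

/-! ### The hyperbolic translations along the real axis -/

/-- The hyperbolic translation with fixed points `±α` sending `0` to `α c`. -/
def mob (α c : ℝ) (z : ℂ) : ℂ := α * ((z / α + c) / (1 + c * (z / α)))

/-- The complex derivative of `mob α c`. -/
def mobDeriv (α c : ℝ) (z : ℂ) : ℂ := (1 - (c : ℂ) ^ 2) / (1 + c * (z / α)) ^ 2

/-- A function dominating the variation of `c ↦ mobDeriv α c z`. -/
def mobVar (α : ℝ) (z : ℂ) (c : ℝ) : ℝ := 2 * Real.arctan (‖z‖ / α * c) + c ^ 2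

/-- In the expansion of the squared modulus the cross term 2c Re ζ is nonnegative. This is the only
use of the right half-plane, and it is what makes the later bounds uniform in z. -/
lemma one_add_sq_le_normSq {c : ℝ} {ζ : ℂ} (hc : 0 ≤ c) (hζ : 0 ≤ ζ.re) :
    1 + (‖ζ‖ * c) ^ 2 ≤ ‖1 + c * ζ‖ ^ 2 := by
  rw [mul_pow, ← Complex.normSq_eq_norm_sq, ← Complex.normSq_eq_norm_sq]
  simp only [Complex.normSq_apply, add_re, one_re, mul_re, ofReal_re, ofReal_im, add_im, one_im,
    mul_im]
  nlinarith [mul_nonneg hc hζ]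

lemma one_le_norm_one_add {c : ℝ} {ζ : ℂ} (hc : 0 ≤ c) (hζ : 0 ≤ ζ.re) :
    1 ≤ ‖1 + c * ζ‖ := by
  have := one_add_sq_le_normSq hc hζ
  nlinarith [sq_nonneg (‖ζ‖ * c), norm_nonneg (1 + c * ζ)]

lemma one_add_mul_ne_zero {c : ℝ} {ζ : ℂ} (hc : 0 ≤ c) (hζ : 0 ≤ ζ.re) :
    1 + c * ζ ≠ 0 := by
  intro h
  have := one_le_norm_one_add hc hζ
  rw [h] at this; norm_num at this

lemma div_re_nonneg {α : ℝ} {z : ℂ} (hα : 0 < α) (hz : 0 ≤ z.re) : 0 ≤ (z / α).re := by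
  rw [Complex.div_ofReal_re]; positivity

lemma norm_div_pos {α : ℝ} (z : ℂ) (hα : 0 < α) : ‖z / α‖ = ‖z‖ / α := by
  rw [norm_div, Complex.norm_real, Real.norm_of_nonneg hα.le]

lemma norm_one_sub_sq {c : ℝ} (h0 : 0 ≤ c) (h1 : c ≤ 1) : ‖1 - (c : ℂ) ^ 2‖ = 1 - c ^ 2 := by
  have : (1 - (c : ℂ) ^ 2) = ((1 - c ^ 2 : ℝ) : ℂ) := by push_cast; ring
  rw [this, Complex.norm_real, Real.norm_of_nonneg]
  nlinarith

lemma norm_mobDeriv_le {α c : ℝ} {z : ℂ} (hα : 0 < α) (hz : 0 ≤ z.re) (h0 : 0 ≤ c) (h1 : c ≤ 1) :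
    ‖mobDeriv α c z‖ ≤ 1 - c ^ 2 := by
  rw [mobDeriv, norm_div, norm_pow, norm_one_sub_sq h0 h1]
  have := one_le_norm_one_add h0 (div_re_nonneg hα hz)
  apply div_le_self (by nlinarith)
  nlinarith

lemma hasDerivAt_mob {α c : ℝ} {z : ℂ} (hα : 0 < α) (hz : 0 ≤ z.re) (h0 : 0 ≤ c) :
    HasDerivAt (mob α c) (mobDeriv α c z) z := by
  have hne := one_add_mul_ne_zero h0 (div_re_nonneg hα hz)
  have hα' : (α : ℂ) ≠ 0 := by exact_mod_cast hα.ne'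
  have h1 : HasDerivAt (fun z : ℂ => z / α + c) (1 / α) z :=
    ((hasDerivAt_id z).div_const _).add_const _
  have h2 : HasDerivAt (fun z : ℂ => 1 + c * (z / α)) (c * (1 / α)) z :=
    (((hasDerivAt_id z).div_const _).const_mul _).const_add _
  refine ((h1.div h2 hne).const_mul (α : ℂ)).congr_deriv ?_
  rw [mobDeriv]
  field_simp
  ring

lemma hasDerivAt_mobDeriv_param {α c : ℝ} {z : ℂ} (hα : 0 < α) (hz : 0 ≤ z.re) (h0 : 0 ≤ c) :
    HasDerivAt (fun c : ℝ => mobDeriv α c z)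
      (-2 * (c + z / α) / (1 + c * (z / α)) ^ 3) c := by
  have hne := one_add_mul_ne_zero h0 (div_re_nonneg hα hz)
  have h1 : HasDerivAt (fun c : ℂ => (1 : ℂ) - c ^ 2) (-(2 * (c : ℂ))) (c : ℂ) := by
    simpa using! ((hasDerivAt_id (c : ℂ)).pow 2).const_sub 1
  have h2 : HasDerivAt (fun c : ℂ => (1 + c * (z / α)) ^ 2)
      (2 * (1 + c * (z / α)) * (z / α)) (c : ℂ) := by
    simpa using! (((hasDerivAt_id (c : ℂ)).mul_const (z / α)).const_add 1).pow 2
  refine ((h1.div h2 (pow_ne_zero _ hne)).congr_deriv ?_).comp_ofReal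
  generalize z / (α : ℂ) = ζ at *
  field_simp
  ring

/-- The right side is the c-derivative of arctan(‖ζ‖c) + c²/2, whose increase over [0, 1] is bounded
uniformly in ζ. It controls both the variation of `mobDeriv` and the product `mob * mobDeriv`. -/
lemma norm_add_div_le {c : ℝ} {ζ : ℂ} (h0 : 0 ≤ c) (hζ : 0 ≤ ζ.re) :
    ‖(c + ζ) / (1 + c * ζ) ^ 3‖ ≤ ‖ζ‖ / (1 + (‖ζ‖ * c) ^ 2) + c := by
  have h1 := one_add_sq_le_normSq h0 hζ
  have h2 := one_le_norm_one_add h0 hζ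
  rw [norm_div, norm_pow]
  set N := ‖1 + c * ζ‖
  have hP : 0 < 1 + (‖ζ‖ * c) ^ 2 := by positivity
  have h3 : 1 + (‖ζ‖ * c) ^ 2 ≤ N ^ 3 := by nlinarith [sq_nonneg N]
  have h4 : ‖(c : ℂ) + ζ‖ ≤ c + ‖ζ‖ := by
    simpa [abs_of_nonneg h0] using norm_add_le (c : ℂ) ζ
  calc ‖(c : ℂ) + ζ‖ / N ^ 3 ≤ (c + ‖ζ‖) / (1 + (‖ζ‖ * c) ^ 2) := by gcongr
    _ = ‖ζ‖ / (1 + (‖ζ‖ * c) ^ 2) + c / (1 + (‖ζ‖ * c) ^ 2) := by ring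
    _ ≤ _ := by
      gcongr
      apply div_le_self h0
      nlinarith [sq_nonneg (‖ζ‖ * c)]

lemma hasDerivAt_mobVar (α : ℝ) (z : ℂ) (c : ℝ) :
    HasDerivAt (mobVar α z)
      (2 * (‖z‖ / α / (1 + (‖z‖ / α * c) ^ 2) + c)) c := by
  have h1 : HasDerivAt (fun c : ℝ => ‖z‖ / α * c) (‖z‖ / α) c := by
    simpa using (hasDerivAt_id c).const_mul (‖z‖ / α)
  have h2 := (h1.arctan.const_mul 2).add ((hasDerivAt_id c).pow 2)
  refine h2.congr_deriv ?_
  simp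
  ring

lemma mobVar_zero (α : ℝ) (z : ℂ) : mobVar α z 0 = 0 := by simp [mobVar]

lemma mobVar_le (α : ℝ) (z : ℂ) {c : ℝ} (h0 : 0 ≤ c) (h1 : c ≤ 1) :
    mobVar α z c ≤ Real.pi + 1 := by
  have := (Real.arctan_lt_pi_div_two (‖z‖ / α * c)).le
  rw [mobVar]; nlinarith

/-- Comparison of derivatives in the parameter. Together with `mobVar_le` it bounds the total
variation over [0, 1] by π + 1, whatever z and α are. -/
lemma norm_mobDeriv_sub_le {α a b : ℝ} {z : ℂ} (hα : 0 < α) (hz : 0 ≤ z.re)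
    (ha : 0 ≤ a) (hab : a ≤ b) :
    ‖mobDeriv α b z - mobDeriv α a z‖ ≤ mobVar α z b - mobVar α z a := by
  refine image_norm_le_of_norm_deriv_right_le_deriv_boundary
    (f := fun c => mobDeriv α c z - mobDeriv α a z) (B := fun c => mobVar α z c - mobVar α z a)
    (f' := fun c => -2 * (c + z / α) / (1 + c * (z / α)) ^ 3)
    (a := a) (b := b) ?_ ?_ ?_ (fun c => (hasDerivAt_mobVar α z c).sub_const _) ?_
    ⟨hab, le_rfl⟩
  · intro c hc
    exact ((hasDerivAt_mobDeriv_param hα hz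
      (ha.trans hc.1)).sub_const _).continuousAt.continuousWithinAt
  · intro c hc
    exact ((hasDerivAt_mobDeriv_param hα hz (ha.trans hc.1)).sub_const _).hasDerivWithinAt
  · simp
  · intro c hc
    have := norm_add_div_le (ha.trans hc.1) (div_re_nonneg hα hz)
    rw [mul_div_assoc, norm_mul]
    rw [norm_div_pos z hα] at this
    norm_num at this ⊢
    exact this

/-- Concavity of arctan on the half-line: the slope of a chord is at least the derivative at its
right end. -/
lemma arctan_sub_ge {R a c : ℝ} (hR : 0 ≤ R) (h0 : 0 ≤ a) (h1 : a ≤ c) :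
    R / (1 + (R * c) ^ 2) * (c - a) ≤ Real.arctan (R * c) - Real.arctan (R * a) := by
  rcases h1.eq_or_lt with rfl | h1
  · simp
  obtain ⟨x, hx, hx'⟩ := exists_hasDerivAt_eq_slope (fun c => Real.arctan (R * c))
    (fun c => 1 / (1 + (R * c) ^ 2) * R) h1 (by fun_prop)
    (fun x _ => ((hasDerivAt_id x).const_mul R |>.congr_deriv (mul_one R)).arctan)
  rw [eq_div_iff (by linarith)] at hx'
  rw [← hx', div_mul_eq_mul_div 1, one_mul]
  have : 0 ≤ c - a := by linarith
  have hx0 : 0 ≤ x := h0.trans hx.1.le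
  have := hx.2.le
  gcongr

/-- The product `mob * mobDeriv` equals α(1 - c²)(c + ζ)/(1 + cζ)³ with ζ = z/α. The last factor,
times the step c - a, is at most an increment of arctan(‖ζ‖c) + c, and such increments telescope
when summed over iterates. -/
lemma norm_mob_mul_le {α a c : ℝ} {z : ℂ} (hα : 0 < α) (hz : 0 ≤ z.re)
    (h0 : 0 ≤ a) (hac : a ≤ c) (h1 : c ≤ 1) :
    ‖mob α c z‖ * ‖mobDeriv α c z‖ * (c - a) ≤
      α * (1 - c ^ 2) * (Real.arctan (‖z‖ / α * c) - Real.arctan (‖z‖ / α * a) + (c - a)) := by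
  have hc := h0.trans hac
  have h2 := norm_add_div_le hc (div_re_nonneg hα hz)
  rw [norm_div_pos z hα] at h2
  have h3 := arctan_sub_ge (R := ‖z‖ / α) (by positivity) h0 hac
  have h4 : mob α c z * mobDeriv α c z =
      α * (1 - (c : ℂ) ^ 2) * ((c + z / α) / (1 + c * (z / α)) ^ 3) := by
    have hne := one_add_mul_ne_zero hc (div_re_nonneg hα hz)
    rw [mob, mobDeriv]
    generalize z / (α : ℂ) = ζ at *
    field_simp
    ring
  rw [← norm_mul, h4, norm_mul, norm_mul, norm_one_sub_sq hc h1, Complex.norm_real,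
    Real.norm_of_nonneg hα.le, mul_assoc]
  have h5 : 0 ≤ 1 - c ^ 2 := by nlinarith
  refine mul_le_mul_of_nonneg_left ?_ (by positivity)
  have h6 : 0 ≤ c - a := by linarith
  nlinarith [mul_le_mul_of_nonneg_right h2 h6]

/-! ### The iterates of a hyperbolic translation -/

/-- The parameter of the `m`-th iterate of the translation with multiplier `μ`. -/
def iterParam (μ : ℝ) (m : ℕ) : ℝ := (1 - μ ^ m) / (1 + μ ^ m)

lemma iterParam_zero (μ : ℝ) : iterParam μ 0 = 0 := by simp [iterParam]

lemma iterParam_one (μ : ℝ) : iterParam μ 1 = (1 - μ) / (1 + μ) := by simp [iterParam]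

lemma iterParam_nonneg {μ : ℝ} (h0 : 0 < μ) (h1 : μ < 1) (m : ℕ) : 0 ≤ iterParam μ m := by
  have := pow_le_one₀ (n := m) h0.le h1.le
  have := pow_pos h0 m
  exact div_nonneg (by linarith) (by linarith)

lemma iterParam_lt_one {μ : ℝ} (h0 : 0 < μ) (m : ℕ) : iterParam μ m < 1 := by
  have := pow_pos h0 m
  rw [iterParam, div_lt_one (by linarith)]; linarith

lemma iterParam_sub {μ : ℝ} (h0 : 0 < μ) (m : ℕ) :
    iterParam μ (m + 1) - iterParam μ m =
      2 * μ ^ m * (1 - μ) / ((1 + μ ^ (m + 1)) * (1 + μ ^ m)) := by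
  have := pow_pos h0 m
  have := pow_pos h0 (m + 1)
  rw [iterParam, iterParam]
  field_simp
  ring

lemma iterParam_lt_succ {μ : ℝ} (h0 : 0 < μ) (h1 : μ < 1) (m : ℕ) :
    iterParam μ m < iterParam μ (m + 1) := by
  have := pow_pos h0 m
  have := pow_pos h0 (m + 1)
  have : 0 < 1 - μ := by linarith
  rw [← sub_pos, iterParam_sub h0]
  positivity

/-- With μ = e^(-2s) the parameter c_m is tanh(ms), and the subtraction formula reads c_{m+1} - c_m
= c_1 (1 - c_m c_{m+1}), where c_m ≤ c_{m+1}. -/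
lemma one_sub_sq_iterParam_le {μ : ℝ} (h0 : 0 < μ) (h1 : μ < 1) (m : ℕ) :
    iterParam μ 1 * (1 - iterParam μ (m + 1) ^ 2) ≤ iterParam μ (m + 1) - iterParam μ m := by
  rw [iterParam_sub h0, iterParam_one, iterParam, pow_succ μ]
  have hq := pow_pos h0 m
  have hq1 := pow_le_one₀ (n := m) h0.le h1.le
  set q := μ ^ m
  have h2 : 0 < 1 + q * μ := by positivity
  have : (1 - μ) / (1 + μ) * (1 - ((1 - q * μ) / (1 + q * μ)) ^ 2) =
      (2 * q * (1 - μ) / (1 + q * μ)) * (2 * μ / ((1 + μ) * (1 + q * μ))) := by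
    field_simp
    ring
  rw [this]
  have h3 : 2 * q * (1 - μ) / ((1 + q * μ) * (1 + q)) =
      (2 * q * (1 - μ) / (1 + q * μ)) * (1 / (1 + q)) := by
    field_simp
  rw [h3]
  refine mul_le_mul_of_nonneg_left ?_ (div_nonneg (mul_nonneg (by positivity) (by linarith)) h2.le)
  rw [div_le_div_iff₀ (by positivity) (by positivity)]
  nlinarith [mul_nonneg (sub_nonneg.2 h1.le) (sub_nonneg.2 (mul_le_one₀ hq1 h0.le h1.le))]

lemma iterParam_one_pos {μ : ℝ} (h0 : 0 < μ) (h1 : μ < 1) : 0 < iterParam μ 1 := by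
  have := iterParam_lt_succ h0 h1 0
  rwa [iterParam_zero] at this

lemma sum_one_sub_sq_le {μ : ℝ} (h0 : 0 < μ) (h1 : μ < 1) (n : ℕ) :
    ∑ m ∈ Finset.range n, (1 - iterParam μ (m + 1) ^ 2) ≤ 1 / iterParam μ 1 := by
  have hκ := iterParam_one_pos h0 h1
  rw [le_div_iff₀ hκ, Finset.sum_mul]
  calc _ ≤ ∑ m ∈ Finset.range n, (iterParam μ (m + 1) - iterParam μ m) :=
        Finset.sum_le_sum fun m _ => by rw [mul_comm]; exact one_sub_sq_iterParam_le h0 h1 m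
    _ = iterParam μ n - iterParam μ 0 := Finset.sum_range_sub _ _
    _ ≤ 1 := by rw [iterParam_zero, sub_zero]; exact (iterParam_lt_one h0 n).le

lemma sum_norm_mobDeriv_succ_le {α μ : ℝ} {z : ℂ} (hα : 0 < α) (hz : 0 ≤ z.re) (h0 : 0 < μ)
    (h1 : μ < 1) (n : ℕ) :
    ∑ m ∈ Finset.range n, ‖mobDeriv α (iterParam μ (m + 1)) z‖ ≤ 1 / iterParam μ 1 :=
  (Finset.sum_le_sum fun _ _ => norm_mobDeriv_le hα hz (iterParam_nonneg h0 h1 _)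
    (iterParam_lt_one h0 _).le).trans (sum_one_sub_sq_le h0 h1 n)

/-- The gain over `sum_norm_mobDeriv_succ_le` is the factor α: it makes the Lipschitz error in F'
harmless, because α / `iterParam μ 1` stays bounded as ε → 0 although 1 / `iterParam μ 1` does not.
-/
lemma sum_norm_mob_mul_succ_le {α μ : ℝ} {z : ℂ} (hα : 0 < α) (hz : 0 ≤ z.re) (h0 : 0 < μ)
    (h1 : μ < 1) (n : ℕ) :
    ∑ m ∈ Finset.range n, ‖mob α (iterParam μ (m + 1)) z‖ * ‖mobDeriv α (iterParam μ (m + 1)) z‖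
      ≤ α * (Real.pi / 2 + 1) / iterParam μ 1 := by
  have hκ := iterParam_one_pos h0 h1
  set c := iterParam μ
  set A : ℕ → ℝ := fun m => Real.arctan (‖z‖ / α * c m) + c m with hA
  have key : ∀ m, ‖mob α (c (m + 1)) z‖ * ‖mobDeriv α (c (m + 1)) z‖ ≤
      α / c 1 * (A (m + 1) - A m) := by
    intro m
    have hlt := iterParam_lt_succ h0 h1 m
    have hX := norm_mob_mul_le hα hz (iterParam_nonneg h0 h1 m) hlt.le
      (iterParam_lt_one h0 (m + 1)).le
    have hk := one_sub_sq_iterParam_le h0 h1 m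
    have hm : 0 ≤ A (m + 1) - A m := by
      simp only [hA]
      have : ‖z‖ / α * c m ≤ ‖z‖ / α * c (m + 1) := by gcongr
      have := Real.arctan_strictMono.monotone this
      linarith [hlt.le]
    have hd : 0 < c (m + 1) - c m := sub_pos.2 hlt
    -- The common factor c_{m+1} - c_m is cancelled: 1 - c_{m+1}² is at most that increment divided
    -- by c_1.
    refine le_of_mul_le_mul_right (hX.trans ?_) hd
    have : 1 - c (m + 1) ^ 2 ≤ (c (m + 1) - c m) / c 1 := by
      rw [le_div_iff₀ hκ, mul_comm]; exact hk
    calc α * (1 - c (m + 1) ^ 2) * (Real.arctan (‖z‖ / α * c (m + 1)) -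
          Real.arctan (‖z‖ / α * c m) + (c (m + 1) - c m))
        = α * (1 - c (m + 1) ^ 2) * (A (m + 1) - A m) := by simp only [hA]; ring
      _ ≤ α * ((c (m + 1) - c m) / c 1) * (A (m + 1) - A m) := by gcongr
      _ = _ := by ring
  calc _ ≤ ∑ m ∈ Finset.range n, α / c 1 * (A (m + 1) - A m) := Finset.sum_le_sum fun m _ => key m
    _ = α / c 1 * (A n - A 0) := by rw [← Finset.mul_sum, Finset.sum_range_sub]
    _ ≤ α / c 1 * (Real.pi / 2 + 1) := by
      gcongr
      simp only [hA, c, iterParam_zero]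
      have := (Real.arctan_lt_pi_div_two (‖z‖ / α * iterParam μ n)).le
      have := (iterParam_lt_one h0 n).le
      simp; linarith
    _ = _ := by ring

lemma mob_zero {α : ℝ} (hα : 0 < α) (z : ℂ) : mob α 0 z = z := by
  have : (α : ℂ) ≠ 0 := by exact_mod_cast hα.ne'
  simp [mob]; field_simp

lemma mobDeriv_zero (α : ℝ) (z : ℂ) : mobDeriv α 0 z = 1 := by simp [mobDeriv]

/-- Composition of translations adds hyperbolic lengths: the parameters tanh(s) and tanh(ms) combine
by the addition formula for tanh, which is `hadd`. -/
lemma mob_iterate {α μ : ℝ} {z : ℂ} (hα : 0 < α) (hz : 0 ≤ z.re) (h0 : 0 < μ) (h1 : μ < 1)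
    (m : ℕ) :
    mob α (iterParam μ m) (mob α (iterParam μ 1) z) = mob α (iterParam μ (m + 1)) z := by
  have hα' : (α : ℂ) ≠ 0 := by exact_mod_cast hα.ne'
  have ha : (1 : ℂ) + iterParam μ 1 * (z / α) ≠ 0 :=
    one_add_mul_ne_zero (iterParam_nonneg h0 h1 1) (div_re_nonneg hα hz)
  have hb : (1 : ℂ) + iterParam μ (m + 1) * (z / α) ≠ 0 :=
    one_add_mul_ne_zero (iterParam_nonneg h0 h1 (m + 1)) (div_re_nonneg hα hz)
  have hq := pow_pos h0 m
  have hadd : iterParam μ (m + 1) * (1 + iterParam μ 1 * iterParam μ m) =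
      iterParam μ 1 + iterParam μ m := by
    simp only [iterParam]
    have : 0 < 1 + μ ^ m * μ := by positivity
    rw [pow_succ]
    field_simp
    ring
  have hadd' : (iterParam μ (m + 1) : ℂ) * (1 + iterParam μ 1 * iterParam μ m) =
      iterParam μ 1 + iterParam μ m := by exact_mod_cast hadd
  have hpos : 0 < 1 + iterParam μ 1 * iterParam μ m := by
    have := iterParam_nonneg h0 h1 1
    have := iterParam_nonneg h0 h1 m
    positivity
  have hpos' : (1 : ℂ) + iterParam μ 1 * iterParam μ m ≠ 0 := by exact_mod_cast hpos.ne'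
  simp only [mob]
  rw [mul_div_cancel_left₀ _ hα']
  generalize z / (α : ℂ) = ζ at *
  generalize (iterParam μ (m + 1) : ℂ) = d at *
  generalize (iterParam μ m : ℂ) = c at *
  generalize (iterParam μ 1 : ℂ) = a at *
  congr 1
  have hd : d = (a + c) / (1 + a * c) := by rw [eq_div_iff hpos', hadd']
  have hne : 1 + a * c + (a + c) * ζ ≠ 0 := by
    intro h
    apply hb
    rw [hd]
    field_simp
    linear_combination h
  have hne2 : 1 + a * ζ + c * (ζ + a) ≠ 0 := by
    intro h; apply hne; linear_combination h
  have e0 := div_mul_cancel₀ (ζ + a) ha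
  have e1 : (ζ + a) / (1 + a * ζ) + c = (1 + a * ζ)⁻¹ * (ζ + a + c * (1 + a * ζ)) := by
    rw [eq_inv_mul_iff_mul_eq₀ ha]
    linear_combination e0
  have e2 : 1 + c * ((ζ + a) / (1 + a * ζ)) = (1 + a * ζ)⁻¹ * (1 + a * ζ + c * (ζ + a)) := by
    rw [eq_inv_mul_iff_mul_eq₀ ha]
    linear_combination c * e0
  have e3 : ζ + d = (1 + a * c)⁻¹ * (ζ + a + c * (1 + a * ζ)) := by
    rw [hd]; field_simp; ring
  have e4 : 1 + d * ζ = (1 + a * c)⁻¹ * (1 + a * ζ + c * (ζ + a)) := by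
    rw [hd]; field_simp; ring
  rw [e1, e2, e3, e4, mul_div_mul_left _ _ (inv_ne_zero ha),
    mul_div_mul_left _ _ (inv_ne_zero hpos')]

lemma summable_norm_of_head_tail {f : ℕ → ℂ} {b : ℝ}
    (hb : ∀ n, ∑ m ∈ Finset.range n, ‖f (m + 1)‖ ≤ b) : Summable fun m => ‖f m‖ := by
  rw [← summable_nat_add_iff 1]
  exact summable_of_sum_range_le (fun _ => norm_nonneg _) hb

/-- The term m = 0 is kept apart because the telescoping estimates compare the term m + 1 with the
increment from c_m to c_{m+1}, and no increment ends at c_0. -/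
lemma norm_tsum_le_head_tail {f : ℕ → ℂ} {a b : ℝ} (ha : ‖f 0‖ ≤ a)
    (hb : ∀ n, ∑ m ∈ Finset.range n, ‖f (m + 1)‖ ≤ b) : ‖∑' m, f m‖ ≤ a + b := by
  have hs := summable_norm_of_head_tail hb
  refine (norm_tsum_le_tsum_norm hs).trans ?_
  rw [hs.tsum_eq_zero_add]
  exact add_le_add ha (Real.tsum_le_of_sum_range_le (fun _ => norm_nonneg _) hb)

/-! ### The series of iterated images -/

/-- A domain which is stable under the translations `mob α c`, `0 ≤ c < 1`. -/
structure IsTranslationDomain (α : ℝ) (U : Set ℂ) : Prop where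
  re_nonneg : ∀ z ∈ U, 0 ≤ z.re
  maps : ∀ c : ℝ, 0 ≤ c → c < 1 → ∀ z ∈ U, mob α c z ∈ U

/-- The series `∑ τ ^ m F (T ^ m z)` over the iterates of the translation `T` with
multiplier `μ`. -/
def imageSeries (α μ τ : ℝ) (F : ℂ → ℂ) (z : ℂ) : ℂ :=
  ∑' m : ℕ, (τ : ℂ) ^ m * F (mob α (iterParam μ m) z)

/-- The termwise derivative of `imageSeries`. -/
def imageSeriesDeriv (α μ τ : ℝ) (F : ℂ → ℂ) (z : ℂ) : ℂ :=
  ∑' m : ℕ, (τ : ℂ) ^ m *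
    (deriv F (mob α (iterParam μ m) z) * mobDeriv α (iterParam μ m) z)

/-- The termwise derivative of `imageSeries` for `F = id`. -/
def linSeriesDeriv (α μ τ : ℝ) (z : ℂ) : ℂ :=
  ∑' m : ℕ, (τ : ℂ) ^ m * mobDeriv α (iterParam μ m) z

lemma summable_pow_mul_of_bounded {τ B : ℝ} (hτ : |τ| < 1) {f : ℕ → ℂ} (hf : ∀ m, ‖f m‖ ≤ B) :
    Summable fun m => (τ : ℂ) ^ m * f m := by
  refine Summable.of_norm_bounded (g := fun m => |τ| ^ m * B)
    ((summable_geometric_of_lt_one (abs_nonneg _) hτ).mul_right B) fun m => ?_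
  rw [norm_mul, norm_pow, Complex.norm_real, Real.norm_eq_abs]
  exact mul_le_mul_of_nonneg_left (hf m) (by positivity)

lemma norm_pow_mul_le {τ : ℝ} (hτ : |τ| < 1) (m : ℕ) (w : ℂ) : ‖(τ : ℂ) ^ m * w‖ ≤ ‖w‖ := by
  rw [norm_mul, norm_pow, Complex.norm_real, Real.norm_eq_abs]
  exact mul_le_of_le_one_left (norm_nonneg _) (pow_le_one₀ (abs_nonneg _) hτ.le)

section

variable {α μ τ : ℝ} {F : ℂ → ℂ} {U : Set ℂ} {B : ℝ}

lemma IsTranslationDomain.iterate_mem (hU : IsTranslationDomain α U) (h0 : 0 < μ) (h1 : μ < 1)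
    {z : ℂ} (hz : z ∈ U) (m : ℕ) : mob α (iterParam μ m) z ∈ U :=
  hU.maps _ (iterParam_nonneg h0 h1 m) (iterParam_lt_one h0 m) z hz

lemma continuousOn_imageSeries (hα : 0 < α) (hU : IsTranslationDomain α U) (h0 : 0 < μ)
    (h1 : μ < 1) (hτ : |τ| < 1) (hF : ContinuousOn F U) (hB : ∀ z ∈ U, ‖F z‖ ≤ B) :
    ContinuousOn (imageSeries α μ τ F) U := by
  refine continuousOn_tsum (u := fun m => |τ| ^ m * B) (fun m => ?_)
    ((summable_geometric_of_lt_one (abs_nonneg _) hτ).mul_right B) fun m z hz => ?_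
  · refine continuousOn_const.mul (hF.comp ?_ fun z hz => hU.iterate_mem h0 h1 hz m)
    exact fun z hz => (hasDerivAt_mob hα (hU.re_nonneg z hz)
      (iterParam_nonneg h0 h1 m)).continuousAt.continuousWithinAt
  · rw [norm_mul, norm_pow, Complex.norm_real, Real.norm_eq_abs]
    exact mul_le_mul_of_nonneg_left (hB _ (hU.iterate_mem h0 h1 hz m)) (by positivity)

/-- A shift of the index. This functional equation is all that the verification of the boundary and
transmission conditions uses about the series. -/
lemma imageSeries_eq (hα : 0 < α) (hU : IsTranslationDomain α U) (h0 : 0 < μ)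
    (h1 : μ < 1) (hτ : |τ| < 1) (hB : ∀ z ∈ U, ‖F z‖ ≤ B) {z : ℂ} (hz : z ∈ U) :
    imageSeries α μ τ F z = F z + τ * imageSeries α μ τ F (mob α (iterParam μ 1) z) := by
  have hs : Summable fun m => (τ : ℂ) ^ m * F (mob α (iterParam μ m) z) :=
    summable_pow_mul_of_bounded hτ fun m => hB _ (hU.iterate_mem h0 h1 hz m)
  rw [imageSeries, hs.tsum_eq_zero_add, imageSeries, ← tsum_mul_left]
  simp only [iterParam_zero, mob_zero hα, pow_zero, one_mul]
  congr 2
  ext m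
  rw [mob_iterate hα (hU.re_nonneg z hz) h0 h1 m, pow_succ]
  ring

lemma hasDerivAt_imageSeries (hα : 0 < α) (hU : IsTranslationDomain α U) (hUo : IsOpen U)
    (h0 : 0 < μ) (h1 : μ < 1) (hτ : |τ| < 1) (hF : DifferentiableOn ℂ F U)
    (hB : ∀ z ∈ U, ‖F z‖ ≤ B) {z : ℂ} (hz : z ∈ U) :
    HasDerivAt (imageSeries α μ τ F) (imageSeriesDeriv α μ τ F z) z := by
  have hterm : ∀ m : ℕ, ∀ w ∈ U, HasDerivAt (fun z => (τ : ℂ) ^ m * F (mob α (iterParam μ m) z))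
      ((τ : ℂ) ^ m * (deriv F (mob α (iterParam μ m) w) * mobDeriv α (iterParam μ m) w)) w := by
    intro m w hw
    have hFd := (hF.differentiableAt (hUo.mem_nhds (hU.iterate_mem h0 h1 hw m))).hasDerivAt
    exact (hFd.comp w (hasDerivAt_mob hα (hU.re_nonneg w hw)
      (iterParam_nonneg h0 h1 m))).const_mul _
  have hu := (summable_geometric_of_lt_one (abs_nonneg _) hτ).mul_right B
  have hd : ∀ m : ℕ, DifferentiableOn ℂ (fun z => (τ : ℂ) ^ m * F (mob α (iterParam μ m) z)) U :=
    fun m w hw => (hterm m w hw).differentiableAt.differentiableWithinAt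
  have hle : ∀ (m : ℕ) (w : ℂ), w ∈ U → ‖(τ : ℂ) ^ m * F (mob α (iterParam μ m) w)‖ ≤
      |τ| ^ m * B := by
    intro m w hw
    rw [norm_mul, norm_pow, Complex.norm_real, Real.norm_eq_abs]
    exact mul_le_mul_of_nonneg_left (hB _ (hU.iterate_mem h0 h1 hw m)) (by positivity)
  have hD := (differentiableOn_tsum_of_summable_norm hu hd hUo hle).differentiableAt
    (hUo.mem_nhds hz)
  refine hD.hasDerivAt.congr_deriv ?_
  rw [← (hasSum_deriv_of_summable_norm hu hd hUo hle hz).tsum_eq]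
  exact tsum_congr fun m => (hterm m z hz).deriv

/-- The crude bound without cancellation, sufficient when ε is bounded away from 0. -/
lemma norm_imageSeriesDeriv_le {C : ℝ} (hα : 0 < α) (hU : IsTranslationDomain α U)
    (h0 : 0 < μ) (h1 : μ < 1) (hτ : |τ| < 1) (hC : ∀ z ∈ U, ‖deriv F z‖ ≤ C)
    {z : ℂ} (hz : z ∈ U) :
    ‖imageSeriesDeriv α μ τ F z‖ ≤ C + C * (1 / iterParam μ 1) := by
  have hz0 := hU.re_nonneg z hz
  have hC0 : 0 ≤ C := (norm_nonneg _).trans (hC z hz)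
  refine norm_tsum_le_head_tail ?_ fun n => ?_
  · simpa [iterParam_zero, mob_zero hα, mobDeriv_zero] using hC z hz
  · calc _ ≤ ∑ m ∈ Finset.range n, C * ‖mobDeriv α (iterParam μ (m + 1)) z‖ := by
          refine Finset.sum_le_sum fun m _ => (norm_pow_mul_le hτ _ _).trans ?_
          rw [norm_mul]
          exact mul_le_mul_of_nonneg_right (hC _ (hU.iterate_mem h0 h1 hz _)) (norm_nonneg _)
      _ ≤ _ := by
          rw [← Finset.mul_sum]
          exact mul_le_mul_of_nonneg_left (sum_norm_mobDeriv_succ_le hα hz0 h0 h1 n) hC0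

/-- The derivative of `F` is frozen at its value `f₀` at the touching point, which is `y₀` in the
translated coordinate. An image w contributes at most K(‖w‖ + α) times the derivative of the
translation. The head contributes 2C. -/
lemma norm_imageSeriesDeriv_sub_le {C K : ℝ} {f₀ y₀ : ℂ} (hα : 0 < α)
    (hU : IsTranslationDomain α U) (h0 : 0 < μ) (h1 : μ < 1) (hτ : |τ| < 1)
    (hC : ∀ z ∈ U, ‖deriv F z‖ ≤ C) (hf : ‖f₀‖ ≤ C) (hK0 : 0 ≤ K) (hy : ‖y₀‖ ≤ α)
    (hK : ∀ z ∈ U, ‖deriv F z - f₀‖ ≤ K * ‖z - y₀‖) {z : ℂ} (hz : z ∈ U) :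
    ‖imageSeriesDeriv α μ τ F z - f₀ * linSeriesDeriv α μ τ z‖ ≤
      2 * C + K * (α / iterParam μ 1 * (Real.pi / 2 + 2)) := by
  have hz0 := hU.re_nonneg z hz
  have hs1 : Summable fun m => (τ : ℂ) ^ m *
      (deriv F (mob α (iterParam μ m) z) * mobDeriv α (iterParam μ m) z) := by
    refine summable_pow_mul_of_bounded (B := C) hτ fun m => ?_
    have := norm_mobDeriv_le hα hz0 (iterParam_nonneg h0 h1 m) (iterParam_lt_one h0 m).le
    have h2 := hC _ (hU.iterate_mem h0 h1 hz m)
    rw [norm_mul]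
    nlinarith [sq_nonneg (iterParam μ m), norm_nonneg (mobDeriv α (iterParam μ m) z),
      norm_nonneg (deriv F (mob α (iterParam μ m) z))]
  have hs2 : Summable fun m => (τ : ℂ) ^ m * mobDeriv α (iterParam μ m) z :=
    summable_pow_mul_of_bounded (B := 1) hτ fun m =>
      (norm_mobDeriv_le hα hz0 (iterParam_nonneg h0 h1 m) (iterParam_lt_one h0 m).le).trans
        (by nlinarith [sq_nonneg (iterParam μ m)])
  rw [imageSeriesDeriv, linSeriesDeriv, ← tsum_mul_left, ← hs1.tsum_sub (hs2.mul_left f₀)]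
  have hcongr : ∀ m : ℕ, (τ : ℂ) ^ m *
      (deriv F (mob α (iterParam μ m) z) * mobDeriv α (iterParam μ m) z) -
        f₀ * ((τ : ℂ) ^ m * mobDeriv α (iterParam μ m) z) =
      (τ : ℂ) ^ m * ((deriv F (mob α (iterParam μ m) z) - f₀) * mobDeriv α (iterParam μ m) z) :=
    fun m => by ring
  rw [tsum_congr hcongr]
  refine norm_tsum_le_head_tail ?_ fun n => ?_
  · simp only [iterParam_zero, mob_zero hα, mobDeriv_zero, pow_zero, one_mul, mul_one]
    exact (norm_sub_le _ _).trans (by linarith [hC z hz])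
  · have hterm : ∀ m, ‖(τ : ℂ) ^ (m + 1) * ((deriv F (mob α (iterParam μ (m + 1)) z) - f₀) *
        mobDeriv α (iterParam μ (m + 1)) z)‖ ≤
        K * (‖mob α (iterParam μ (m + 1)) z‖ * ‖mobDeriv α (iterParam μ (m + 1)) z‖ +
          α * ‖mobDeriv α (iterParam μ (m + 1)) z‖) := by
      intro m
      refine (norm_pow_mul_le hτ _ _).trans ?_
      rw [norm_mul, ← add_mul, ← mul_assoc]
      refine mul_le_mul_of_nonneg_right
        ((hK _ (hU.iterate_mem h0 h1 hz _)).trans ?_) (norm_nonneg _)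
      exact mul_le_mul_of_nonneg_left ((norm_sub_le _ _).trans (by linarith)) hK0
    refine (Finset.sum_le_sum fun m _ => hterm m).trans ?_
    rw [← Finset.mul_sum, Finset.sum_add_distrib, ← Finset.mul_sum]
    refine mul_le_mul_of_nonneg_left ?_ hK0
    have e1 := sum_norm_mob_mul_succ_le hα hz0 h0 h1 n
    have e2 := mul_le_mul_of_nonneg_left (sum_norm_mobDeriv_succ_le hα hz0 h0 h1 n) hα.le
    calc _ ≤ α * (Real.pi / 2 + 1) / iterParam μ 1 + α * (1 / iterParam μ 1) := add_le_add e1 e2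
      _ = _ := by ring

/-- Abel summation: (1 - τ) Σ τ^m p_m = p_0 + τ Σ τ^m (p_{m+1} - p_m). The right side is bounded by
1 plus the total variation π + 1, and for τ ≤ 0 the factor 1 - τ is at least 1. -/
lemma norm_linSeriesDeriv_le_of_nonpos (hα : 0 < α) {z : ℂ} (hz : 0 ≤ z.re) (h0 : 0 < μ)
    (h1 : μ < 1) (hτ : -1 < τ) (hτ0 : τ ≤ 0) :
    ‖linSeriesDeriv α μ τ z‖ ≤ Real.pi + 2 := by
  have hτ' : |τ| < 1 := abs_lt.2 ⟨hτ, by linarith⟩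
  set p : ℕ → ℂ := fun m => mobDeriv α (iterParam μ m) z with hp
  have hp1 : ∀ m, ‖p m‖ ≤ 1 := fun m =>
    (norm_mobDeriv_le hα hz (iterParam_nonneg h0 h1 m) (iterParam_lt_one h0 m).le).trans
      (by nlinarith [sq_nonneg (iterParam μ m)])
  have hs := summable_pow_mul_of_bounded hτ' hp1
  have hs' := summable_pow_mul_of_bounded hτ' fun m => hp1 (m + 1)
  have hsd : ∀ n, ∑ m ∈ Finset.range n, ‖p (m + 1) - p m‖ ≤ Real.pi + 1 := by
    intro n
    calc _ ≤ ∑ m ∈ Finset.range n,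
          (mobVar α z (iterParam μ (m + 1)) - mobVar α z (iterParam μ m)) :=
          Finset.sum_le_sum fun m _ => norm_mobDeriv_sub_le hα hz (iterParam_nonneg h0 h1 m)
            (iterParam_lt_succ h0 h1 m).le
      _ = mobVar α z (iterParam μ n) := by
          rw [Finset.sum_range_sub (fun m => mobVar α z (iterParam μ m)), iterParam_zero,
            mobVar_zero, sub_zero]
      _ ≤ _ := mobVar_le α z (iterParam_nonneg h0 h1 n) (iterParam_lt_one h0 n).le
  have key : (1 - (τ : ℂ)) * ∑' m, (τ : ℂ) ^ m * p m =
      p 0 + τ * ∑' m, (τ : ℂ) ^ m * (p (m + 1) - p m) := by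
    have e : ∑' m, (τ : ℂ) ^ m * (p (m + 1) - p m) =
        ∑' m, (τ : ℂ) ^ m * p (m + 1) - ∑' m, (τ : ℂ) ^ m * p m := by
      rw [← hs'.tsum_sub hs]
      exact tsum_congr fun m => by ring
    have e2 : ∑' m, (τ : ℂ) ^ m * p m = p 0 + τ * ∑' m, (τ : ℂ) ^ m * p (m + 1) := by
      rw [hs.tsum_eq_zero_add, ← tsum_mul_left]
      simp only [pow_zero, one_mul]
      congr 1
      exact tsum_congr fun m => by ring
    rw [e]
    linear_combination e2
  have hnorm : ‖(1 - (τ : ℂ)) * ∑' m, (τ : ℂ) ^ m * p m‖ ≤ 1 + (Real.pi + 1) := by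
    rw [key]
    refine (norm_add_le _ _).trans (add_le_add (hp1 0) ?_)
    rw [norm_mul, Complex.norm_real, Real.norm_eq_abs]
    have : ‖∑' m, (τ : ℂ) ^ m * (p (m + 1) - p m)‖ ≤ Real.pi + 1 := by
      have hsum : Summable fun m => ‖p (m + 1) - p m‖ :=
        summable_of_sum_range_le (fun _ => norm_nonneg _) hsd
      refine (tsum_of_norm_bounded hsum.hasSum fun m => norm_pow_mul_le hτ' m _).trans ?_
      exact Real.tsum_le_of_sum_range_le (fun _ => norm_nonneg _) hsd
    have h2 := abs_nonneg τ
    nlinarith [Real.pi_pos, norm_nonneg (∑' m, (τ : ℂ) ^ m * (p (m + 1) - p m))]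
  rw [norm_mul] at hnorm
  have h3 : 1 ≤ ‖1 - (τ : ℂ)‖ := by
    have : (1 - (τ : ℂ)) = ((1 - τ : ℝ) : ℂ) := by push_cast; ring
    rw [this, Complex.norm_real, Real.norm_of_nonneg (by linarith)]
    linarith
  calc ‖linSeriesDeriv α μ τ z‖ ≤ ‖1 - (τ : ℂ)‖ * ‖linSeriesDeriv α μ τ z‖ :=
        le_mul_of_one_le_left (norm_nonneg _) h3
    _ ≤ 1 + (Real.pi + 1) := hnorm
    _ = _ := by ring

end

/-! ### Riemann sums of functions of bounded variation -/

/-- On each cell of length h the error is at most h times the increment of `V`, and these increments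
telescope. The error is linear in h with no smoothness constant, so it survives division by h. -/
lemma norm_riemann_sum_sub_integral_le {f : ℝ → ℂ} {V : ℝ → ℝ} {h B : ℝ} (hh : 0 < h)
    (hf : IntegrableOn f (Ioi 0)) (hfc : ContinuousOn f (Ici 0))
    (hV : ∀ s t, 0 ≤ s → s ≤ t → ‖f t - f s‖ ≤ V t - V s)
    (hVB : ∀ t, 0 ≤ t → V t - V 0 ≤ B) (hs : Summable fun m : ℕ => f (m * h)) :
    ‖h * ∑' m : ℕ, f (m * h) - ∫ t in Ioi (0 : ℝ), f t‖ ≤ h * B := by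
  have hint : ∀ a b : ℝ, 0 ≤ a → 0 ≤ b → IntervalIntegrable f volume a b := fun a b ha hb =>
    (hfc.mono fun x hx => (le_inf ha hb).trans hx.1).intervalIntegrable
  have hpart : ∀ n : ℕ, ‖h * ∑ m ∈ Finset.range n, f (m * h) -
      ∫ t in (0 : ℝ)..(n * h), f t‖ ≤ h * B := by
    intro n
    have hsplit : ∑ m ∈ Finset.range n, ∫ t in ((m : ℕ) * h)..((m + 1 : ℕ) * h), f t =
        ∫ t in (0 : ℝ)..(n * h), f t := by
      have := intervalIntegral.sum_integral_adjacent_intervals (f := f) (μ := volume)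
        (a := fun m : ℕ => (m : ℝ) * h) (n := n)
        (fun k _ => hint _ _ (by positivity) (by positivity))
      simpa using this
    rw [← hsplit, Finset.mul_sum, ← Finset.sum_sub_distrib]
    refine (norm_sum_le _ _).trans ?_
    calc _ ≤ ∑ m ∈ Finset.range n, h * (V ((m + 1 : ℕ) * h) - V ((m : ℕ) * h)) := by
          refine Finset.sum_le_sum fun m _ => ?_
          have hm0 : (0 : ℝ) ≤ m * h := by positivity
          have hm1 : (m : ℝ) * h ≤ (m + 1 : ℕ) * h := by push_cast; nlinarith
          have e : (h : ℂ) * f (m * h) = ∫ _ in ((m : ℕ) * h)..((m + 1 : ℕ) * h), f (m * h) := by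
            rw [intervalIntegral.integral_const]
            rw [Complex.real_smul]
            push_cast
            ring
          rw [e, ← intervalIntegral.integral_sub (by simp) (hint _ _ hm0 (hm0.trans hm1))]
          refine (intervalIntegral.norm_integral_le_of_norm_le_const
            (C := V ((m + 1 : ℕ) * h) - V ((m : ℕ) * h)) fun t ht => ?_).trans ?_
          · rw [uIoc_of_le hm1] at ht
            rw [norm_sub_rev]
            have h1 := hV _ t hm0 ht.1.le
            have h2 := (norm_nonneg _).trans (hV t _ (hm0.trans ht.1.le) ht.2)
            linarith
          · rw [abs_of_nonneg (by linarith)]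
            push_cast
            linarith
      _ = h * (V (n * h) - V 0) := by
          rw [← Finset.mul_sum, Finset.sum_range_sub (fun m : ℕ => V ((m : ℕ) * h))]
          simp
      _ ≤ _ := mul_le_mul_of_nonneg_left (hVB _ (by positivity)) hh.le
  have ht : Tendsto (fun n : ℕ => h * ∑ m ∈ Finset.range n, f (m * h) -
      ∫ t in (0 : ℝ)..(n * h), f t) atTop
      (𝓝 (h * ∑' m : ℕ, f (m * h) - ∫ t in Ioi (0 : ℝ), f t)) := by
    refine (hs.hasSum.tendsto_sum_nat.const_mul _).sub ?_
    exact intervalIntegral_tendsto_integral_Ioi 0 hf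
      (tendsto_natCast_atTop_atTop.atTop_mul_const hh)
  exact le_of_tendsto ht.norm (Eventually.of_forall hpart)

/-! ### The Lerch function in bipolar coordinates -/

/-- The parameter of the translation `ξ ↦ ξ + t`. -/
def transParam (t : ℝ) : ℝ := (1 - Real.exp (-t)) / (1 + Real.exp (-t))

lemma iterParam_exp (s : ℝ) (m : ℕ) :
    iterParam (Real.exp (-(2 * s))) m = transParam (m * (2 * s)) := by
  rw [iterParam, transParam, ← Real.exp_nat_mul]
  ring_nf

lemma transParam_nonneg {t : ℝ} (ht : 0 ≤ t) : 0 ≤ transParam t := by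
  have : Real.exp (-t) ≤ 1 := Real.exp_le_one_iff.2 (by linarith)
  exact div_nonneg (by linarith) (by positivity)

lemma transParam_lt_one (t : ℝ) : transParam t < 1 := by
  have := Real.exp_pos (-t)
  rw [transParam, div_lt_one (by positivity)]; linarith

lemma transParam_zero : transParam 0 = 0 := by simp [transParam]

lemma transParam_mono : Monotone transParam := by
  intro s t hst
  have : Real.exp (-t) ≤ Real.exp (-s) := Real.exp_le_exp.2 (by linarith)
  rw [transParam, transParam, div_le_div_iff₀ (by positivity) (by positivity)]
  nlinarith

lemma continuous_transParam : Continuous transParam := by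
  unfold transParam
  exact Continuous.div (by fun_prop) (by fun_prop) fun t => by positivity

lemma one_sub_transParam_le (t : ℝ) : 1 - transParam t ≤ 2 * Real.exp (-t) := by
  have := Real.exp_pos (-t)
  have e : 1 - transParam t = 2 * Real.exp (-t) / (1 + Real.exp (-t)) := by
    rw [transParam]; field_simp; ring
  rw [e]
  exact div_le_self (by positivity) (by linarith)

lemma one_sub_sq_transParam_le {t : ℝ} (ht : 0 ≤ t) :
    1 - transParam t ^ 2 ≤ 4 * Real.exp (-t) := by
  have h1 := one_sub_transParam_le t
  have h2 := transParam_lt_one t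
  have h3 := transParam_nonneg ht
  nlinarith

lemma integrableOn_exp_neg_Ioi : IntegrableOn (fun t : ℝ => Real.exp (-t)) (Ioi 0) := by
  simpa using exp_neg_integrableOn_Ioi 0 one_pos

lemma integral_exp_neg_Ioi' : ∫ t in Ioi (0 : ℝ), Real.exp (-t) = 1 := by
  rw [integral_exp_neg_Ioi]; simp

/-- The Laplace transform of the derivative of the translations. -/
def mobDerivLaplace (α β : ℝ) (z : ℂ) : ℂ :=
  ∫ t in Ioi (0 : ℝ), (Real.exp (-(β * t)) : ℂ) * mobDeriv α (transParam t) z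

section

variable {α β : ℝ} {z : ℂ}

lemma continuousOn_laplaceIntegrand (hα : 0 < α) (hz : 0 ≤ z.re) (β : ℝ) :
    ContinuousOn (fun t : ℝ => (Real.exp (-(β * t)) : ℂ) * mobDeriv α (transParam t) z)
      (Ici 0) := by
  have h1 : Continuous fun t : ℝ => (Real.exp (-(β * t)) : ℂ) := by fun_prop
  refine h1.continuousOn.mul fun t ht => ?_
  have h2 := (hasDerivAt_mobDeriv_param hα hz (transParam_nonneg ht)).continuousAt
  exact (ContinuousAt.comp (f := transParam) h2
    continuous_transParam.continuousAt).continuousWithinAt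

lemma norm_mobDeriv_transParam_le (hα : 0 < α) (hz : 0 ≤ z.re) {t : ℝ} (ht : 0 ≤ t) :
    ‖mobDeriv α (transParam t) z‖ ≤ 4 * Real.exp (-t) :=
  (norm_mobDeriv_le hα hz (transParam_nonneg ht) (transParam_lt_one t).le).trans
    (one_sub_sq_transParam_le ht)

lemma exp_neg_mul_le_one (hβ : 0 ≤ β) {t : ℝ} (ht : 0 ≤ t) : Real.exp (-(β * t)) ≤ 1 :=
  Real.exp_le_one_iff.2 (by nlinarith)

lemma norm_laplaceIntegrand_le (hα : 0 < α) (hz : 0 ≤ z.re) (hβ : 0 ≤ β) {t : ℝ} (ht : 0 ≤ t) :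
    ‖(Real.exp (-(β * t)) : ℂ) * mobDeriv α (transParam t) z‖ ≤ 4 * Real.exp (-t) := by
  rw [norm_mul, Complex.norm_real, Real.norm_of_nonneg (Real.exp_pos _).le]
  exact (mul_le_of_le_one_left (norm_nonneg _) (exp_neg_mul_le_one hβ ht)).trans
    (norm_mobDeriv_transParam_le hα hz ht)

lemma integrableOn_laplaceIntegrand (hα : 0 < α) (hz : 0 ≤ z.re) (hβ : 0 ≤ β) :
    IntegrableOn (fun t : ℝ => (Real.exp (-(β * t)) : ℂ) * mobDeriv α (transParam t) z)
      (Ioi 0) := by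
  refine Integrable.mono' (integrableOn_exp_neg_Ioi.const_mul 4)
    (((continuousOn_laplaceIntegrand hα hz β).mono Ioi_subset_Ici_self).aestronglyMeasurable
      measurableSet_Ioi) ?_
  filter_upwards [ae_restrict_mem measurableSet_Ioi] with t ht
  exact norm_laplaceIntegrand_le hα hz hβ (le_of_lt ht)

lemma norm_mobDerivLaplace_le (hα : 0 < α) (hz : 0 ≤ z.re) (hβ : 0 ≤ β) :
    ‖mobDerivLaplace α β z‖ ≤ 4 := by
  have := norm_integral_le_of_norm_le (integrableOn_exp_neg_Ioi.const_mul 4)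
    ((ae_restrict_mem measurableSet_Ioi).mono fun t (ht : t ∈ Ioi (0 : ℝ)) =>
      norm_laplaceIntegrand_le hα hz hβ (le_of_lt ht))
  rw [integral_const_mul, integral_exp_neg_Ioi', mul_one] at this
  exact this

/-- Translation by t multiplies u = (α - z)/(α + z) by e^(-t), and the point M with coordinate u
satisfies (M - α)/(2α) = -u/(1 + u). Thus the Lerch integrand is a translate of z weighted by
e^(-βt). -/
lemma lerch_integrand_eq (hα : 0 < α) (hz : 0 ≤ z.re) {t : ℝ} (ht : 0 ≤ t) :
    -((α - z) / (α + z) * (Real.exp (-(β + 1) * t) : ℂ) /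
      (1 + (α - z) / (α + z) * (Real.exp (-t) : ℂ))) =
    (Real.exp (-(β * t)) : ℂ) * ((mob α (transParam t) z - α) / (2 * α)) := by
  have hα' : (α : ℂ) ≠ 0 := by exact_mod_cast hα.ne'
  have e1 : Real.exp (-(β + 1) * t) = Real.exp (-(β * t)) * Real.exp (-t) := by
    rw [← Real.exp_add]; ring_nf
  have hq := Real.exp_pos (-t)
  have hq1 : Real.exp (-t) ≤ 1 := Real.exp_le_one_iff.2 (by linarith)
  rw [e1, mob, transParam]
  generalize Real.exp (-t) = q at *
  generalize Real.exp (-(β * t)) = E at *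
  have h1 : (α : ℂ) + z ≠ 0 := by
    intro h
    have := congrArg Complex.re h
    simp at this; linarith
  have h2 : (α : ℂ) * (1 + q) + z * (1 - q) ≠ 0 := by
    intro h
    have := congrArg Complex.re h
    simp at this
    nlinarith
  have h3 : (1 : ℂ) + q ≠ 0 := by
    exact_mod_cast (by positivity : (1 : ℝ) + q ≠ 0)
  push_cast
  have e2 : (1 : ℂ) + (α - z) / (α + z) * q = (α * (1 + q) + z * (1 - q)) / (α + z) := by
    field_simp; ring
  have e3 : (1 : ℂ) + (1 - q) / (1 + q) * (z / α) =
      (α * (1 + q) + z * (1 - q)) / ((1 + q) * α) := by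
    field_simp
  rw [e2, e3]
  field_simp
  ring

/-- Differentiation under the integral sign, with the majorant 4e^(-t)/(2α) valid on the whole right
half-plane. It identifies the continuous limit of the image sum with a Lerch function. -/
lemma hasDerivAt_lerchL_comp (hα : 0 < α) (hβ : 0 ≤ β) (hz : 0 < z.re) :
    HasDerivAt (fun z : ℂ => lerchL ((α - z) / (α + z)) β)
      (1 / (2 * α) * mobDerivLaplace α β z) z := by
  have hS : {w : ℂ | 0 < w.re} ∈ 𝓝 z := (isOpen_lt continuous_const continuous_re).mem_nhds hz
  set Ψ : ℂ → ℝ → ℂ := fun w t =>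
    (Real.exp (-(β * t)) : ℂ) * ((mob α (transParam t) w - α) / (2 * α)) with hΨ
  set Ψ' : ℂ → ℝ → ℂ := fun w t =>
    1 / (2 * α) * ((Real.exp (-(β * t)) : ℂ) * mobDeriv α (transParam t) w) with hΨ'
  have hcont : ∀ w ∈ {w : ℂ | 0 < w.re}, ContinuousOn (Ψ w) (Ici 0) := by
    intro w hw
    have h1 : Continuous fun t : ℝ => (Real.exp (-(β * t)) : ℂ) := by fun_prop
    refine h1.continuousOn.mul ((ContinuousOn.sub ?_ continuousOn_const).div_const _)
    unfold mob
    have h2 := continuous_transParam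
    refine continuousOn_const.mul (ContinuousOn.div (by fun_prop) (by fun_prop) fun t ht => ?_)
    exact one_add_mul_ne_zero (transParam_nonneg ht) (div_re_nonneg hα (le_of_lt hw))
  have hmeas : ∀ w ∈ {w : ℂ | 0 < w.re},
      AEStronglyMeasurable (Ψ w) (volume.restrict (Ioi 0)) := fun w hw =>
    ((hcont w hw).mono Ioi_subset_Ici_self).aestronglyMeasurable measurableSet_Ioi
  have hint : Integrable (Ψ z) (volume.restrict (Ioi 0)) := by
    refine Integrable.mono' (integrableOn_exp_neg_Ioi.const_mul ‖z / α - 1‖) (hmeas z hz) ?_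
    filter_upwards [ae_restrict_mem measurableSet_Ioi] with t ht
    have ht : (0 : ℝ) ≤ t := le_of_lt ht
    have hα' : (α : ℂ) ≠ 0 := by exact_mod_cast hα.ne'
    have hne := one_add_mul_ne_zero (transParam_nonneg ht) (div_re_nonneg hα hz.le)
    have h1 := one_le_norm_one_add (transParam_nonneg ht) (div_re_nonneg hα hz.le)
    -- The factor 1 - `transParam t`, of size e^(-t), is exposed; it gives integrability even for β
    -- = 0.
    have e : (mob α (transParam t) z - α) / (2 * α) =
        ((1 - transParam t : ℝ) : ℂ) / 2 * ((z / α - 1) / (1 + transParam t * (z / α))) := by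
      rw [mob]
      generalize z / (α : ℂ) = ζ at *
      have hX : (ζ + transParam t) / (1 + transParam t * ζ) - 1 =
          (1 - transParam t) * ((ζ - 1) / (1 + transParam t * ζ)) := by
        rw [div_sub_one hne, mul_div_assoc']
        congr 1
        ring
      have hY : (α * ((ζ + transParam t) / (1 + transParam t * ζ)) - α) / (2 * α) =
          ((ζ + transParam t) / (1 + transParam t * ζ) - 1) / 2 := by
        rw [← mul_sub_one, mul_comm 2 (α : ℂ), mul_div_mul_left _ _ hα']
      rw [hY, hX]
      push_cast
      ring
    have h2 : 0 ≤ 1 - transParam t := by linarith [transParam_lt_one t]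
    have h3 := one_sub_transParam_le t
    rw [hΨ, norm_mul, Complex.norm_real, Real.norm_of_nonneg (Real.exp_pos _).le, e]
    refine (mul_le_of_le_one_left (norm_nonneg _) (exp_neg_mul_le_one hβ ht)).trans ?_
    rw [norm_mul, norm_div, norm_div, Complex.norm_real, Real.norm_of_nonneg h2, mul_comm]
    have h4 : ‖z / (α : ℂ) - 1‖ / ‖1 + (transParam t : ℂ) * (z / α)‖ ≤ ‖z / (α : ℂ) - 1‖ :=
      div_le_self (norm_nonneg _) h1
    refine mul_le_mul h4 ?_ (by positivity) (norm_nonneg _)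
    norm_num
    linarith
  have key := hasDerivAt_integral_of_dominated_loc_of_deriv_le (μ := volume.restrict (Ioi 0))
    (F := Ψ) (F' := Ψ') (x₀ := z) (s := {w : ℂ | 0 < w.re})
    (bound := fun t => 1 / (2 * α) * (4 * Real.exp (-t))) hS
    (by filter_upwards [hS] with w hw using hmeas w hw) hint
    ((((continuousOn_laplaceIntegrand hα hz.le β).const_smul (1 / (2 * α) : ℂ)).mono
      Ioi_subset_Ici_self).aestronglyMeasurable measurableSet_Ioi)
    (by
      filter_upwards [ae_restrict_mem measurableSet_Ioi] with t ht w hw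
      rw [hΨ', norm_mul]
      have : ‖(1 / (2 * α) : ℂ)‖ = 1 / (2 * α) := by
        simp [abs_of_pos hα]
      rw [this]
      exact mul_le_mul_of_nonneg_left (norm_laplaceIntegrand_le hα (le_of_lt hw) hβ (le_of_lt ht))
        (by positivity))
    ((integrableOn_exp_neg_Ioi.const_mul 4).const_mul _)
    (by
      filter_upwards [ae_restrict_mem measurableSet_Ioi] with t ht w hw
      have := ((hasDerivAt_mob hα (le_of_lt hw) (transParam_nonneg (le_of_lt ht))).sub_const
        (α : ℂ)).div_const (2 * α : ℂ)
      refine (this.const_mul (Real.exp (-(β * t)) : ℂ)).congr_deriv ?_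
      rw [hΨ']
      ring)
  refine (key.2.congr_of_eventuallyEq ?_).congr_deriv ?_
  · filter_upwards [hS] with w hw
    rw [lerchL, ← integral_neg]
    exact setIntegral_congr_fun measurableSet_Ioi fun t ht =>
      lerch_integrand_eq hα (le_of_lt hw) (le_of_lt ht)
  · rw [hΨ', mobDerivLaplace, ← integral_const_mul]

/-- Since xte^(-xt) ≤ 1, the difference is controlled by the relative error of the exponents,
uniformly in t. Relative errors are essential: as τ varies in (0, 1) the exponents may be
arbitrarily small or large. The two quotients cover both orders of b and β. -/
lemma abs_exp_sub_exp_le {b t : ℝ} (hb : 0 < b) (hβ : 0 < β) (ht : 0 ≤ t) :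
    |Real.exp (-(b * t)) - Real.exp (-(β * t))| ≤ |b - β| / b + |b - β| / β := by
  have key : ∀ x y : ℝ, 0 < x → x ≤ y →
      Real.exp (-(x * t)) - Real.exp (-(y * t)) ≤ (y - x) / x := by
    intro x y hx hxy
    have h1 : Real.exp (-(y * t)) = Real.exp (-(x * t)) * Real.exp (-((y - x) * t)) := by
      rw [← Real.exp_add]; ring_nf
    have h2 := Real.add_one_le_exp (-((y - x) * t))
    have h3 : x * t * Real.exp (-(x * t)) ≤ 1 := by
      have := Real.add_one_le_exp (x * t)
      rw [Real.exp_neg, ← div_eq_mul_inv, div_le_one (Real.exp_pos _)]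
      linarith
    rw [h1, le_div_iff₀ hx]
    have h4 := Real.exp_pos (-(x * t))
    have h5 : 0 ≤ y - x := by linarith
    calc (Real.exp (-(x * t)) - Real.exp (-(x * t)) * Real.exp (-((y - x) * t))) * x
        = x * Real.exp (-(x * t)) * (1 - Real.exp (-((y - x) * t))) := by ring
      _ ≤ x * Real.exp (-(x * t)) * ((y - x) * t) := by gcongr; linarith
      _ = (y - x) * (x * t * Real.exp (-(x * t))) := by ring
      _ ≤ (y - x) * 1 := by gcongr
      _ = _ := mul_one _
  have mono : ∀ x y : ℝ, x ≤ y → Real.exp (-(y * t)) ≤ Real.exp (-(x * t)) := fun x y h =>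
    Real.exp_le_exp.2 (by nlinarith)
  have p1 : 0 ≤ |b - β| / b := by positivity
  have p2 : 0 ≤ |b - β| / β := by positivity
  rcases le_total b β with h | h
  · have h1 := key b β hb h
    rw [abs_of_nonneg (sub_nonneg.2 (mono _ _ h))]
    rw [abs_of_nonpos (by linarith : b - β ≤ 0), neg_sub] at *
    linarith
  · have h1 := key β b hβ h
    rw [abs_of_nonpos (sub_nonpos.2 (mono _ _ h)), neg_sub]
    rw [abs_of_nonneg (by linarith : 0 ≤ b - β)] at *
    linarith

lemma norm_mobDerivLaplace_sub_le {b : ℝ} (hα : 0 < α) (hz : 0 ≤ z.re) (hb : 0 < b)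
    (hβ : 0 < β) :
    ‖mobDerivLaplace α b z - mobDerivLaplace α β z‖ ≤ 4 * (|b - β| / b + |b - β| / β) := by
  rw [mobDerivLaplace, mobDerivLaplace, ← integral_sub (integrableOn_laplaceIntegrand hα hz hb.le)
    (integrableOn_laplaceIntegrand hα hz hβ.le)]
  have := norm_integral_le_of_norm_le (μ := volume.restrict (Ioi (0 : ℝ)))
    (f := fun t : ℝ => (Real.exp (-(b * t)) : ℂ) * mobDeriv α (transParam t) z -
      (Real.exp (-(β * t)) : ℂ) * mobDeriv α (transParam t) z)
    (integrableOn_exp_neg_Ioi.const_mul ((|b - β| / b + |b - β| / β) * 4))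
    ((ae_restrict_mem measurableSet_Ioi).mono fun t (ht : t ∈ Ioi (0 : ℝ)) => by
      rw [← sub_mul, norm_mul, ← Complex.ofReal_sub, Complex.norm_real, Real.norm_eq_abs, mul_assoc]
      exact mul_le_mul (abs_exp_sub_exp_le hb hβ (le_of_lt ht))
        (norm_mobDeriv_transParam_le hα hz (le_of_lt ht)) (norm_nonneg _) (by positivity))
  rw [integral_const_mul, integral_exp_neg_Ioi'] at this
  linarith

/-- The m-th term is the value at t = 2sm of e^(-bt) `mobDeriv α (transParam t) z`, with e^(-2sb) =
τ. So the series is a Riemann sum of step 2s divided by 2s. The integrand has variation at most 1 +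
(π + 1), whence a bound free of s, τ and z. -/
lemma norm_linSeriesDeriv_sub_laplace_le {s τ : ℝ} (hα : 0 < α) (hz : 0 ≤ z.re) (hs : 0 < s)
    (hτ : 0 < τ) (hτ1 : τ < 1) :
    ‖linSeriesDeriv α (Real.exp (-(2 * s))) τ z -
      1 / (2 * s) * mobDerivLaplace α (-Real.log τ / (2 * s)) z‖ ≤ Real.pi + 2 := by
  set b := -Real.log τ / (2 * s) with hb
  have hlog : Real.log τ < 0 := Real.log_neg hτ hτ1
  have hb0 : 0 < b := div_pos (by linarith) (by linarith)
  set f : ℝ → ℂ := fun t => (Real.exp (-(b * t)) : ℂ) * mobDeriv α (transParam t) z with hf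
  have hpow : ∀ m : ℕ, f (m * (2 * s)) =
      (τ : ℂ) ^ m * mobDeriv α (iterParam (Real.exp (-(2 * s))) m) z := by
    intro m
    rw [hf, iterParam_exp]
    simp only
    congr 1
    rw [← Complex.ofReal_pow]
    congr 1
    have : -(b * (m * (2 * s))) = m * Real.log τ := by
      rw [hb]; field_simp
    rw [this, Real.exp_nat_mul, Real.exp_log hτ]
  have hμ1 : Real.exp (-(2 * s)) < 1 := Real.exp_lt_one_iff.2 (by linarith)
  have hsum : Summable fun m : ℕ => f (m * (2 * s)) := by
    simp only [hpow]
    refine summable_pow_mul_of_bounded (B := 1) (by rwa [abs_of_pos hτ]) fun m => ?_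
    exact (norm_mobDeriv_le hα hz (iterParam_nonneg (Real.exp_pos _) hμ1 m)
      (iterParam_lt_one (Real.exp_pos _) m).le).trans
        (by nlinarith [sq_nonneg (iterParam (Real.exp (-(2 * s))) m)])
  have hR := norm_riemann_sum_sub_integral_le (f := f) (h := 2 * s) (B := Real.pi + 2)
    -- Each factor of the integrand is at most 1 in modulus, so the variations of the exponential
    -- and of `mobDeriv` simply add.
    (V := fun t => -Real.exp (-(b * t)) + mobVar α z (transParam t)) (by linarith)
    (integrableOn_laplaceIntegrand hα hz hb0.le) (continuousOn_laplaceIntegrand hα hz b)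
    (by
      intro x y hx hxy
      have e : f y - f x = (Real.exp (-(b * y)) : ℂ) *
          (mobDeriv α (transParam y) z - mobDeriv α (transParam x) z) -
          ((Real.exp (-(b * x)) - Real.exp (-(b * y)) : ℝ) : ℂ) *
            mobDeriv α (transParam x) z := by
        rw [hf]; push_cast; ring
      have h1 := norm_mobDeriv_sub_le hα hz (transParam_nonneg hx) (transParam_mono hxy)
      have h2 := norm_mobDeriv_le hα hz (transParam_nonneg hx) (transParam_lt_one x).le
      have h3 : Real.exp (-(b * y)) ≤ Real.exp (-(b * x)) := Real.exp_le_exp.2 (by nlinarith)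
      have h4 := exp_neg_mul_le_one hb0.le (hx.trans hxy)
      rw [e]
      refine (norm_sub_le _ _).trans ?_
      rw [norm_mul, norm_mul, Complex.norm_real, Complex.norm_real,
        Real.norm_of_nonneg (Real.exp_pos _).le, Real.norm_of_nonneg (by linarith)]
      have h5 := mul_le_of_le_one_left (norm_nonneg
        (mobDeriv α (transParam y) z - mobDeriv α (transParam x) z)) h4
      have h6 : (Real.exp (-(b * x)) - Real.exp (-(b * y))) * ‖mobDeriv α (transParam x) z‖ ≤
          Real.exp (-(b * x)) - Real.exp (-(b * y)) :=
        mul_le_of_le_one_right (by linarith) (h2.trans (by nlinarith [sq_nonneg (transParam x)]))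
      linarith)
    (by
      intro t ht
      have h1 := mobVar_le α z (transParam_nonneg ht) (transParam_lt_one t).le
      have h2 := Real.exp_pos (-(b * t))
      simp only [transParam_zero, mobVar_zero, mul_zero, neg_zero, Real.exp_zero]
      linarith) hsum
  have e : linSeriesDeriv α (Real.exp (-(2 * s))) τ z = ∑' m : ℕ, f (m * (2 * s)) :=
    tsum_congr fun m => (hpow m).symm
  have h2s : ((2 * s : ℝ) : ℂ) ≠ 0 := by exact_mod_cast (by linarith : (2 * s) ≠ 0)
  have e2 : linSeriesDeriv α (Real.exp (-(2 * s))) τ z - 1 / (2 * s) * mobDerivLaplace α b z =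
      ((2 * s : ℝ) : ℂ)⁻¹ * (((2 * s : ℝ) : ℂ) * ∑' m : ℕ, f (m * (2 * s)) -
        ∫ t in Ioi (0 : ℝ), f t) := by
    have e3 : mobDerivLaplace α b z = ∫ t in Ioi (0 : ℝ), f t := rfl
    rw [e, mul_sub, inv_mul_cancel_left₀ h2s, e3, one_div]
    push_cast
    rfl
  rw [e2, norm_mul, norm_inv, Complex.norm_real, Real.norm_of_nonneg (by linarith)]
  rw [inv_mul_le_iff₀ (by linarith)]
  exact hR

/-- The quantity 1/s occurs in the exponent, where `Y` replaces it, and in the prefactor, where `R /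
(2 * α)` replaces it. An O(1) error in 1/s changes the exponent by a relative error O(s); multiplied
by the prefactor 1/(2s) this is O(1). -/
lemma norm_linSeriesDeriv_sub_lerch_le {s τ Y y₀ R E₁ E₂ : ℝ} (hα : 0 < α) (hz : 0 ≤ z.re)
    (hs : 0 < s) (hτ : 0 < τ) (hτ1 : τ < 1) (hy₀ : 0 < y₀) (hY : y₀ ≤ Y)
    (h₁ : |1 / s - Y| ≤ E₁) (h₂ : |1 / s - R / (2 * α)| ≤ E₂) :
    ‖linSeriesDeriv α (Real.exp (-(2 * s))) τ z -
      R / 2 * (1 / (2 * α) * mobDerivLaplace α (-Real.log τ * Y / 2) z)‖ ≤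
      Real.pi + 2 + 2 * (E₁ + E₁ * (E₁ / y₀ + 1)) + 2 * E₂ := by
  have hlog : 0 < -Real.log τ := by linarith [Real.log_neg hτ hτ1]
  set ℓ := -Real.log τ with hℓ
  have hY0 : 0 < Y := hy₀.trans_le hY
  have hb0 : 0 < ℓ / (2 * s) := by positivity
  have hβ0 : 0 < ℓ * Y / 2 := by positivity
  have hE₁ : 0 ≤ E₁ := (abs_nonneg _).trans h₁
  have t1 := norm_linSeriesDeriv_sub_laplace_le hα hz hs hτ hτ1
  have t2 := norm_mobDerivLaplace_sub_le hα hz hb0 hβ0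
  have t3 := norm_mobDerivLaplace_le hα hz hβ0.le
  rw [← hℓ] at t1
  set J := mobDerivLaplace α (ℓ / (2 * s)) z
  set J' := mobDerivLaplace α (ℓ * Y / 2) z
  set Λ := linSeriesDeriv α (Real.exp (-(2 * s))) τ z
  have e : Λ - R / 2 * (1 / (2 * α) * J') = (Λ - 1 / (2 * s) * J) +
      ((1 / (2 * s) : ℝ) : ℂ) * (J - J') + ((1 / 2 * (1 / s - R / (2 * α)) : ℝ) : ℂ) * J' := by
    push_cast
    ring
  rw [e]
  refine (norm_add₃_le).trans ?_
  rw [norm_mul, norm_mul, Complex.norm_real, Complex.norm_real, Real.norm_eq_abs, Real.norm_eq_abs,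
    abs_mul, abs_of_pos (by positivity : 0 < 1 / (2 * s)),
    abs_of_pos (by norm_num : (0 : ℝ) < 1 / 2)]
  have d1 : |ℓ / (2 * s) - ℓ * Y / 2| = ℓ / 2 * |1 / s - Y| := by
    have : ℓ / (2 * s) - ℓ * Y / 2 = ℓ / 2 * (1 / s - Y) := by field_simp
    rw [this, abs_mul, abs_of_pos (by positivity : 0 < ℓ / 2)]
  -- The logarithm ℓ cancels in the relative errors, which makes the bound independent of k.
  have d2 : 1 / (2 * s) * (4 * (|ℓ / (2 * s) - ℓ * Y / 2| / (ℓ / (2 * s)) +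
      |ℓ / (2 * s) - ℓ * Y / 2| / (ℓ * Y / 2))) = 2 * (|1 / s - Y| + |1 / s - Y| * (1 / s / Y)) := by
    rw [d1]; field_simp; ring
  have d3 : 1 / s / Y ≤ E₁ / y₀ + 1 := by
    have : 1 / s ≤ E₁ + Y := by linarith [le_abs_self (1 / s - Y)]
    calc 1 / s / Y ≤ (E₁ + Y) / Y := by gcongr
      _ = E₁ / Y + 1 := by field_simp
      _ ≤ _ := by gcongr
  have d4 : 1 / (2 * s) * ‖J - J'‖ ≤ 2 * (E₁ + E₁ * (E₁ / y₀ + 1)) := by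
    refine (mul_le_mul_of_nonneg_left t2 (by positivity)).trans ?_
    rw [d2]
    have : 0 < 1 / s / Y := by positivity
    gcongr
  have d5 : 1 / 2 * |1 / s - R / (2 * α)| * ‖J'‖ ≤ 1 / 2 * E₂ * 4 := by
    have := abs_nonneg (1 / s - R / (2 * α))
    have := this.trans h₂
    gcongr
  linarith

end

/-! ### The geometric parameters -/

/-- The multiplier of the translation generated by the reflections in the two circles. -/
def multiplier (ri re ε : ℝ) : ℝ := Real.exp (-(2 * (xiI ri re ε - xiE ri re ε)))

section

variable {ri re ε : ℝ}

lemma poleDist_sq (hri : 0 < ri) (h0 : 0 < ε) (h1 : ε < re - ri) :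
    poleDist ri re ε ^ 2 =
      ε * (2 * ri + ε) * (2 * re - ε) * (2 * re - 2 * ri - ε) / (2 * (re - ri - ε)) ^ 2 := by
  have a1 : 0 < 2 * re - ε := by linarith
  have a2 : 0 < 2 * re - 2 * ri - ε := by linarith
  rw [poleDist, div_pow, Real.sq_sqrt (by positivity)]

lemma poleDist_pos (hri : 0 < ri) (h0 : 0 < ε) (h1 : ε < re - ri) : 0 < poleDist ri re ε := by
  have a1 : 0 < 2 * re - ε := by linarith
  have a2 : 0 < 2 * re - 2 * ri - ε := by linarith
  have a3 : 0 < re - ri - ε := by linarith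
  exact div_pos (Real.sqrt_pos.2 (by positivity)) (by positivity)

lemma ci_sq (hri : 0 < ri) (h0 : 0 < ε) (h1 : ε < re - ri) :
    ci ri re ε ^ 2 = poleDist ri re ε ^ 2 + ri ^ 2 := by
  have a3 : re - ri - ε ≠ 0 := by linarith
  rw [poleDist_sq hri h0 h1, ci]
  field_simp
  ring

lemma ce_eq (ri re ε : ℝ) : ce ri re ε = ci ri re ε + (re - ri - ε) := by rw [ce]; ring

lemma ce_sq (hri : 0 < ri) (h0 : 0 < ε) (h1 : ε < re - ri) :
    ce ri re ε ^ 2 = poleDist ri re ε ^ 2 + re ^ 2 := by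
  have a3 : re - ri - ε ≠ 0 := by linarith
  rw [poleDist_sq hri h0 h1, ce_eq, ci]
  field_simp
  ring

lemma ci_pos (hri : 0 < ri) (h0 : 0 < ε) (h1 : ε < re - ri) : 0 < ci ri re ε := by
  have a3 : 0 < re - ri - ε := by linarith
  refine div_pos ?_ (by positivity)
  nlinarith

lemma ce_pos (hri : 0 < ri) (h0 : 0 < ε) (h1 : ε < re - ri) : 0 < ce ri re ε := by
  have := ci_pos hri h0 h1
  rw [ce_eq]; linarith

lemma poleDist_lt_ci (hri : 0 < ri) (h0 : 0 < ε) (h1 : ε < re - ri) :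
    poleDist ri re ε < ci ri re ε :=
  lt_of_pow_lt_pow_left₀ 2 (ci_pos hri h0 h1).le (by rw [ci_sq hri h0 h1]; nlinarith)

lemma poleDist_lt_ce (hri : 0 < ri) (h0 : 0 < ε) (h1 : ε < re - ri) :
    poleDist ri re ε < ce ri re ε := by
  rw [ce_eq]; linarith [poleDist_lt_ci hri h0 h1]

lemma x0_nonneg (hri : 0 < ri) (h0 : 0 < ε) (h1 : ε < re - ri) : 0 ≤ x0 ri re ε := by
  have h := ce_sq hri h0 h1
  have := ce_pos hri h0 h1
  rw [x0, sub_nonneg]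
  nlinarith [poleDist_pos hri h0 h1]

lemma x0_le_poleDist (hri : 0 < ri) (h0 : 0 < ε) (h1 : ε < re - ri) :
    x0 ri re ε ≤ poleDist ri re ε := by
  have h := ce_sq hri h0 h1
  have := ce_pos hri h0 h1
  have h2 := poleDist_pos hri h0 h1
  have h3 : ce ri re ε ≤ re + poleDist ri re ε := by nlinarith
  rw [x0]; linarith

lemma centre_add_x0 (ri re ε : ℝ) : ri + ε + x0 ri re ε = ci ri re ε := by
  rw [x0, ce]; ring

lemma exp_neg_two_xiI (hri : 0 < ri) (h0 : 0 < ε) (h1 : ε < re - ri) :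
    Real.exp (-(2 * xiI ri re ε)) =
      (ci ri re ε - poleDist ri re ε) / (ci ri re ε + poleDist ri re ε) := by
  have h := poleDist_lt_ci hri h0 h1
  have h2 := poleDist_pos hri h0 h1
  rw [xiI, ← mul_assoc, show (2 : ℝ) * (1 / 2) = 1 by norm_num, one_mul, Real.exp_neg,
    Real.exp_log (div_pos (by linarith) (by linarith)), inv_div]

lemma exp_neg_two_xiE (hri : 0 < ri) (h0 : 0 < ε) (h1 : ε < re - ri) :
    Real.exp (-(2 * xiE ri re ε)) =
      (ce ri re ε - poleDist ri re ε) / (ce ri re ε + poleDist ri re ε) := by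
  have h := poleDist_lt_ce hri h0 h1
  have h2 := poleDist_pos hri h0 h1
  rw [xiE, ← mul_assoc, show (2 : ℝ) * (1 / 2) = 1 by norm_num, one_mul, Real.exp_neg,
    Real.exp_log (div_pos (by linarith) (by linarith)), inv_div]

lemma multiplier_pos (ri re ε : ℝ) : 0 < multiplier ri re ε := Real.exp_pos _

lemma multiplier_eq (hri : 0 < ri) (h0 : 0 < ε) (h1 : ε < re - ri) :
    multiplier ri re ε =
      (ci ri re ε - poleDist ri re ε) / (ci ri re ε + poleDist ri re ε) /
        ((ce ri re ε - poleDist ri re ε) / (ce ri re ε + poleDist ri re ε)) := by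
  rw [← exp_neg_two_xiI hri h0 h1, ← exp_neg_two_xiE hri h0 h1, ← Real.exp_sub, multiplier]
  congr 1; ring

lemma multiplier_lt_one (hri : 0 < ri) (h0 : 0 < ε) (h1 : ε < re - ri) :
    multiplier ri re ε < 1 := by
  have hi := poleDist_lt_ci hri h0 h1
  have he := poleDist_lt_ce hri h0 h1
  have h2 := poleDist_pos hri h0 h1
  have h3 := ce_eq ri re ε
  rw [multiplier_eq hri h0 h1, div_lt_one (div_pos (by linarith) (by linarith)),
    div_lt_div_iff₀ (by linarith) (by linarith), h3]
  nlinarith [mul_pos h2 (by linarith : 0 < re - ri - ε)]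

lemma xi_gap_pos (hri : 0 < ri) (h0 : 0 < ε) (h1 : ε < re - ri) :
    0 < xiI ri re ε - xiE ri re ε := by
  have := multiplier_lt_one hri h0 h1
  rw [multiplier, Real.exp_lt_one_iff] at this
  linarith

/-- Here `iterParam (multiplier ri re ε) 1` is tanh(ξᵢ - ξₑ) = α(e - c)/(ce - α²), where c and e are
the centres. Hence α divided by it is rational in ε, regular at ε = 0, with value r_*²/2 there; this
is the origin of r_* in the singular term. -/
lemma poleDist_div_iterParam (hri : 0 < ri) (h0 : 0 < ε) (h1 : ε < re - ri) :
    poleDist ri re ε / iterParam (multiplier ri re ε) 1 =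
      (re ^ 2 + ri ^ 2 - (re - ri - ε) ^ 2) / (2 * (re - ri - ε)) := by
  have hi := poleDist_lt_ci hri h0 h1
  have he := poleDist_lt_ce hri h0 h1
  have h2 := poleDist_pos hri h0 h1
  have h3 := ce_eq ri re ε
  have h4 := ci_sq hri h0 h1
  have h5 : ci ri re ε * (2 * (re - ri - ε)) = re ^ 2 - ri ^ 2 - (re - ri - ε) ^ 2 := by
    rw [ci, div_mul_cancel₀]
    have : 0 < re - ri - ε := by linarith
    positivity
  rw [iterParam_one, multiplier_eq hri h0 h1]
  set α := poleDist ri re ε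
  set c := ci ri re ε
  set e := ce ri re ε
  have p1 : 0 < c - α := by linarith
  have p2 : 0 < e - α := by linarith
  have p3 : 0 < c + α := by linarith
  have p4 : 0 < e + α := by linarith
  have hη : 0 < re - ri - ε := by linarith
  have e1 : (1 - (c - α) / (c + α) / ((e - α) / (e + α))) /
      (1 + (c - α) / (c + α) / ((e - α) / (e + α))) = α * (e - c) / (c * e - α ^ 2) := by
    have q1 : 0 < c * e - α ^ 2 := by nlinarith
    have q2 : 0 < (c + α) * (e - α) := by positivity
    rw [div_div_div_eq, one_sub_div q2.ne', one_add_div q2.ne', div_div_div_cancel_right₀ q2.ne',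
      div_eq_div_iff (by nlinarith [mul_pos p1 p4]) q1.ne']
    ring
  have hec : e - c = re - ri - ε := by rw [h3]; ring
  have hce : c * e - α ^ 2 = (re ^ 2 + ri ^ 2 - (re - ri - ε) ^ 2) / 2 := by
    rw [h3]; nlinarith
  rw [e1, hec, hce]
  have : re ^ 2 + ri ^ 2 - (re - ri - ε) ^ 2 ≠ 0 := by nlinarith
  field_simp

/-- The right-hand quantity is coth s, whose pole at 0 is exactly 1/s. The inequality eˣ ≥ 1 + x at
x = ±2s suffices. -/
lemma abs_inv_iterParam_sub_le {s : ℝ} (hs : 0 < s) :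
    |1 / s - 1 / iterParam (Real.exp (-(2 * s))) 1| ≤ 2 := by
  have h1 := Real.add_one_le_exp (2 * s)
  have h2 := Real.add_one_le_exp (-(2 * s))
  have h3 : Real.exp (2 * s) * Real.exp (-(2 * s)) = 1 := by rw [← Real.exp_add]; simp
  rw [iterParam_one, one_div_div]
  set E := Real.exp (2 * s)
  set e := Real.exp (-(2 * s))
  have he : 0 < 1 - e := by
    have : 1 < E := by linarith
    nlinarith [Real.exp_pos (2 * s)]
  have : 1 / s - (1 + e) / (1 - e) = (1 - e - s * (1 + e)) / (s * (1 - e)) := by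
    field_simp
  rw [this, abs_le]
  constructor
  · rw [le_div_iff₀ (by positivity)]
    have : 2 * s * e ≤ 1 - e := by nlinarith [Real.exp_pos (-(2 * s))]
    nlinarith
  · rw [div_le_iff₀ (by positivity)]
    nlinarith

lemma rStar_sq (hri : 0 < ri) (hre : ri < re) : rStar ri re ^ 2 = 2 * ri * re / (re - ri) := by
  have : 0 < re := hri.trans hre
  have : 0 < re - ri := by linarith
  rw [rStar, Real.sq_sqrt (by positivity)]

lemma rStar_pos (hri : 0 < ri) (hre : ri < re) : 0 < rStar ri re := by
  have : 0 < re := hri.trans hre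
  have : 0 < re - ri := by linarith
  exact Real.sqrt_pos.2 (by positivity)

lemma poleDist_div_iterParam_le (hri : 0 < ri) (h0 : 0 < ε) (h1 : ε ≤ (re - ri) / 2)
    (hre : ri < re) :
    poleDist ri re ε / iterParam (multiplier ri re ε) 1 ≤ (re ^ 2 + ri ^ 2) / (re - ri) := by
  have hd : 0 < re - ri := by linarith
  rw [poleDist_div_iterParam hri h0 (by linarith)]
  have : re - ri ≤ 2 * (re - ri - ε) := by linarith
  gcongr
  nlinarith [sq_nonneg (re - ri - ε)]

/-- As ε → r_e - r_i the circles become concentric and α → ∞; the product of α with the distance of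
the centres still has a positive lower bound, which controls both 1/α and 1/tanh(ξᵢ - ξₑ) in this
regime. -/
lemma le_poleDist_of_ge (hri : 0 < ri) (hre : ri < re) (h0 : (re - ri) / 2 ≤ ε)
    (h1 : ε < re - ri) : (re - ri) * √(ri * re) ≤ 2 * (re - ri - ε) * poleDist ri re ε := by
  have hη : 0 < re - ri - ε := by linarith
  have hre0 : 0 < re := hri.trans hre
  have hd : 0 < re - ri := by linarith
  rw [poleDist, mul_div_cancel₀ _ (by positivity)]
  apply Real.le_sqrt_of_sq_le
  rw [mul_pow, Real.sq_sqrt (by positivity)]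
  calc (re - ri) ^ 2 * (ri * re) = (re - ri) / 2 * (2 * ri) * re * (re - ri) := by ring
    _ ≤ ε * (2 * ri + ε) * (2 * re - ε) * (2 * re - 2 * ri - ε) := by
      have a1 : 0 < 2 * re - ε := by linarith
      exact mul_le_mul (mul_le_mul (mul_le_mul h0 (by linarith) (by positivity) (by linarith))
        (by linarith) hre0.le (mul_nonneg (by linarith) (by linarith))) (by linarith) hd.le
        (mul_nonneg (mul_nonneg (by linarith) (by linarith)) a1.le)

lemma inv_poleDist_le_of_ge (hri : 0 < ri) (hre : ri < re) (h0 : (re - ri) / 2 ≤ ε)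
    (h1 : ε < re - ri) : 1 / poleDist ri re ε ≤ 2 / √(ri * re) := by
  have h := le_poleDist_of_ge hri hre h0 h1
  have hre0 : 0 < re := hri.trans hre
  have hα := poleDist_pos hri (by linarith : 0 < ε) h1
  have hs : 0 < √(ri * re) := Real.sqrt_pos.2 (by positivity)
  rw [div_le_div_iff₀ hα hs]
  nlinarith

lemma inv_iterParam_le_of_ge (hri : 0 < ri) (hre : ri < re) (h0 : (re - ri) / 2 ≤ ε)
    (h1 : ε < re - ri) :
    1 / iterParam (multiplier ri re ε) 1 ≤ (re ^ 2 + ri ^ 2) / ((re - ri) * √(ri * re)) := by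
  have h := le_poleDist_of_ge hri hre h0 h1
  have hre0 : 0 < re := hri.trans hre
  have h00 : 0 < ε := by linarith
  have hα := poleDist_pos hri h00 h1
  have hs : 0 < √(ri * re) := Real.sqrt_pos.2 (by positivity)
  have hη : 0 < re - ri - ε := by linarith
  have hd : 0 < re - ri := by linarith
  have e := poleDist_div_iterParam hri h00 h1
  have e2 : 1 / iterParam (multiplier ri re ε) 1 =
      (re ^ 2 + ri ^ 2 - (re - ri - ε) ^ 2) / (2 * (re - ri - ε) * poleDist ri re ε) := by
    rw [← div_div, ← e]
    field_simp
  rw [e2]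
  gcongr
  nlinarith [sq_nonneg (re - ri - ε)]

/-- The expansion α² = r_*² ε + O(ε²). The sign of the error gives the lower bound α ≥ r_*√ε, used
in all later divisions by α. -/
lemma poleDist_sq_sub (hri : 0 < ri) (hre : ri < re) (h0 : 0 < ε) (h1 : ε ≤ (re - ri) / 2) :
    rStar ri re ^ 2 * ε ≤ poleDist ri re ε ^ 2 ∧
      poleDist ri re ε ^ 2 - rStar ri re ^ 2 * ε ≤
        (12 * (ri * re) + 4 * (re - ri) ^ 2) / (re - ri) ^ 2 * ε ^ 2 := by
  have hd : 0 < re - ri := by linarith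
  have hre0 : 0 < re := hri.trans hre
  have hη : 0 < re - ri - ε := by linarith
  -- The numerator left after ε² has been factored out exactly; only its sign and an upper bound
  -- matter.
  set N := 12 * (ri * re) * (re - ri) - 8 * (ri * re) * ε +
    (re - ri) * (2 * (re - ri) - ε) ^ 2 with hN
  have e : poleDist ri re ε ^ 2 - rStar ri re ^ 2 * ε =
      ε ^ 2 * (N / (4 * (re - ri) * (re - ri - ε) ^ 2)) := by
    rw [poleDist_sq hri h0 (by linarith), rStar_sq hri hre, hN]
    have := hη.ne'
    have := hd.ne'
    field_simp
    ring
  have hP : 0 < ri * re := by positivity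
  have hN0 : 0 ≤ N := by
    have : 0 ≤ (re - ri) * (2 * (re - ri) - ε) ^ 2 := by positivity
    rw [hN]; nlinarith
  constructor
  · have : 0 ≤ ε ^ 2 * (N / (4 * (re - ri) * (re - ri - ε) ^ 2)) := by positivity
    linarith
  · rw [e, mul_comm]
    refine mul_le_mul_of_nonneg_right ?_ (sq_nonneg _)
    have hN1 : N ≤ 12 * (ri * re) * (re - ri) + 4 * (re - ri) ^ 3 := by
      have : (re - ri) * (2 * (re - ri) - ε) ^ 2 ≤ (re - ri) * (2 * (re - ri)) ^ 2 := by
        gcongr <;> linarith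
      rw [hN]
      nlinarith [mul_pos hP h0]
    have hD : (re - ri) ^ 3 ≤ 4 * (re - ri) * (re - ri - ε) ^ 2 := by
      have : ((re - ri) / 2) ^ 2 ≤ (re - ri - ε) ^ 2 := by gcongr; linarith
      nlinarith
    calc N / (4 * (re - ri) * (re - ri - ε) ^ 2)
        ≤ (12 * (ri * re) * (re - ri) + 4 * (re - ri) ^ 3) / (re - ri) ^ 3 := by gcongr
      _ = _ := by field_simp

lemma rStar_mul_sqrt_le (hri : 0 < ri) (hre : ri < re) (h0 : 0 < ε) (h1 : ε ≤ (re - ri) / 2) :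
    rStar ri re * √ε ≤ poleDist ri re ε := by
  refine le_of_sq_le_sq ?_ (poleDist_pos hri h0 (by linarith)).le
  rw [mul_pow, Real.sq_sqrt h0.le]
  exact (poleDist_sq_sub hri hre h0 h1).1

/-- Multiplied by α, the difference becomes the deviation of a rational function of ε from its value
r_*²/2 at 0, which is O(ε). Division by α ≥ r_*√ε leaves O(√ε). -/
lemma exists_abs_inv_iterParam_sub_le (hri : 0 < ri) (hre : ri < re) :
    ∃ E, ∀ ε, 0 < ε → ε ≤ (re - ri) / 2 →
      |1 / iterParam (multiplier ri re ε) 1 - rStar ri re ^ 2 / (2 * poleDist ri re ε)| ≤ E := by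
  have hd : 0 < re - ri := by linarith
  have hre0 : 0 < re := hri.trans hre
  have hr := rStar_pos hri hre
  set H := (2 * (re - ri) ^ 2 + 2 * (ri * re)) / (re - ri) ^ 2 with hH
  refine ⟨H * (√(re - ri) / rStar ri re), fun ε h0 h1 => ?_⟩
  have hη : 0 < re - ri - ε := by linarith
  have hα := poleDist_pos hri h0 (by linarith : ε < re - ri)
  have e := poleDist_div_iterParam hri h0 (by linarith : ε < re - ri)
  have hαs := rStar_mul_sqrt_le hri hre h0 h1
  have e2 : 1 / iterParam (multiplier ri re ε) 1 - rStar ri re ^ 2 / (2 * poleDist ri re ε) =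
      ε / poleDist ri re ε * (((re - ri) * (re - ri + (re - ri - ε)) + 2 * (ri * re)) /
        (2 * (re - ri - ε) * (re - ri))) := by
    have : 1 / iterParam (multiplier ri re ε) 1 =
        (re ^ 2 + ri ^ 2 - (re - ri - ε) ^ 2) / (2 * (re - ri - ε)) / poleDist ri re ε := by
      rw [← e]; field_simp
    rw [this, rStar_sq hri hre]
    have := hη.ne'
    have := hd.ne'
    field_simp
    ring
  rw [e2, abs_of_nonneg (by positivity), mul_comm]
  have hσ : 0 < √ε := Real.sqrt_pos.2 h0
  have b1 : ((re - ri) * (re - ri + (re - ri - ε)) + 2 * (ri * re)) /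
        (2 * (re - ri - ε) * (re - ri)) ≤ H := by
    rw [hH]
    exact div_le_div₀ (by positivity) (by nlinarith) (by positivity) (by nlinarith)
  have b2 : ε / poleDist ri re ε ≤ √(re - ri) / rStar ri re := by
    calc ε / poleDist ri re ε ≤ ε / (rStar ri re * √ε) := by gcongr
      _ = √ε / rStar ri re := by
        rw [mul_comm, ← div_div, Real.div_sqrt]
      _ ≤ _ := by gcongr; linarith
  have : 0 ≤ H := by positivity
  gcongr

/-- From α² - r_*²ε = O(ε²) and the difference of squares, α - r_*√ε = O(ε^(3/2)); the difference of
the reciprocals is then O(√ε). -/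
lemma exists_abs_rStar_sub_le (hri : 0 < ri) (hre : ri < re) :
    ∃ E, ∀ ε, 0 < ε → ε ≤ (re - ri) / 2 →
      |rStar ri re ^ 2 / (2 * poleDist ri re ε) - rStar ri re / (2 * √ε)| ≤ E := by
  have hd : 0 < re - ri := by linarith
  have hre0 : 0 < re := hri.trans hre
  have hr := rStar_pos hri hre
  set C := (12 * (ri * re) + 4 * (re - ri) ^ 2) / (re - ri) ^ 2 with hC
  have hC0 : 0 ≤ C := by positivity
  refine ⟨C * √(re - ri) / (2 * rStar ri re), fun ε h0 h1 => ?_⟩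
  have hα := poleDist_pos hri h0 (by linarith : ε < re - ri)
  have hαs := rStar_mul_sqrt_le hri hre h0 h1
  have hsq := (poleDist_sq_sub hri hre h0 h1).2
  have hσ : 0 < √ε := Real.sqrt_pos.2 h0
  have hσ2 : √ε ^ 2 = ε := Real.sq_sqrt h0.le
  have hσd : √ε ≤ √(re - ri) := Real.sqrt_le_sqrt (by linarith)
  rw [← hC] at hsq
  set α := poleDist ri re ε
  set r := rStar ri re
  set σ := √ε
  have e : r ^ 2 / (2 * α) - r / (2 * σ) = -(r * (α - r * σ) / (2 * α * σ)) := by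
    field_simp; ring
  have hsub : 0 ≤ α - r * σ := by linarith
  rw [e, abs_neg, abs_of_nonneg (by positivity)]
  have hdiff : (α - r * σ) * (r * σ) ≤ C * σ ^ 4 := by
    have : (α - r * σ) * (α + r * σ) ≤ C * σ ^ 4 := by
      calc _ = α ^ 2 - r ^ 2 * σ ^ 2 := by ring
        _ ≤ C * ε ^ 2 := by rw [hσ2]; exact hsq
        _ = _ := by rw [← hσ2]; ring
    nlinarith [mul_pos hr hσ]
  calc r * (α - r * σ) / (2 * α * σ) ≤ r * (α - r * σ) / (2 * (r * σ) * σ) := by gcongr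
    _ = (α - r * σ) * (r * σ) / (2 * r * σ ^ 3) := by field_simp
    _ ≤ C * σ ^ 4 / (2 * r * σ ^ 3) := by gcongr
    _ = C * σ / (2 * r) := by field_simp
    _ ≤ _ := by gcongr

/-- As `ε → 0`, the gap in the bipolar coordinate `ξ` satisfies
`1 / (ξᵢ - ξₑ) = r_*² / (2α) + O(1) = r_* / (2√ε) + O(1)`. -/
lemma exists_gap_asymptotics (hri : 0 < ri) (hre : ri < re) :
    ∃ E₁ E₂ y₀ : ℝ, 0 < y₀ ∧ ∀ ε, 0 < ε → ε ≤ (re - ri) / 2 →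
      y₀ ≤ rStar ri re / (2 * √ε) ∧
      |1 / (xiI ri re ε - xiE ri re ε) - rStar ri re / (2 * √ε)| ≤ E₁ ∧
      |1 / (xiI ri re ε - xiE ri re ε) - rStar ri re ^ 2 / (2 * poleDist ri re ε)| ≤ E₂ := by
  obtain ⟨E, hE⟩ := exists_abs_inv_iterParam_sub_le hri hre
  obtain ⟨E', hE'⟩ := exists_abs_rStar_sub_le hri hre
  have hr := rStar_pos hri hre
  have hd : 0 < re - ri := by linarith
  refine ⟨2 + E + E', 2 + E, rStar ri re / (2 * √(re - ri)), by positivity, fun ε h0 h1 => ?_⟩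
  have hs := xi_gap_pos hri h0 (by linarith : ε < re - ri)
  have a1 := abs_inv_iterParam_sub_le hs
  have a2 := hE ε h0 h1
  have a3 := hE' ε h0 h1
  rw [← multiplier] at a1
  have b2 := (abs_sub_le _ _ _).trans (add_le_add a1 a2)
  refine ⟨?_, (abs_sub_le _ _ _).trans (add_le_add b2 a3), b2⟩
  have hσ : 0 < √ε := Real.sqrt_pos.2 h0
  have : √ε ≤ √(re - ri) := Real.sqrt_le_sqrt (by linarith)
  gcongr

end

/-! ### Two circles of the hyperbolic pencil with limit points `±α` -/

/-- Two nested circles, of centres `c < e` and radii `r < R`, in the pencil with limit points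
`±α`, with the multiplier `μ` of the composition of their reflections. -/
structure CircleConfig (α c e r R μ : ℝ) : Prop where
  pole_pos : 0 < α
  pole_lt : α < c
  centre_lt : c < e
  r_pos : 0 < r
  R_pos : 0 < R
  c_sq : c ^ 2 = α ^ 2 + r ^ 2
  e_sq : e ^ 2 = α ^ 2 + R ^ 2
  nested : e - c + r < R
  mult_pos : 0 < μ
  mult_lt_one : μ < 1
  iter_mul : iterParam μ 1 * (c * e - α ^ 2) = α * (e - c)

lemma circleConfig {ri re ε : ℝ} (hri : 0 < ri) (h0 : 0 < ε) (h1 : ε < re - ri) :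
    CircleConfig (poleDist ri re ε) (ci ri re ε) (ce ri re ε) ri re (multiplier ri re ε) where
  pole_pos := poleDist_pos hri h0 h1
  pole_lt := poleDist_lt_ci hri h0 h1
  centre_lt := by rw [ce_eq]; linarith
  r_pos := hri
  R_pos := by linarith
  c_sq := ci_sq hri h0 h1
  e_sq := ce_sq hri h0 h1
  nested := by rw [ce_eq]; linarith
  mult_pos := multiplier_pos _ _ _
  mult_lt_one := multiplier_lt_one hri h0 h1
  iter_mul := by
    have hκ := iterParam_one_pos (multiplier_pos ri re ε) (multiplier_lt_one hri h0 h1)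
    have h := poleDist_div_iterParam hri h0 h1
    have h4 := ci_sq hri h0 h1
    have hη : 0 < re - ri - ε := by linarith
    have h5 : ci ri re ε * (2 * (re - ri - ε)) = re ^ 2 - ri ^ 2 - (re - ri - ε) ^ 2 := by
      rw [ci, div_mul_cancel₀]
      positivity
    rw [div_eq_div_iff hκ.ne' (by positivity)] at h
    have h6 : ci ri re ε * ce ri re ε - poleDist ri re ε ^ 2 =
        (re ^ 2 + ri ^ 2 - (re - ri - ε) ^ 2) / 2 := by
      rw [ce_eq]; nlinarith
    rw [h6, ce_eq]
    linarith

section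

variable {α c e r R μ : ℝ}

/-- The Apollonius description of the circle as a level set of |α - z|/|α + z|: the power of the
point z is a combination of the two squared distances. -/
lemma pencil_identity {α c r : ℝ} (h : c ^ 2 = α ^ 2 + r ^ 2) (z : ℂ) :
    (c + α) * ‖(α : ℂ) - z‖ ^ 2 - (c - α) * ‖(α : ℂ) + z‖ ^ 2 =
      2 * α * (‖z - c‖ ^ 2 - r ^ 2) := by
  simp only [← Complex.normSq_eq_norm_sq, Complex.normSq_apply, sub_re, sub_im, add_re, add_im,
    ofReal_re, ofReal_im]
  linear_combination -2 * α * h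

/-- A translation multiplies α - z and α + z by (1 - t) and (1 + t) over the same denominator. By
the pencil identity the power of the point does not grow, up to a positive factor, so every disk of
the pencil around α is mapped into itself. -/
lemma norm_mob_sub_sq_le {α c r t : ℝ} (hα : 0 < α) (hc : α < c) (h : c ^ 2 = α ^ 2 + r ^ 2)
    (h0 : 0 ≤ t) (h1 : t < 1) {z : ℂ} (hz : 0 ≤ z.re) :
    ‖mob α t z - c‖ ^ 2 - r ^ 2 ≤
      ((1 - t) / ‖1 + t * (z / α)‖) ^ 2 * (‖z - c‖ ^ 2 - r ^ 2) := by
  have hα' : (α : ℂ) ≠ 0 := by exact_mod_cast hα.ne'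
  have hne := one_add_mul_ne_zero h0 (div_re_nonneg hα hz)
  have e1 : (α : ℂ) - mob α t z = ((1 - t : ℝ) : ℂ) / (1 + t * (z / α)) * (α - z) := by
    have hz' : z = α * (z / α) := by field_simp
    rw [mob]
    nth_rewrite 4 [hz']
    generalize z / (α : ℂ) = ζ at *
    rw [div_mul_eq_mul_div, eq_div_iff hne, sub_mul, mul_assoc, div_mul_cancel₀ _ hne]
    push_cast
    ring
  have e2 : (α : ℂ) + mob α t z = ((1 + t : ℝ) : ℂ) / (1 + t * (z / α)) * (α + z) := by
    have hz' : z = α * (z / α) := by field_simp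
    rw [mob]
    nth_rewrite 4 [hz']
    generalize z / (α : ℂ) = ζ at *
    rw [div_mul_eq_mul_div, eq_div_iff hne, add_mul, mul_assoc, div_mul_cancel₀ _ hne]
    push_cast
    ring
  have p1 := pencil_identity h (mob α t z)
  have p2 := pencil_identity h z
  rw [e1, e2, norm_mul, norm_mul, norm_div, norm_div, Complex.norm_real, Complex.norm_real,
    Real.norm_of_nonneg (by linarith), Real.norm_of_nonneg (by linarith)] at p1
  have hN : 0 < ‖1 + (t : ℂ) * (z / α)‖ := norm_pos_iff.2 hne
  set N := ‖1 + (t : ℂ) * (z / α)‖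
  set A := ‖(α : ℂ) - z‖
  set B := ‖(α : ℂ) + z‖
  have h3 : ((1 - t) / N) ^ 2 ≤ ((1 + t) / N) ^ 2 := by
    have : 0 ≤ 1 - t := by linarith
    gcongr
    linarith
  have h4 : 0 ≤ (c - α) * B ^ 2 := mul_nonneg (by linarith) (sq_nonneg _)
  have h5 := mul_le_mul_of_nonneg_right h3 h4
  have h6 : 2 * α * (‖mob α t z - c‖ ^ 2 - r ^ 2) ≤
      2 * α * (((1 - t) / N) ^ 2 * (‖z - c‖ ^ 2 - r ^ 2)) := by
    calc _ = ((1 - t) / N) ^ 2 * ((c + α) * A ^ 2) - ((1 + t) / N) ^ 2 * ((c - α) * B ^ 2) := by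
          rw [← p1]; ring
      _ ≤ ((1 - t) / N) ^ 2 * ((c + α) * A ^ 2) - ((1 - t) / N) ^ 2 * ((c - α) * B ^ 2) := by
          linarith
      _ = ((1 - t) / N) ^ 2 * (2 * α * (‖z - c‖ ^ 2 - r ^ 2)) := by rw [← p2]; ring
      _ = _ := by ring
  exact le_of_mul_le_mul_left h6 (by positivity)

lemma CircleConfig.e_gt (h : CircleConfig α c e r R μ) : R < e := by
  have := h.e_sq
  have := h.pole_pos
  have := h.pole_lt
  have := h.centre_lt
  have := h.R_pos
  nlinarith

lemma CircleConfig.re_pos (h : CircleConfig α c e r R μ) {z : ℂ}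
    (hz : z ∈ Metric.closedBall (e : ℂ) R) : 0 < z.re := by
  rw [Metric.mem_closedBall, dist_eq_norm] at hz
  have h1 := (abs_le.1 ((Complex.abs_re_le_norm _).trans hz)).1
  rw [sub_re, ofReal_re] at h1
  linarith [h.e_gt]

lemma CircleConfig.isTranslationDomain_ball (h : CircleConfig α c e r R μ) :
    IsTranslationDomain α (Metric.ball (e : ℂ) R) where
  re_nonneg z hz := (h.re_pos (Metric.ball_subset_closedBall hz)).le
  maps t h0 h1 z hz := by
    have hre := h.re_pos (Metric.ball_subset_closedBall hz)
    rw [Metric.mem_ball, dist_eq_norm] at hz ⊢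
    have key := norm_mob_sub_sq_le h.pole_pos (h.pole_lt.trans h.centre_lt) h.e_sq h0 h1 hre.le
    have hne := one_add_mul_ne_zero h0 (div_re_nonneg h.pole_pos hre.le)
    have : 0 < (1 - t) / ‖1 + (t : ℂ) * (z / α)‖ := div_pos (by linarith) (norm_pos_iff.2 hne)
    have h2 : ‖z - e‖ ^ 2 - R ^ 2 < 0 := by
      have := norm_nonneg (z - e)
      have := h.R_pos
      nlinarith
    refine lt_of_pow_lt_pow_left₀ 2 h.R_pos.le ?_
    nlinarith [mul_neg_of_pos_of_neg (pow_pos this 2) h2]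

lemma CircleConfig.isTranslationDomain_closedBall (h : CircleConfig α c e r R μ) :
    IsTranslationDomain α (Metric.closedBall (e : ℂ) R) where
  re_nonneg z hz := (h.re_pos hz).le
  maps t h0 h1 z hz := by
    have hre := h.re_pos hz
    rw [Metric.mem_closedBall, dist_eq_norm] at hz ⊢
    have key := norm_mob_sub_sq_le h.pole_pos (h.pole_lt.trans h.centre_lt) h.e_sq h0 h1 hre.le
    have h2 : ‖z - e‖ ^ 2 - R ^ 2 ≤ 0 := by
      have := norm_nonneg (z - e)
      have := h.R_pos
      nlinarith
    refine le_of_sq_le_sq ?_ h.R_pos.le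
    nlinarith [mul_nonpos_of_nonneg_of_nonpos
      (sq_nonneg ((1 - t) / ‖1 + (t : ℂ) * (z / α)‖)) h2]

lemma CircleConfig.closedBall_subset (h : CircleConfig α c e r R μ) :
    Metric.closedBall (c : ℂ) r ⊆ Metric.ball (e : ℂ) R := by
  intro z hz
  rw [Metric.mem_closedBall, dist_eq_norm] at hz
  rw [Metric.mem_ball, dist_eq_norm]
  have e1 : z - e = (z - c) + ((c - e : ℝ) : ℂ) := by push_cast; ring
  rw [e1]
  refine (norm_add_le _ _).trans_lt ?_
  rw [Complex.norm_real, Real.norm_of_nonpos (by linarith [h.centre_lt])]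
  linarith [h.nested]

/-- The inversion in the circle of centre `c` and radius `r`. -/
def inversionReal (c r : ℝ) (z : ℂ) : ℂ := c + r ^ 2 / conj (z - c)

lemma inversionReal_mem (h : CircleConfig α c e r R μ) {z : ℂ} (hz : r ≤ ‖z - c‖) :
    inversionReal c r z ∈ Metric.ball (e : ℂ) R := by
  apply h.closedBall_subset
  have := h.r_pos
  rw [Metric.mem_closedBall, dist_eq_norm, inversionReal, add_sub_cancel_left, norm_div,
    Complex.norm_conj, norm_pow, Complex.norm_real, Real.norm_of_nonneg this.le,
    div_le_iff₀ (by linarith)]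
  nlinarith

lemma inversionReal_of_norm_eq {z : ℂ} (hr : 0 < r) (hz : ‖z - c‖ = r) :
    inversionReal c r z = z := by
  have hne : conj (z - c) ≠ 0 := by
    rw [Ne, map_eq_zero, ← norm_eq_zero]; linarith
  have h2 : (r : ℂ) ^ 2 = (z - c) * conj (z - c) := by
    rw [Complex.mul_conj, Complex.normSq_eq_norm_sq, hz]; push_cast; ring
  rw [inversionReal, h2, mul_div_cancel_right₀ _ hne]
  ring

/-- The translation is the composition of the two inversions, and the inversion in the outer circle
fixes that circle pointwise. -/
lemma mob_eq_inversionReal (h : CircleConfig α c e r R μ) {z : ℂ} (hz : ‖z - e‖ = R) :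
    mob α (iterParam μ 1) z = inversionReal c r z := by
  have hα := h.pole_pos
  have hc : (c : ℂ) ^ 2 = α ^ 2 + r ^ 2 := by exact_mod_cast h.c_sq
  have he : (e : ℂ) ^ 2 = α ^ 2 + R ^ 2 := by exact_mod_cast h.e_sq
  have hk : (iterParam μ 1 : ℂ) * (c * e - α ^ 2) = α * (e - c) := by exact_mod_cast h.iter_mul
  have hre := h.re_pos (z := z) (by rw [Metric.mem_closedBall, dist_eq_norm, hz])
  have hne := one_add_mul_ne_zero (iterParam_nonneg h.mult_pos h.mult_lt_one 1)
    (div_re_nonneg hα hre.le)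
  have hα' : (α : ℂ) ≠ 0 := by exact_mod_cast hα.ne'
  have hpos : 0 < c * e - α ^ 2 := by nlinarith [h.pole_lt, h.centre_lt]
  have hpos' : (c : ℂ) * e - α ^ 2 ≠ 0 := by exact_mod_cast hpos.ne'
  have hzc : z - c ≠ 0 := by
    intro h0
    have hmem : z ∈ Metric.closedBall (c : ℂ) r := by
      rw [sub_eq_zero.1 h0]; exact Metric.mem_closedBall_self h.r_pos.le
    have := h.closedBall_subset hmem
    rw [Metric.mem_ball, dist_eq_norm, hz] at this
    exact lt_irrefl _ this
  have hcirc : (z - e) * (conj z - e) = R ^ 2 := by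
    have := Complex.mul_conj (z - e)
    rw [Complex.normSq_eq_norm_sq, hz, map_sub, conj_ofReal] at this
    rw [this]; push_cast; ring
  have hzc' : conj z - (c : ℂ) ≠ 0 := by
    rw [← conj_ofReal c, ← map_sub, Ne, map_eq_zero]; exact hzc
  rw [inversionReal, map_sub, conj_ofReal, mob]
  have hne2 : (α : ℂ) + iterParam μ 1 * z ≠ 0 := by
    intro h0; apply hne; field_simp; rw [h0, mul_zero]
  have e1 : (α : ℂ) * ((z / α + iterParam μ 1) / (1 + iterParam μ 1 * (z / α))) =
      α * (z + α * iterParam μ 1) / (α + iterParam μ 1 * z) := by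
    have : (1 : ℂ) + iterParam μ 1 * (z / α) = (α + iterParam μ 1 * z) / α := by field_simp
    rw [this]
    field_simp
  have e2 : (c : ℂ) + r ^ 2 / (conj z - c) = (c * conj z - α ^ 2) / (conj z - c) := by
    rw [eq_div_iff hzc', add_mul, div_mul_cancel₀ _ hzc']
    linear_combination -hc
  rw [e1, e2, div_eq_div_iff hne2 hzc']
  -- Multiplication by ce - α² makes the parameter enter only through the relation `hk`, after which
  -- the identity is a polynomial one on the circle.
  refine mul_left_cancel₀ hpos' ?_
  linear_combination (α ^ 2 * (conj z - c) - (c * conj z - α ^ 2) * z) * hk +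
    α * (c ^ 2 - α ^ 2) * (hcirc - he)

end

/-! ### Functions assembled from reflections -/

/-- Cauchy–Riemann. The conjugate is the reason for the minus sign in C₂ = -Im f₀. -/
lemma hasGradientAt_re {f : ℂ → ℂ} {f' x : ℂ} (h : HasDerivAt f f' x) :
    HasGradientAt (fun z => (f z).re) (conj f') x := by
  rw [hasGradientAt_iff_hasFDerivAt]
  refine (reCLM.hasFDerivAt.comp x h.complexToReal_fderiv).congr_fderiv ?_
  ext y
  simp [InnerProductSpace.toDual_apply_apply, Complex.inner]
  ring

/-- The holomorphic function whose real part is `glued` inside the circle. -/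
def innerPart (α μ τ : ℝ) (P N : ℂ → ℂ) (z : ℂ) : ℂ :=
  P z + τ * (N (mob α (iterParam μ 1) z) - N z)

/-- The holomorphic function whose real part is `glued` outside the circle. -/
def outerPart (α c r μ τ : ℝ) (P N : ℂ → ℂ) (z : ℂ) : ℂ :=
  P z + τ * (N (mob α (iterParam μ 1) z) - conj (N (inversionReal c r z)))

/-- The function `Re (P + τ (N ∘ T - N))` inside the circle of centre `c` and radius `r`, with `N`
replaced by its reflection outside. -/
def glued (α c r μ τ : ℝ) (P N : ℂ → ℂ) (z : ℂ) : ℝ :=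
  if ‖z - c‖ ≤ r then (innerPart α μ τ P N z).re else (outerPart α c r μ τ P N z).re

lemma outerPart_re (α c r μ τ : ℝ) (P N : ℂ → ℂ) (z : ℂ) :
    (outerPart α c r μ τ P N z).re =
      (P z + τ * (N (mob α (iterParam μ 1) z) - N (inversionReal c r z))).re := by
  simp [outerPart]

lemma glued_of_le {α c r μ τ : ℝ} {P N : ℂ → ℂ} {z : ℂ} (hz : ‖z - c‖ ≤ r) :
    glued α c r μ τ P N z = (innerPart α μ τ P N z).re := if_pos hz

/-- The two formulas agree on the circle because the inversion fixes it; this gives continuity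
across the interface. -/
lemma glued_of_ge {α c r μ τ : ℝ} {P N : ℂ → ℂ} {z : ℂ} (hr : 0 < r) (hz : r ≤ ‖z - c‖) :
    glued α c r μ τ P N z = (outerPart α c r μ τ P N z).re := by
  rcases hz.eq_or_lt with h | h
  · rw [glued_of_le h.ge, outerPart_re, innerPart, inversionReal_of_norm_eq hr h.symm]
  · exact if_neg (not_le.2 h)

section

variable {α c e r R μ τ : ℝ} {P N : ℂ → ℂ}

/-- The inversion is antiholomorphic, the conjugate of w ↦ c + r²/(w - c); the outer conjugation
makes the composition holomorphic again. -/
lemma hasDerivAt_conj_inversionReal {N' z : ℂ} (hz : z - c ≠ 0)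
    (hN : HasDerivAt N N' (inversionReal c r z)) :
    HasDerivAt (fun z => conj (N (inversionReal c r z)))
      (conj N' * (-(r ^ 2 / (z - c) ^ 2))) z := by
  have h1 : HasDerivAt (fun z : ℂ => (c : ℂ) + r ^ 2 / (z - c)) (-(r ^ 2 / (z - c) ^ 2)) z := by
    have := (((hasDerivAt_id z).sub_const (c : ℂ)).inv hz).const_mul ((r : ℂ) ^ 2)
    refine (this.const_add (c : ℂ)).congr_deriv ?_ |>.congr_of_eventuallyEq ?_
    · simp only [id]; ring
    · exact Eventually.of_forall fun w => by simp [div_eq_mul_inv]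
  have e : ∀ w, inversionReal c r w = conj ((c : ℂ) + r ^ 2 / (w - c)) := fun w => by
    simp [inversionReal]
  have h2 := hN
  rw [e] at h2
  have h3 := h2.conj_conj
  rw [Complex.conj_conj] at h3
  refine (h3.comp z h1).congr_of_eventuallyEq (Eventually.of_forall fun w => ?_)
  simp [e]

lemma hasDerivAt_innerPart (h : CircleConfig α c e r R μ)
    (hP : DifferentiableOn ℂ P (Metric.ball (e : ℂ) R))
    (hN : DifferentiableOn ℂ N (Metric.ball (e : ℂ) R)) {z : ℂ} (hz : z ∈ Metric.ball (e : ℂ) R) :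
    HasDerivAt (innerPart α μ τ P N) (deriv P z + τ * (deriv N (mob α (iterParam μ 1) z) *
      mobDeriv α (iterParam μ 1) z - deriv N z)) z := by
  have hU := h.isTranslationDomain_ball
  have d : ∀ {Q : ℂ → ℂ} {w : ℂ}, DifferentiableOn ℂ Q (Metric.ball (e : ℂ) R) →
      w ∈ Metric.ball (e : ℂ) R → HasDerivAt Q (deriv Q w) w := fun hQ hw =>
    (hQ.differentiableAt (Metric.isOpen_ball.mem_nhds hw)).hasDerivAt
  have hm := hasDerivAt_mob h.pole_pos (hU.re_nonneg z hz)
    (iterParam_nonneg h.mult_pos h.mult_lt_one 1)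
  exact (d hP hz).add ((((d hN (hU.iterate_mem h.mult_pos h.mult_lt_one hz 1)).comp z hm).sub
    (d hN hz)).const_mul _)

lemma hasDerivAt_outerPart (h : CircleConfig α c e r R μ)
    (hP : DifferentiableOn ℂ P (Metric.ball (e : ℂ) R))
    (hN : DifferentiableOn ℂ N (Metric.ball (e : ℂ) R)) {z : ℂ} (hz : z ∈ Metric.ball (e : ℂ) R)
    (hzr : r ≤ ‖z - c‖) :
    HasDerivAt (outerPart α c r μ τ P N) (deriv P z + τ * (deriv N (mob α (iterParam μ 1) z) *
      mobDeriv α (iterParam μ 1) z -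
        conj (deriv N (inversionReal c r z)) * (-(r ^ 2 / (z - c) ^ 2)))) z := by
  have hU := h.isTranslationDomain_ball
  have d : ∀ {Q : ℂ → ℂ} {w : ℂ}, DifferentiableOn ℂ Q (Metric.ball (e : ℂ) R) →
      w ∈ Metric.ball (e : ℂ) R → HasDerivAt Q (deriv Q w) w := fun hQ hw =>
    (hQ.differentiableAt (Metric.isOpen_ball.mem_nhds hw)).hasDerivAt
  have hm := hasDerivAt_mob h.pole_pos (hU.re_nonneg z hz)
    (iterParam_nonneg h.mult_pos h.mult_lt_one 1)
  have hzc : z - c ≠ 0 := norm_pos_iff.1 (h.r_pos.trans_le hzr)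
  exact (d hP hz).add ((((d hN (hU.iterate_mem h.mult_pos h.mult_lt_one hz 1)).comp z hm).sub
    (hasDerivAt_conj_inversionReal hzc (d hN (inversionReal_mem h hzr)))).const_mul _)

/-- Neither the translation, nor the inversion outside its circle, expands: both have derivative at
most 1 in modulus. So bounds for P' and N' pass to the glued function, on both sides of the
interface. -/
lemma norm_gradient_glued_le {A B : ℝ} (h : CircleConfig α c e r R μ) (hτ : |τ| ≤ 1)
    (hP : DifferentiableOn ℂ P (Metric.ball (e : ℂ) R))
    (hN : DifferentiableOn ℂ N (Metric.ball (e : ℂ) R))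
    (hA : ∀ z ∈ Metric.ball (e : ℂ) R, ‖deriv P z‖ ≤ A)
    (hB : ∀ z ∈ Metric.ball (e : ℂ) R, ‖deriv N z‖ ≤ B) {z : ℂ}
    (hz : z ∈ Metric.ball (e : ℂ) R) (hzr : ‖z - c‖ ≠ r) :
    ∃ w, HasGradientAt (glued α c r μ τ P N) w z ∧ ‖w‖ ≤ A + 2 * B := by
  have hU := h.isTranslationDomain_ball
  have hκ0 := iterParam_nonneg h.mult_pos h.mult_lt_one 1
  have hm := norm_mobDeriv_le h.pole_pos (hU.re_nonneg z hz) hκ0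
    (iterParam_lt_one h.mult_pos 1).le
  have hB0 : 0 ≤ B := (norm_nonneg _).trans (hB z hz)
  have hfirst : ‖deriv N (mob α (iterParam μ 1) z) * mobDeriv α (iterParam μ 1) z‖ ≤ B := by
    rw [norm_mul]
    have h1 := hB _ (hU.iterate_mem h.mult_pos h.mult_lt_one hz 1)
    calc _ ≤ B * 1 := mul_le_mul h1 (hm.trans (by nlinarith)) (norm_nonneg _) hB0
      _ = B := mul_one B
  have hbound : ∀ w, ‖w‖ ≤ B → ‖deriv P z + τ * (deriv N (mob α (iterParam μ 1) z) *
      mobDeriv α (iterParam μ 1) z - w)‖ ≤ A + 2 * B := by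
    intro w hw
    refine (norm_add_le _ _).trans (add_le_add (hA z hz) ?_)
    rw [norm_mul, Complex.norm_real, Real.norm_eq_abs]
    exact (mul_le_of_le_one_left (norm_nonneg _) hτ).trans
      ((norm_sub_le _ _).trans (by linarith))
  rcases lt_or_gt_of_ne hzr with hlt | hgt
  · have hd := hasGradientAt_re (hasDerivAt_innerPart (τ := τ) h hP hN hz)
    refine ⟨_, hd.congr_of_eventuallyEq ?_, ?_⟩
    · have : ∀ᶠ w : ℂ in 𝓝 z, ‖w - c‖ < r :=
        (by fun_prop : Continuous fun w : ℂ => ‖w - c‖).continuousAt.eventually_lt_const hlt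
      filter_upwards [this] with w hw using glued_of_le hw.le
    · rw [Complex.norm_conj]
      exact hbound _ (hB z hz)
  · have hd := hasGradientAt_re (hasDerivAt_outerPart (τ := τ) h hP hN hz hgt.le)
    refine ⟨_, hd.congr_of_eventuallyEq ?_, ?_⟩
    · have : ∀ᶠ w : ℂ in 𝓝 z, r < ‖w - c‖ :=
        (by fun_prop : Continuous fun w : ℂ => ‖w - c‖).continuousAt.eventually_const_lt hgt
      filter_upwards [this] with w hw using glued_of_ge h.r_pos hw.le
    · rw [Complex.norm_conj]
      refine hbound _ ?_
      rw [norm_mul, Complex.norm_conj, norm_neg, norm_div, norm_pow, norm_pow, Complex.norm_real,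
        Real.norm_of_nonneg h.r_pos.le]
      have h1 := hB _ (inversionReal_mem h hgt.le)
      have h2 : r ^ 2 / ‖z - c‖ ^ 2 ≤ 1 := by
        apply div_le_one_of_le₀ _ (by positivity)
        have := h.r_pos
        gcongr
      calc _ ≤ B * 1 := mul_le_mul h1 h2 (by positivity) hB0
        _ = B := mul_one B

lemma harmonicAt_glued (h : CircleConfig α c e r R μ)
    (hP : DifferentiableOn ℂ P (Metric.ball (e : ℂ) R))
    (hN : DifferentiableOn ℂ N (Metric.ball (e : ℂ) R)) {x₀ : ℝ} {x : ℂ}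
    (hz : x + x₀ ∈ Metric.ball (e : ℂ) R) (hzr : ‖x + x₀ - c‖ ≠ r) :
    HarmonicAt (fun x : ℂ => glued α c r μ τ P N (x + x₀)) x := by
  have hc : Continuous fun w : ℂ => ‖w + x₀ - c‖ := by fun_prop
  have hc2 : Continuous fun w : ℂ => w + x₀ := by fun_prop
  have hball : IsOpen {w : ℂ | w + x₀ ∈ Metric.ball (e : ℂ) R} := Metric.isOpen_ball.preimage hc2
  rcases lt_or_gt_of_ne hzr with hlt | hgt
  · have han : AnalyticAt ℂ (fun w : ℂ => innerPart α μ τ P N (w + x₀)) x := by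
      refine DifferentiableOn.analyticAt (s := {w : ℂ | w + x₀ ∈ Metric.ball (e : ℂ) R})
        (fun w hw => ?_) (hball.mem_nhds hz)
      exact ((hasDerivAt_innerPart h hP hN hw).comp_add_const w
        (x₀ : ℂ)).differentiableAt.differentiableWithinAt
    refine (harmonicAt_congr_nhds ?_).2 han.harmonicAt_re
    filter_upwards [hc.continuousAt.eventually_lt_const hlt] with w hw using glued_of_le hw.le
  · have hopen : IsOpen {w : ℂ | w + x₀ ∈ Metric.ball (e : ℂ) R ∧ r < ‖w + x₀ - c‖} :=
      hball.inter (isOpen_lt continuous_const hc)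
    have han : AnalyticAt ℂ (fun w : ℂ => outerPart α c r μ τ P N (w + x₀)) x := by
      refine DifferentiableOn.analyticAt
        (s := {w : ℂ | w + x₀ ∈ Metric.ball (e : ℂ) R ∧ r < ‖w + x₀ - c‖})
        (fun w hw => ?_) (hopen.mem_nhds ⟨hz, hgt⟩)
      exact ((hasDerivAt_outerPart h hP hN hw.1 hw.2.le).comp_add_const w
        (x₀ : ℂ)).differentiableAt.differentiableWithinAt
    refine (harmonicAt_congr_nhds ?_).2 han.harmonicAt_re
    filter_upwards [hc.continuousAt.eventually_const_lt hgt] with w hw using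
      glued_of_ge h.r_pos hw.le

lemma continuousOn_glued (h : CircleConfig α c e r R μ)
    (hP : ContinuousOn P (Metric.closedBall (e : ℂ) R))
    (hN : ContinuousOn N (Metric.closedBall (e : ℂ) R)) :
    ContinuousOn (glued α c r μ τ P N) (Metric.closedBall (e : ℂ) R) := by
  have hU := h.isTranslationDomain_closedBall
  have hmob : ContinuousOn (fun z => N (mob α (iterParam μ 1) z)) (Metric.closedBall (e : ℂ) R) :=
    hN.comp (fun z hz => (hasDerivAt_mob h.pole_pos (hU.re_nonneg z hz)
      (iterParam_nonneg h.mult_pos h.mult_lt_one 1)).continuousAt.continuousWithinAt)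
      fun z hz => hU.iterate_mem h.mult_pos h.mult_lt_one hz 1
  have hc : Continuous fun w : ℂ => ‖w - c‖ := by fun_prop
  have hA : IsClosed (Metric.closedBall (e : ℂ) R ∩ {z | ‖z - c‖ ≤ r}) :=
    Metric.isClosed_closedBall.inter (isClosed_le hc continuous_const)
  have hB : IsClosed (Metric.closedBall (e : ℂ) R ∩ {z | r ≤ ‖z - c‖}) :=
    Metric.isClosed_closedBall.inter (isClosed_le continuous_const hc)
  have hcov : Metric.closedBall (e : ℂ) R = Metric.closedBall (e : ℂ) R ∩ {z | ‖z - c‖ ≤ r} ∪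
      Metric.closedBall (e : ℂ) R ∩ {z | r ≤ ‖z - c‖} := by
    ext z
    simp only [mem_union, mem_inter_iff, mem_ofPred_eq]
    have := le_total ‖z - c‖ r
    tauto
  rw [hcov]
  refine ContinuousOn.union_of_isClosed ?_ ?_ hA hB
  · refine ContinuousOn.congr (f := fun z => (innerPart α μ τ P N z).re) ?_
      fun z hz => glued_of_le hz.2
    refine continuous_re.comp_continuousOn (ContinuousOn.mono ?_ inter_subset_left)
    exact hP.add (continuousOn_const.mul (hmob.sub hN))
  · refine ContinuousOn.congr (f := fun z => (outerPart α c r μ τ P N z).re) ?_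
      fun z hz => glued_of_ge h.r_pos hz.2
    have hinv : ContinuousOn (fun z => N (inversionReal c r z))
        (Metric.closedBall (e : ℂ) R ∩ {z | r ≤ ‖z - c‖}) := by
      refine hN.comp ?_ fun z hz => Metric.ball_subset_closedBall (inversionReal_mem h hz.2)
      unfold inversionReal
      refine continuousOn_const.add (continuousOn_const.div ?_ fun z hz => ?_)
      · exact (continuous_conj.comp (by fun_prop : Continuous fun z : ℂ => z - c)).continuousOn
      · rw [Ne, map_eq_zero]
        exact norm_pos_iff.1 (h.r_pos.trans_le hz.2)
    refine continuous_re.comp_continuousOn ?_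
    exact (hP.mono inter_subset_left).add (continuousOn_const.mul
      ((hmob.mono inter_subset_left).sub (continuous_conj.comp_continuousOn hinv)))

lemma hasDerivAt_re_line {N' x ν : ℂ} (hN : HasDerivAt N N' x) :
    HasDerivAt (fun t : ℝ => (N (x + t • ν)).re) (N' * ν).re 0 := by
  have h1 : HasDerivAt (fun t : ℂ => x + t * ν) ν ((0 : ℝ) : ℂ) := by
    simpa using ((hasDerivAt_id ((0 : ℝ) : ℂ)).mul_const ν).const_add x
  have h2 : HasDerivAt N N' (x + ((0 : ℝ) : ℂ) * ν) := by simpa using hN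
  simpa [Complex.real_smul] using! (h2.comp ((0 : ℝ) : ℂ) h1).real_of_complex

end

/-! ### The explicit solution -/

/-- `F` is holomorphic in the outer disk, continuous up to the boundary, and its real part has
boundary values `g`. -/
structure IsHolomorphicExtension (re : ℝ) (g : ℂ → ℝ) (F : ℂ → ℂ) : Prop where
  differentiableOn : DifferentiableOn ℂ F (Metric.ball (re : ℂ) re)
  continuousOn : ContinuousOn F (Metric.closedBall (re : ℂ) re)
  boundary : ∀ x ∈ Metric.sphere (re : ℂ) re, (F x).re = g x

/-- The function `F` in the translated coordinate. -/
def translated (ri re ε : ℝ) (F : ℂ → ℂ) (z : ℂ) : ℂ := F (z - x0 ri re ε)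

/-- The solution of the transmission problem, as a series of images. -/
def imageSolution (ri re ε k : ℝ) (F : ℂ → ℂ) (x : ℂ) : ℝ :=
  glued (poleDist ri re ε) (ci ri re ε) ri (multiplier ri re ε) (tau k) (translated ri re ε F)
    (imageSeries (poleDist ri re ε) (multiplier ri re ε) (tau k) (translated ri re ε F))
    (x + x0 ri re ε)

lemma abs_tau_lt_one {k : ℝ} (hk : 0 < k) : |tau k| < 1 := by
  rw [tau, abs_div, abs_of_pos (by linarith : 0 < k + 1), div_lt_one (by linarith), abs_lt]
  constructor <;> linarith

section

variable {ri re ε k : ℝ} {g : ℂ → ℝ} {F : ℂ → ℂ}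

lemma add_x0_sub_ce (ri re ε : ℝ) (x : ℂ) :
    x + x0 ri re ε - ce ri re ε = x - re := by
  rw [x0]; push_cast; ring

lemma add_x0_sub_ci (ri re ε : ℝ) (x : ℂ) :
    x + x0 ri re ε - ci ri re ε = x - ((ri + ε : ℝ) : ℂ) := by
  rw [← centre_add_x0]; push_cast; ring

lemma add_x0_mem_ball {x : ℂ} :
    x + x0 ri re ε ∈ Metric.ball (ce ri re ε : ℂ) re ↔ x ∈ Metric.ball (re : ℂ) re := by
  rw [Metric.mem_ball, Metric.mem_ball, dist_eq_norm, dist_eq_norm, add_x0_sub_ce]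

lemma add_x0_mem_closedBall {x : ℂ} :
    x + x0 ri re ε ∈ Metric.closedBall (ce ri re ε : ℂ) re ↔
      x ∈ Metric.closedBall (re : ℂ) re := by
  rw [Metric.mem_closedBall, Metric.mem_closedBall, dist_eq_norm, dist_eq_norm, add_x0_sub_ce]

lemma sub_x0_mem_ball {z : ℂ} :
    z - x0 ri re ε ∈ Metric.ball (re : ℂ) re ↔ z ∈ Metric.ball (ce ri re ε : ℂ) re := by
  rw [← add_x0_mem_ball (ri := ri) (ε := ε), sub_add_cancel]

lemma sub_x0_mem_closedBall {z : ℂ} :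
    z - x0 ri re ε ∈ Metric.closedBall (re : ℂ) re ↔
      z ∈ Metric.closedBall (ce ri re ε : ℂ) re := by
  rw [← add_x0_mem_closedBall (ri := ri) (ε := ε), sub_add_cancel]

lemma IsHolomorphicExtension.hasDerivAt_translated (hF : IsHolomorphicExtension re g F) {z : ℂ}
    (hz : z ∈ Metric.ball (ce ri re ε : ℂ) re) :
    HasDerivAt (translated ri re ε F) (deriv F (z - x0 ri re ε)) z := by
  have h := (hF.differentiableOn.differentiableAt
    (Metric.isOpen_ball.mem_nhds (sub_x0_mem_ball.2 hz))).hasDerivAt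
  exact h.comp_sub_const z (x0 ri re ε : ℂ)

lemma IsHolomorphicExtension.differentiableOn_translated (hF : IsHolomorphicExtension re g F) :
    DifferentiableOn ℂ (translated ri re ε F) (Metric.ball (ce ri re ε : ℂ) re) := fun _ hz =>
  (hF.hasDerivAt_translated hz).differentiableAt.differentiableWithinAt

lemma IsHolomorphicExtension.continuousOn_translated (hF : IsHolomorphicExtension re g F) :
    ContinuousOn (translated ri re ε F) (Metric.closedBall (ce ri re ε : ℂ) re) :=
  hF.continuousOn.comp (by fun_prop) fun _ hz => sub_x0_mem_closedBall.2 hz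

lemma IsHolomorphicExtension.exists_bound (hF : IsHolomorphicExtension re g F) :
    ∃ B, ∀ ri ε, ∀ z ∈ Metric.closedBall (ce ri re ε : ℂ) re, ‖translated ri re ε F z‖ ≤ B := by
  obtain ⟨B, hB⟩ := (isCompact_closedBall (re : ℂ) re).exists_bound_of_continuousOn hF.continuousOn
  exact ⟨B, fun ri ε z hz => hB _ (sub_x0_mem_closedBall.2 hz)⟩

lemma IsHolomorphicExtension.hasDerivAt_imageSeries (hF : IsHolomorphicExtension re g F)
    (hri : 0 < ri) (h0 : 0 < ε) (h1 : ε < re - ri) (hk : 0 < k) {z : ℂ}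
    (hz : z ∈ Metric.ball (ce ri re ε : ℂ) re) :
    HasDerivAt (imageSeries (poleDist ri re ε) (multiplier ri re ε) (tau k)
        (translated ri re ε F))
      (imageSeriesDeriv (poleDist ri re ε) (multiplier ri re ε) (tau k)
        (translated ri re ε F) z) z := by
  have h := circleConfig hri h0 h1
  obtain ⟨B, hB⟩ := hF.exists_bound
  exact NearlyTouchingDisks.hasDerivAt_imageSeries h.pole_pos h.isTranslationDomain_ball
    Metric.isOpen_ball h.mult_pos h.mult_lt_one (abs_tau_lt_one hk) hF.differentiableOn_translated
    (fun z hz => hB _ _ z (Metric.ball_subset_closedBall hz)) hz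

/-- By the functional equation the glued function is (1 - τ) Re G inside, and Re G - τ Re (G ∘
inversion) outside. The first form in terms of F gives the boundary values, these two forms give the
transmission condition. -/
lemma isSolution_imageSolution (hF : IsHolomorphicExtension re g F)
    (hri : 0 < ri) (h0 : 0 < ε) (h1 : ε < re - ri) (hk : 0 < k) :
    IsSolution ri re ε k g (imageSolution ri re ε k F) := by
  have h := circleConfig hri h0 h1
  obtain ⟨B, hB'⟩ := hF.exists_bound
  have hB := hB' ri ε
  have hτ := abs_tau_lt_one hk
  set α := poleDist ri re ε
  set μ := multiplier ri re ε
  set c := ci ri re ε with hc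
  set e := ce ri re ε with he
  set τ := tau k with hτdef
  set P := translated ri re ε F with hP
  set G := imageSeries α μ τ P with hG
  have hre : 0 < re := h.R_pos
  have hcl : closure (outerDisk re) = Metric.closedBall (re : ℂ) re :=
    closure_ball _ hre.ne'
  have hPd : DifferentiableOn ℂ P (Metric.ball (e : ℂ) re) := hF.differentiableOn_translated
  have hPc : ContinuousOn P (Metric.closedBall (e : ℂ) re) := hF.continuousOn_translated
  have hGd' : ∀ z ∈ Metric.ball (e : ℂ) re, HasDerivAt G (imageSeriesDeriv α μ τ P z) z :=
    fun z hz => hF.hasDerivAt_imageSeries hri h0 h1 hk hz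
  have hGd : DifferentiableOn ℂ G (Metric.ball (e : ℂ) re) := fun z hz =>
    (hGd' z hz).differentiableAt.differentiableWithinAt
  have hGc : ContinuousOn G (Metric.closedBall (e : ℂ) re) :=
    continuousOn_imageSeries h.pole_pos h.isTranslationDomain_closedBall h.mult_pos h.mult_lt_one
      hτ hPc hB
  have hfe : ∀ z ∈ Metric.closedBall (e : ℂ) re, G z = P z + τ * G (mob α (iterParam μ 1) z) :=
    fun z hz => imageSeries_eq h.pole_pos h.isTranslationDomain_closedBall h.mult_pos
      h.mult_lt_one hτ hB hz
  have hinner : ∀ z ∈ Metric.closedBall (e : ℂ) re,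
      (innerPart α μ τ P G z).re = (1 - τ) * (G z).re := by
    intro z hz
    have : innerPart α μ τ P G z = ((1 - τ : ℝ) : ℂ) * G z := by
      rw [innerPart]; push_cast; linear_combination -hfe z hz
    rw [this, Complex.re_ofReal_mul]
  have houter : ∀ z ∈ Metric.closedBall (e : ℂ) re,
      (outerPart α c ri μ τ P G z).re = (G z).re - τ * (G (inversionReal c ri z)).re := by
    intro z hz
    have : P z + τ * (G (mob α (iterParam μ 1) z) - G (inversionReal c ri z)) =
        G z - τ * G (inversionReal c ri z) := by linear_combination -hfe z hz
    rw [outerPart_re, this, sub_re, Complex.re_ofReal_mul]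
  have hsub : inclusion ri ε ⊆ outerDisk re := by
    intro x hx
    rw [inclusion, Metric.mem_ball, dist_eq_norm, ← add_x0_sub_ci (re := re)] at hx
    refine add_x0_mem_ball.1 (h.closedBall_subset ?_)
    rw [Metric.mem_closedBall, dist_eq_norm]
    exact hx.le
  have hclD : closure (inclusion ri ε) = Metric.closedBall ((ri + ε : ℝ) : ℂ) ri :=
    closure_ball _ hri.ne'
  refine ⟨?_, ?_, ?_, ?_, ?_⟩
  · rw [hcl]
    refine (continuousOn_glued (τ := τ) h hPc hGc).comp (by fun_prop) fun x hx => ?_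
    exact add_x0_mem_closedBall.2 hx
  · intro x hx
    refine harmonicAt_glued h hPd hGd (add_x0_mem_ball.2 (hsub hx)) ?_
    rw [inclusion, Metric.mem_ball, dist_eq_norm, ← add_x0_sub_ci (re := re)] at hx
    exact hx.ne
  · intro x hx
    refine harmonicAt_glued h hPd hGd (add_x0_mem_ball.2 hx.1) ?_
    have hx2 := hx.2
    rw [hclD, Metric.mem_closedBall, dist_eq_norm, ← add_x0_sub_ci (re := re), not_le] at hx2
    exact hx2.ne'
  · intro x hx
    have hx' : x ∈ Metric.closedBall (re : ℂ) re := Metric.sphere_subset_closedBall hx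
    have hz : x + x0 ri re ε ∈ Metric.closedBall (e : ℂ) re := add_x0_mem_closedBall.2 hx'
    have hze : ‖x + x0 ri re ε - e‖ = re := by
      rw [he, add_x0_sub_ce]
      exact mem_sphere_iff_norm.1 hx
    have hzc : ri ≤ ‖x + x0 ri re ε - c‖ := by
      by_contra hlt
      have := h.closedBall_subset (mem_closedBall_iff_norm.2 (not_le.1 hlt).le)
      rw [mem_ball_iff_norm, hze] at this
      exact lt_irrefl _ this
    -- On the outer circle the translate and the reflection of the point coincide, so the two terms
    -- with G cancel.
    rw [imageSolution, glued_of_ge hri hzc, outerPart_re, mob_eq_inversionReal h hze, sub_self,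
      mul_zero, add_zero, translated, add_sub_cancel_right]
    exact hF.boundary x hx
  · intro x hx
    rw [interface, mem_sphere_iff_norm] at hx
    have hzc : ‖x + x0 ri re ε - c‖ = ri := by rw [hc, add_x0_sub_ci]; exact hx
    have hzB : x + x0 ri re ε ∈ Metric.ball (e : ℂ) re :=
      h.closedBall_subset (mem_closedBall_iff_norm.2 hzc.le)
    set ν : ℂ := ri⁻¹ • (x - ((ri + ε : ℝ) : ℂ)) with hν
    have hνn : ‖ν‖ = 1 := by
      rw [hν, norm_smul, hx, Real.norm_of_nonneg (by positivity), inv_mul_cancel₀ hri.ne']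
    have hxν : x - ((ri + ε : ℝ) : ℂ) = ri * ν := by
      rw [hν, Complex.real_smul]; push_cast
      rw [mul_inv_cancel_left₀]
      exact_mod_cast hri.ne'
    set z := x + x0 ri re ε with hzdef
    have hline : ∀ t : ℝ, x + t • ν + x0 ri re ε - c = ((ri + t : ℝ) : ℂ) * ν := by
      intro t
      rw [hc, add_x0_sub_ci, add_sub_right_comm, hxν, Complex.real_smul]
      push_cast; ring
    have hnorm : ∀ t : ℝ, -ri ≤ t → ‖x + t • ν + x0 ri re ε - c‖ = ri + t := by
      intro t ht
      rw [hline, norm_mul, hνn, mul_one, Complex.norm_real, Real.norm_of_nonneg (by linarith)]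
    have hcomm : ∀ t : ℝ, x + t • ν + x0 ri re ε = z + t • ν := fun t => by
      rw [hzdef]; ring
    have hd := hGd' z hzB
    set G' := imageSeriesDeriv α μ τ P z
    have hmem : ∀ᶠ t : ℝ in 𝓝 0, z + t • ν ∈ Metric.ball (e : ℂ) re := by
      have hcont : Continuous fun t : ℝ => z + t • ν := by fun_prop
      refine hcont.continuousAt.eventually_mem ?_
      rw [zero_smul, add_zero]
      exact Metric.isOpen_ball.mem_nhds hzB
    have hgt : ∀ᶠ t : ℝ in 𝓝 0, -ri ≤ t :=
      (eventually_gt_nhds (by linarith : -ri < (0 : ℝ))).mono fun t ht => ht.le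
    have hline1 : HasDerivAt (fun t : ℝ => (G (z + t • ν)).re) (G' * ν).re 0 :=
      hasDerivAt_re_line hd
    -- The inner normal derivative; the outer one is (1 + τ) Re(G'ν), and k(1 - τ) = 1 + τ by the
    -- definition of τ.
    refine ⟨(1 - τ) * (G' * ν).re, ?_, ?_⟩
    · have hk1 : k * ((1 - τ) * (G' * ν).re) = (1 + τ) * (G' * ν).re := by
        have : k * (1 - τ) = 1 + τ := by
          rw [hτdef, tau]; field_simp; ring
        rw [← mul_assoc, this]
      rw [hk1]
      -- On a radius the inversion sends c + (ri + t)ν to c + ri²/(ri + t) ν, whose derivative at t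
      -- = 0 is -ν.
      have hinv : HasDerivAt (fun t : ℝ => (G (inversionReal c ri (z + t • ν))).re)
          (-(G' * ν).re) 0 := by
        have hq : HasDerivAt (fun t : ℂ => c + (ri : ℂ) ^ 2 / (ri + t) * ν) (-ν)
            ((0 : ℝ) : ℂ) := by
          have hne : (ri : ℂ) + ((0 : ℝ) : ℂ) ≠ 0 := by
            simpa using hri.ne'
          have := ((((hasDerivAt_id ((0 : ℝ) : ℂ)).const_add (ri : ℂ)).inv hne).const_mul
            ((ri : ℂ) ^ 2)).mul_const ν |>.const_add (c : ℂ)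
          refine (this.congr_deriv ?_).congr_of_eventuallyEq (Eventually.of_forall fun t => ?_)
          · have : (ri : ℂ) ≠ 0 := by exact_mod_cast hri.ne'
            simp only [ofReal_zero, id, add_zero]
            field_simp
          · simp [div_eq_mul_inv]
        have hzν : (c : ℂ) + (ri : ℂ) ^ 2 / (ri + ((0 : ℝ) : ℂ)) * ν = z := by
          have : (ri : ℂ) ≠ 0 := by exact_mod_cast hri.ne'
          have h2 := hline 0
          rw [zero_smul, add_zero, add_zero] at h2
          rw [ofReal_zero, add_zero, sq, mul_div_assoc, div_self this, mul_one, ← h2, hzdef]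
          ring
        have hd' := hd
        rw [← hzν] at hd'
        have := (hd'.comp ((0 : ℝ) : ℂ) hq).real_of_complex
        refine (this.congr_deriv (by simp)).congr_of_eventuallyEq ?_
        filter_upwards [eventually_gt_nhds (by linarith : -ri < (0 : ℝ))] with t ht
        have hνν : ν * conj ν = 1 := by
          rw [Complex.mul_conj, Complex.normSq_eq_norm_sq, hνn]; simp
        have hν0 : conj ν ≠ 0 := right_ne_zero_of_mul_eq_one hνν
        have hrt : ((ri : ℂ) + t) ≠ 0 := by exact_mod_cast (by linarith : ri + t ≠ 0)
        simp only [Function.comp]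
        congr 2
        rw [inversionReal, ← hcomm, hline, map_mul, conj_ofReal]
        congr 1
        push_cast
        rw [div_mul_eq_mul_div, div_eq_div_iff (mul_ne_zero hrt hν0) hrt]
        linear_combination -(ri : ℂ) ^ 2 * (ri + t) * hνν
      have hsum : HasDerivAt (fun t : ℝ => (G (z + t • ν)).re -
          τ * (G (inversionReal c ri (z + t • ν))).re) ((1 + τ) * (G' * ν).re) 0 :=
        (hline1.sub (hinv.const_mul τ)).congr_deriv (by ring)
      refine hsum.hasDerivWithinAt.congr_of_eventuallyEq_of_mem ?_ self_mem_Ici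
      filter_upwards [self_mem_nhdsWithin, nhdsWithin_le_nhds hmem,
        nhdsWithin_le_nhds hgt] with t ht htm htr
      rw [imageSolution, glued_of_ge hri, ← houter _ (Metric.ball_subset_closedBall htm), hcomm]
      rw [hnorm t htr]
      linarith [mem_Ici.1 ht]
    · refine (hline1.const_mul (1 - τ)).hasDerivWithinAt.congr_of_eventuallyEq_of_mem ?_
        self_mem_Iic
      filter_upwards [self_mem_nhdsWithin, nhdsWithin_le_nhds hmem,
        nhdsWithin_le_nhds hgt] with t ht htm htr
      rw [imageSolution, glued_of_le, ← hinner _ (Metric.ball_subset_closedBall htm), hcomm]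
      rw [hnorm t htr]
      linarith [mem_Iic.1 ht]

end

/-! ### Uniqueness -/

/-- Mean value property: ‖z - c‖² is a harmonic function q plus ‖z - y‖². On a circle of radius ρ
about a local maximum y, h + aq would be at most its value at y minus aρ², contradicting its
average. -/
lemma not_isLocalMax_harmonic_add {h : ℂ → ℝ} {y c : ℂ} {a : ℝ} (ha : 0 < a)
    (hh : HarmonicAt h y) : ¬ IsLocalMax (fun x => h x + a * ‖x - c‖ ^ 2) y := by
  intro hmax
  set q : ℂ → ℝ := fun z => (((‖y - c‖ ^ 2 : ℝ) : ℂ) + 2 * (conj (y - c) * (z - y))).re with hq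
  have hqh : ∀ z, HarmonicAt q z := fun z =>
    AnalyticAt.harmonicAt_re (f := fun z => ((‖y - c‖ ^ 2 : ℝ) : ℂ) + 2 * (conj (y - c) * (z - y)))
      (by fun_prop)
  have hqz : ∀ z, ‖z - c‖ ^ 2 = q z + ‖z - y‖ ^ 2 := by
    intro z
    simp only [hq, ← Complex.normSq_eq_norm_sq, Complex.normSq_apply, sub_re, sub_im, add_re,
      mul_re, mul_im, conj_re, conj_im, ofReal_re, re_ofNat, im_ofNat]
    ring
  obtain ⟨R, hR, hball⟩ := Metric.eventually_nhds_iff_ball.1 (hh.eventually.and hmax)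
  have hR2 : 0 < R / 2 := by linarith
  have hsub : Metric.closedBall y (R / 2) ⊆ Metric.ball y R :=
    Metric.closedBall_subset_ball (by linarith)
  have hf : HarmonicOnNhd (h + a • q) (Metric.closedBall y |R / 2|) := by
    rw [abs_of_pos hR2]
    exact fun z hz => (hball z (hsub hz)).1.add ((hqh z).const_smul)
  have havg := InnerProductSpace.HarmonicOnNhd.circleAverage_eq hf
  have hint : CircleIntegrable (h + a • q) y (R / 2) :=
    (hf.contDiffOn.continuousOn.mono Metric.sphere_subset_closedBall).circleIntegrable'
  have hle := Real.circleAverage_mono_on_of_le_circle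
    (a := h y + a * ‖y - c‖ ^ 2 - a * (R / 2) ^ 2) hint (fun z hz => by
      rw [abs_of_pos hR2] at hz
      have h1 := (hball z (hsub (Metric.sphere_subset_closedBall hz))).2
      have h2 : ‖z - y‖ = R / 2 := mem_sphere_iff_norm.1 hz
      simp only at h1
      rw [hqz z, h2] at h1
      simp only [Pi.add_apply, Pi.smul_apply, smul_eq_mul]
      linarith)
  rw [havg] at hle
  have h3 := hqz y
  simp only [sub_self, norm_zero] at h3
  simp only [Pi.add_apply, Pi.smul_apply, smul_eq_mul] at hle
  nlinarith [mul_pos ha (pow_pos hR2 2)]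

lemma deriv_right_nonpos {f : ℝ → ℝ} {f' : ℝ} (hf : HasDerivWithinAt f f' (Ici 0) 0)
    (h : ∀ᶠ t in 𝓝 0, f t ≤ f 0) : f' ≤ 0 := by
  have hmax : IsLocalMaxOn f (Ici 0) 0 := h.filter_mono nhdsWithin_le_nhds
  have := hmax.hasFDerivWithinAt_nonpos hf.hasFDerivWithinAt (y := 1)
    (mem_posTangentConeAt_of_segment_subset (by
      rw [zero_add, segment_eq_Icc zero_le_one]; exact Icc_subset_Ici_self))
  simpa using this

lemma deriv_left_nonneg {f : ℝ → ℝ} {f' : ℝ} (hf : HasDerivWithinAt f f' (Iic 0) 0)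
    (h : ∀ᶠ t in 𝓝 0, f t ≤ f 0) : 0 ≤ f' := by
  have hmax : IsLocalMaxOn f (Iic 0) 0 := h.filter_mono nhdsWithin_le_nhds
  have := hmax.hasFDerivWithinAt_nonpos hf.hasFDerivWithinAt (y := -1)
    (mem_posTangentConeAt_of_segment_subset (by
      rw [zero_add, segment_symm, segment_eq_Icc (by norm_num)]; exact Icc_subset_Iic_self))
  simpa using this

/-- The barrier: it is subharmonic and its normal derivative has a positive jump on the circle. -/
def barrier (c : ℂ) (r η : ℝ) (x : ℂ) : ℝ := Real.log (max ‖x - c‖ r / r) + η * ‖x - c‖ ^ 2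

lemma continuous_barrier (c : ℂ) {r : ℝ} (hr : 0 < r) (η : ℝ) : Continuous (barrier c r η) := by
  unfold barrier
  refine Continuous.add (Continuous.log (by fun_prop) fun x => ?_) (by fun_prop)
  have : 0 < max ‖x - c‖ r := lt_max_of_lt_right hr
  positivity

lemma barrier_nonneg (c : ℂ) {r η : ℝ} (hr : 0 < r) (hη : 0 ≤ η) (x : ℂ) :
    0 ≤ barrier c r η x := by
  refine add_nonneg (Real.log_nonneg ?_) (by positivity)
  rw [le_div_iff₀ hr, one_mul]
  exact le_max_right _ _

section

variable {ri re ε k : ℝ} {g u v : ℂ → ℝ}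

/-- Maximum principle for u - v + δψ with the barrier ψ. An interior maximum off the interface is
excluded by strict subharmonicity, and one on the interface by the jump of the normal derivative of
ψ. So the maximum lies on ∂Ω, where u = v, and δ → 0 concludes. -/
lemma IsSolution.le (hri : 0 < ri) (h0 : 0 < ε) (h1 : ε < re - ri) (hk : 0 < k)
    (hu : IsSolution ri re ε k g u) (hv : IsSolution ri re ε k g v) {x : ℂ}
    (hx : x ∈ Metric.closedBall (re : ℂ) re) : u x ≤ v x := by
  have hre : 0 < re := by linarith
  set c : ℂ := ((ri + ε : ℝ) : ℂ) with hc
  -- With this choice k times the inner slope 2ηri of the barrier is 1/(2ri), half of the slope 1/ri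
  -- of the logarithm outside; the excess contradicts the sign conditions at a maximum.
  set η : ℝ := 1 / (4 * ri ^ 2 * k) with hη
  have hη0 : 0 < η := by positivity
  set ψ := barrier c ri η with hψ
  have hcl : closure (outerDisk re) = Metric.closedBall (re : ℂ) re := closure_ball _ hre.ne'
  have hclD : closure (inclusion ri ε) = Metric.closedBall c ri := closure_ball _ hri.ne'
  have hK := isCompact_closedBall (re : ℂ) re
  obtain ⟨M, hM⟩ := hK.exists_bound_of_continuousOn (continuous_barrier c hri η).continuousOn
  have huv : ContinuousOn (fun x => u x - v x) (Metric.closedBall (re : ℂ) re) := by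
    have := hu.continuousOn.sub hv.continuousOn
    rwa [hcl] at this
  have main : ∀ δ : ℝ, 0 < δ → u x - v x ≤ δ * M := by
    intro δ hδ
    set W : ℂ → ℝ := fun x => u x - v x + δ * ψ x with hW
    obtain ⟨y, hy, hymax⟩ := hK.exists_isMaxOn ⟨x, hx⟩
      (huv.add ((continuous_barrier c hri η).continuousOn.const_smul δ))
    have hymax : ∀ z ∈ Metric.closedBall (re : ℂ) re, W z ≤ W y := hymax
    have hfinal : y ∈ Metric.sphere (re : ℂ) re → u x - v x ≤ δ * M := by
      intro hys
      have h2 := hymax x hx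
      simp only [hW] at h2
      rw [hu.boundary y hys, hv.boundary y hys, sub_self, zero_add] at h2
      have h3 := (le_abs_self _).trans (hM y hy)
      have h4 := barrier_nonneg c hri hη0.le x
      nlinarith [mul_le_mul_of_nonneg_left h3 hδ.le, mul_nonneg hδ.le h4]
    by_contra hcon
    have hyball : y ∈ Metric.ball (re : ℂ) re := by
      rcases (Metric.mem_closedBall.1 hy).lt_or_eq with h | h
      · exact h
      · exact absurd (hfinal h) hcon
    have hev : ∀ᶠ z in 𝓝 y, W z ≤ W y := by
      filter_upwards [Metric.isOpen_ball.mem_nhds hyball] with z hz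
      exact hymax z (Metric.ball_subset_closedBall hz)
    have hcontn : Continuous fun z : ℂ => ‖z - c‖ := by fun_prop
    rcases lt_trichotomy ‖y - c‖ ri with hlt | heq | hgt
    · have hmem : y ∈ inclusion ri ε := mem_ball_iff_norm.2 hlt
      refine not_isLocalMax_harmonic_add (c := c) (mul_pos hδ hη0)
        ((hu.harmonic_inside y hmem).sub (hv.harmonic_inside y hmem)) ?_
      have hloc : (fun z => (u - v) z + δ * η * ‖z - c‖ ^ 2) =ᶠ[𝓝 y] W := by
        filter_upwards [hcontn.continuousAt.eventually_lt_const hlt] with z hz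
        simp only [hW, hψ, barrier, Pi.sub_apply]
        rw [max_eq_right hz.le, div_self hri.ne', Real.log_one]
        ring
      refine IsLocalMax.congr ?_ hloc.symm
      exact hev
    · have hmem : y ∈ interface ri ε := mem_sphere_iff_norm.2 heq
      obtain ⟨a, ha1, ha2⟩ := hu.transmission y hmem
      obtain ⟨b, hb1, hb2⟩ := hv.transmission y hmem
      rw [← hc] at ha1 ha2 hb1 hb2
      set ν : ℂ := ri⁻¹ • (y - c) with hν
      have hνn : ‖ν‖ = 1 := by
        rw [hν, norm_smul, heq, Real.norm_of_nonneg (by positivity), inv_mul_cancel₀ hri.ne']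
      have hyν : y - c = ri * ν := by
        rw [hν, Complex.real_smul]; push_cast
        rw [mul_inv_cancel_left₀]
        exact_mod_cast hri.ne'
      have hnorm : ∀ t : ℝ, -ri ≤ t → ‖y + t • ν - c‖ = ri + t := by
        intro t ht
        have : y + t • ν - c = ((ri + t : ℝ) : ℂ) * ν := by
          rw [add_sub_right_comm, hyν, Complex.real_smul]; push_cast; ring
        rw [this, norm_mul, hνn, mul_one, Complex.norm_real, Real.norm_of_nonneg (by linarith)]
      have hevt : ∀ᶠ t : ℝ in 𝓝 0, W (y + t • ν) ≤ W (y + (0 : ℝ) • ν) := by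
        have hcont : Continuous fun t : ℝ => y + t • ν := by fun_prop
        have ht : Tendsto (fun t : ℝ => y + t • ν) (𝓝 0) (𝓝 y) := by
          simpa using hcont.tendsto 0
        simpa using ht.eventually hev
      have hgt : ∀ᶠ t : ℝ in 𝓝 0, -ri ≤ t :=
        (eventually_gt_nhds (by linarith : -ri < (0 : ℝ))).mono fun t ht => ht.le
      have hsqd : HasDerivAt (fun t : ℝ => η * (ri + t) ^ 2) (η * (2 * ri)) 0 := by
        have := ((((hasDerivAt_id (0 : ℝ)).const_add ri).pow 2)).const_mul η
        simpa using! this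
      have hlogd : HasDerivAt (fun t : ℝ => Real.log ((ri + t) / ri)) (1 / ri) 0 := by
        have h1 : HasDerivAt (fun t : ℝ => (ri + t) / ri) (1 / ri) 0 :=
          ((hasDerivAt_id (0 : ℝ)).const_add ri).div_const ri
        have := h1.log (by simp [hri.ne'])
        simpa [hri.ne'] using this
      have hright : HasDerivWithinAt (fun t : ℝ => W (y + t • ν))
          (k * a - k * b + δ * (1 / ri + η * (2 * ri))) (Ici 0) 0 := by
        refine HasDerivWithinAt.congr_of_eventuallyEq_of_mem
          ((ha1.sub hb1).add (((hlogd.add hsqd).const_mul δ).hasDerivWithinAt)) ?_ self_mem_Ici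
        filter_upwards [self_mem_nhdsWithin, nhdsWithin_le_nhds hgt] with t ht htr
        simp only [hW, hψ, barrier, Pi.add_apply, Pi.sub_apply]
        rw [hnorm t htr, max_eq_left (by linarith [mem_Ici.1 ht])]
      have hleft : HasDerivWithinAt (fun t : ℝ => W (y + t • ν))
          (a - b + δ * (η * (2 * ri))) (Iic 0) 0 := by
        refine HasDerivWithinAt.congr_of_eventuallyEq_of_mem
          ((ha2.sub hb2).add ((hsqd.const_mul δ).hasDerivWithinAt)) ?_ self_mem_Iic
        filter_upwards [self_mem_nhdsWithin, nhdsWithin_le_nhds hgt] with t ht htr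
        simp only [hW, hψ, barrier, Pi.add_apply, Pi.sub_apply]
        rw [hnorm t htr, max_eq_right (by linarith [mem_Iic.1 ht]), div_self hri.ne',
          Real.log_one, zero_add]
      have e1 := deriv_right_nonpos hright hevt
      have e2 := deriv_left_nonneg hleft hevt
      have e3 : k * (η * (2 * ri)) = 1 / (2 * ri) := by
        rw [hη]; field_simp; norm_num
      have e4 : 1 / ri = 2 * (1 / (2 * ri)) := by field_simp
      have e5 : 0 < δ * (1 / (2 * ri)) := by positivity
      have e6 : 0 < δ * (η * (2 * ri)) := by positivity
      have e7 := mul_nonneg hk.le e2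
      have e8 : k * (a - b + δ * (η * (2 * ri))) = k * a - k * b + δ * (1 / (2 * ri)) := by
        rw [← e3]; ring
      rw [e8] at e7
      rw [e4] at e1
      linarith
    · have hmem : y ∈ outerDisk re \ closure (inclusion ri ε) := by
        refine ⟨hyball, ?_⟩
        rw [hclD, mem_closedBall_iff_norm, not_le]
        exact hgt
      have hne : y - c ≠ 0 := norm_pos_iff.1 (hri.trans hgt)
      have hlog : HarmonicAt (fun z : ℂ => Real.log ‖(z - c) / ri‖) y :=
        AnalyticAt.harmonicAt_log_norm (f := fun z => (z - c) / ri)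
          (by fun_prop (disch := exact_mod_cast hri.ne'))
          (div_ne_zero hne (by exact_mod_cast hri.ne'))
      refine not_isLocalMax_harmonic_add (c := c) (mul_pos hδ hη0)
        (((hu.harmonic_outside y hmem).sub (hv.harmonic_outside y hmem)).add
          (hlog.const_smul (c := δ))) ?_
      have hloc : (fun z => ((u - v) + δ • fun z : ℂ => Real.log ‖(z - c) / ri‖) z +
          δ * η * ‖z - c‖ ^ 2) =ᶠ[𝓝 y] W := by
        filter_upwards [hcontn.continuousAt.eventually_const_lt hgt] with z hz
        simp only [hW, hψ, barrier, Pi.sub_apply, Pi.add_apply, Pi.smul_apply, smul_eq_mul]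
        rw [max_eq_left hz.le, norm_div, Complex.norm_real, Real.norm_of_nonneg hri.le]
        ring
      exact IsLocalMax.congr hev hloc.symm
  have hlim : Tendsto (fun δ : ℝ => δ * M) (𝓝[>] 0) (𝓝 0) := by
    have : Tendsto (fun δ : ℝ => δ * M) (𝓝 0) (𝓝 (0 * M)) := tendsto_id.mul_const M
    rw [zero_mul] at this
    exact this.mono_left nhdsWithin_le_nhds
  have := ge_of_tendsto hlim (by filter_upwards [self_mem_nhdsWithin] with δ hδ using main δ hδ)
  linarith

lemma IsSolution.eqOn (hri : 0 < ri) (h0 : 0 < ε) (h1 : ε < re - ri) (hk : 0 < k)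
    (hu : IsSolution ri re ε k g u) (hv : IsSolution ri re ε k g v) :
    EqOn u v (Metric.closedBall (re : ℂ) re) := fun _ hx =>
  le_antisymm (hu.le hri h0 h1 hk hv hx) (hv.le hri h0 h1 hk hu hx)

end

/-! ### Power series with bounded coefficients -/

lemma summable_mul_pow {b : ℕ → ℂ} {C : ℝ} (hb : ∀ n, ‖b n‖ ≤ C) {w : ℂ} (hw : ‖w‖ < 1) :
    Summable fun n => b n * w ^ n := by
  refine Summable.of_norm_bounded (g := fun n => C * ‖w‖ ^ n)
    ((summable_geometric_of_lt_one (norm_nonneg _) hw).mul_left C) fun n => ?_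
  rw [norm_mul, norm_pow]
  exact mul_le_mul_of_nonneg_right (hb n) (by positivity)

lemma hasDerivAt_tsum_mul_pow {b : ℕ → ℂ} {C : ℝ} (hb : ∀ n, ‖b n‖ ≤ C) {w : ℂ}
    (hw : ‖w‖ < 1) :
    HasDerivAt (fun w => ∑' n, b n * w ^ n) (∑' n, ((n + 1 : ℕ) * b (n + 1)) * w ^ n) w := by
  obtain ⟨ρ, hwρ, hρ1⟩ := exists_between hw
  have hρ0 : 0 ≤ ρ := (norm_nonneg w).trans hwρ.le
  have hU : IsOpen (Metric.ball (0 : ℂ) ρ) := Metric.isOpen_ball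
  have hmem : w ∈ Metric.ball (0 : ℂ) ρ := mem_ball_zero_iff.2 hwρ
  have hu : Summable fun n => C * ρ ^ n := (summable_geometric_of_lt_one hρ0 hρ1).mul_left C
  have hd : ∀ n, DifferentiableOn ℂ (fun w : ℂ => b n * w ^ n) (Metric.ball (0 : ℂ) ρ) :=
    fun n => by fun_prop
  have hle : ∀ (n : ℕ) (z : ℂ), z ∈ Metric.ball (0 : ℂ) ρ → ‖b n * z ^ n‖ ≤ C * ρ ^ n := by
    intro n z hz
    rw [norm_mul, norm_pow]
    have := (mem_ball_zero_iff.1 hz).le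
    have h0 := (norm_nonneg _).trans (hb n)
    exact mul_le_mul (hb n) (pow_le_pow_left₀ (norm_nonneg _) this n) (by positivity) h0
  have hD := (differentiableOn_tsum_of_summable_norm hu hd hU hle).differentiableAt
    (hU.mem_nhds hmem)
  have hS := hasSum_deriv_of_summable_norm hu hd hU hle hmem
  refine hD.hasDerivAt.congr_deriv ?_
  rw [← hS.tsum_eq, hS.summable.tsum_eq_zero_add]
  simp only [pow_zero, mul_one, deriv_const, zero_add]
  refine tsum_congr fun n => ?_
  have : HasDerivAt (fun w : ℂ => b (n + 1) * w ^ (n + 1))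
      (b (n + 1) * ((n + 1 : ℕ) * w ^ n)) w := by
    simpa using! (hasDerivAt_pow (n + 1) w).const_mul (b (n + 1))
  rw [this.deriv]
  ring

/-! ### Fourier coefficients and Cauchy integrals over the circle -/

/-- The (unnormalised) Fourier coefficients of nonnegative index. -/
def circleCoeff (h : ℝ → ℂ) (n : ℕ) : ℂ :=
  ∫ t in (0 : ℝ)..(2 * Real.pi), h t * exp (-(n * t * I))

lemma norm_exp_neg_mul_I (t : ℝ) : ‖exp (-(t * I))‖ = 1 := by
  have := Complex.norm_exp_ofReal_mul_I (-t)
  push_cast at this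
  rwa [neg_mul] at this

lemma one_sub_ne_zero_of_norm_lt {w : ℂ} (hw : ‖w‖ < 1) (t : ℝ) :
    1 - w * exp (-(t * I)) ≠ 0 := by
  intro h
  have h1 : ‖w * exp (-(t * I))‖ = 1 := by rw [← sub_eq_zero.1 h]; simp
  rw [norm_mul, norm_exp_neg_mul_I, mul_one] at h1
  linarith

lemma hasSum_circleCoeff {h : ℝ → ℂ} (hh : Continuous h) {w : ℂ} (hw : ‖w‖ < 1) :
    HasSum (fun n => circleCoeff h n * w ^ n)
      (∫ t in (0 : ℝ)..(2 * Real.pi), h t / (1 - w * exp (-(t * I)))) := by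
  obtain ⟨B, hB⟩ := (isCompact_uIcc (a := (0 : ℝ)) (b := 2 * Real.pi)).exists_bound_of_continuousOn
    hh.continuousOn
  have hB0 : 0 ≤ B := (norm_nonneg _).trans (hB 0 left_mem_uIcc)
  have key := intervalIntegral.hasSum_integral_of_dominated_convergence (μ := volume)
    (a := 0) (b := 2 * Real.pi)
    (F := fun (n : ℕ) (t : ℝ) => h t * (w * exp (-(t * I))) ^ n)
    (f := fun t => h t / (1 - w * exp (-(t * I)))) (fun n _ => B * ‖w‖ ^ n)
    (fun n => by
      have : Continuous fun t : ℝ => h t * (w * exp (-(t * I))) ^ n := by fun_prop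
      exact this.aestronglyMeasurable)
    (fun n => Eventually.of_forall fun t ht => by
      rw [norm_mul, norm_pow, norm_mul, norm_exp_neg_mul_I, mul_one]
      exact mul_le_mul_of_nonneg_right (hB t (uIoc_subset_uIcc ht)) (by positivity))
    (Eventually.of_forall fun t _ =>
      (summable_geometric_of_lt_one (norm_nonneg _) hw).mul_left B)
    (by simp)
    (Eventually.of_forall fun t _ => by
      have h1 : ‖w * exp (-(t * I))‖ < 1 := by
        rwa [norm_mul, norm_exp_neg_mul_I, mul_one]
      rw [div_eq_mul_inv]
      exact (hasSum_geometric_of_norm_lt_one h1).mul_left (h t))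
  have e : ∀ n : ℕ, circleCoeff h n * w ^ n
      = ∫ t in (0 : ℝ)..(2 * Real.pi), h t * (w * exp (-(t * I))) ^ n := by
    intro n
    rw [circleCoeff, ← intervalIntegral.integral_mul_const]
    refine intervalIntegral.integral_congr fun t _ => ?_
    rw [mul_pow, ← Complex.exp_nat_mul]
    ring_nf
  simpa only [e] using key

lemma circleCoeff_deriv {h h' : ℝ → ℂ} (hd : ∀ t, HasDerivAt h (h' t) t) (hc : Continuous h')
    (hp : Function.Periodic h (2 * Real.pi)) (n : ℕ) :
    circleCoeff h' n = n * I * circleCoeff h n := by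
  have hu : ∀ t : ℝ, HasDerivAt (fun t : ℝ => exp (-(n * t * I)))
      (-(n * I) * exp (-(n * t * I))) t := by
    intro t
    have h1 : HasDerivAt (fun t : ℝ => -((n : ℂ) * (t : ℂ) * I)) (-((n : ℂ) * 1 * I)) t :=
      (((hasDerivAt_id t).ofReal_comp.const_mul (n : ℂ)).mul_const I).neg
    refine h1.cexp.congr_deriv ?_
    ring
  have key := intervalIntegral.integral_mul_deriv_eq_deriv_mul (a := 0) (b := 2 * Real.pi)
    (fun t _ => hu t) (fun t _ => hd t)
    (by have : Continuous fun t : ℝ => -(n * I) * exp (-(n * t * I)) := by fun_prop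
        exact this.intervalIntegrable _ _) (hc.intervalIntegrable _ _)
  have h2 : exp (-(n * ((2 * Real.pi : ℝ) : ℂ) * I)) = 1 := by
    rw [Complex.exp_neg, inv_eq_one, Complex.exp_eq_one_iff]
    exact ⟨n, by push_cast; ring⟩
  have h3 : h (2 * Real.pi) = h 0 := by simpa using hp 0
  rw [h2, h3] at key
  simp only [circleCoeff]
  simp only [ofReal_zero, mul_zero, zero_mul, neg_zero, exp_zero, sub_self, zero_sub] at key
  rw [← intervalIntegral.integral_const_mul, ← intervalIntegral.integral_neg] at *
  convert key using 1
  · exact intervalIntegral.integral_congr fun t _ => mul_comm _ _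
  · exact intervalIntegral.integral_congr fun t _ => by ring

/-- For |s| ≥ π/2 the cosine is nonpositive and the modulus is at least 1; for |s| ≤ π/2 it is at
least |sin s| ≥ 2|s|/π. -/
lemma abs_div_pi_le_norm_one_sub {ρ s : ℝ} (hρ : 0 ≤ ρ) (hs : |s| ≤ Real.pi) :
    |s| / Real.pi ≤ ‖1 - ρ * exp (-(s * I))‖ := by
  have hpi := Real.pi_pos
  refine abs_le_of_sq_le_sq' ?_ (norm_nonneg _) |>.2
  have e : ‖1 - (ρ : ℂ) * exp (-(s * I))‖ ^ 2 = 1 - 2 * ρ * Real.cos s + ρ ^ 2 := by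
    have h1 : -((s : ℂ) * I) = ((-s : ℝ) : ℂ) * I := by push_cast; ring
    rw [h1, exp_mul_I, ← ofReal_cos, ← ofReal_sin, ← Complex.normSq_eq_norm_sq,
      Complex.normSq_apply]
    simp [-ofReal_cos, -ofReal_sin]
    nlinarith [Real.sin_sq_add_cos_sq s]
  rw [e, div_pow, sq_abs]
  rcases le_total (Real.pi / 2) |s| with h | h
  · have hc : Real.cos s ≤ 0 := by
      rw [← Real.cos_abs]
      exact Real.cos_nonpos_of_pi_div_two_le_of_le h (by linarith)
    have : s ^ 2 / Real.pi ^ 2 ≤ 1 := by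
      rw [div_le_one (by positivity), ← sq_abs]
      exact pow_le_pow_left₀ (abs_nonneg _) hs 2
    nlinarith [mul_nonneg hρ (neg_nonneg.2 hc), sq_nonneg ρ]
  · have h1 := Real.mul_abs_le_abs_sin h
    have h2 : (2 / Real.pi * |s|) ^ 2 ≤ Real.sin s ^ 2 := by
      rw [← sq_abs (Real.sin s)]
      exact pow_le_pow_left₀ (by positivity) h1 2
    have h3 : (2 / Real.pi * |s|) ^ 2 = 4 * (s ^ 2 / Real.pi ^ 2) := by
      rw [mul_pow, sq_abs]; ring
    have h4 : 0 ≤ s ^ 2 / Real.pi ^ 2 := by positivity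
    nlinarith [Real.sin_sq_add_cos_sq s, sq_nonneg (ρ - Real.cos s)]

lemma intervalIntegrable_abs_rpow {r : ℝ} (hr : -1 < r) (a : ℝ) (ha : 0 ≤ a) :
    IntervalIntegrable (fun x : ℝ => |x| ^ r) volume (-a) a := by
  have h1 : IntervalIntegrable (fun x : ℝ => |x| ^ r) volume 0 a := by
    refine (intervalIntegral.intervalIntegrable_rpow' (a := 0) (b := a) hr).congr ?_
    intro x hx
    rw [uIoc_of_le ha] at hx
    simp only [abs_of_pos hx.1]
  have h2 : IntervalIntegrable (fun x : ℝ => |x| ^ r) volume (-a) 0 := by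
    have := (IntervalIntegrable.iff_comp_neg (f := fun x : ℝ => |x| ^ r)).1 h1
    simpa using this.symm
  exact h2.trans h1

/-- Cauchy integrals of Hölder continuous functions are bounded. -/
lemma exists_norm_cauchyIntegral_le {h : ℝ → ℂ} {K δ : ℝ} (hh : Continuous h)
    (hp : Function.Periodic h (2 * Real.pi)) (hδ : 0 < δ) (hK : 0 ≤ K)
    (hol : ∀ s t, ‖h s - h t‖ ≤ K * |s - t| ^ δ) :
    ∃ B, ∀ w : ℂ, ‖w‖ < 1 →
      ‖∫ t in (0 : ℝ)..(2 * Real.pi), h t * exp (-(t * I)) / (1 - w * exp (-(t * I)))‖ ≤ B := by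
  -- Numerator K|s|^δ from the Hölder condition, denominator at least |s|/π; integrable because δ >
  -- 0.
  refine ⟨∫ s in (-Real.pi)..Real.pi, K * Real.pi * |s| ^ (δ - 1), fun w hw => ?_⟩
  have hpi := Real.pi_pos
  -- The kernel has only negative frequencies, so a constant may be subtracted from h: its value at
  -- the angle of w, where the kernel is most singular.
  have hzero : ∫ t in (0 : ℝ)..(2 * Real.pi), exp (-(t * I)) / (1 - w * exp (-(t * I))) = 0 := by
    have h1 := hasSum_circleCoeff (h := fun t : ℝ => exp (-(t * I))) (by fun_prop) hw
    have h2 : ∀ n : ℕ, circleCoeff (fun t : ℝ => exp (-(t * I))) n = 0 := by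
      intro n
      have hc : -((n + 1 : ℕ) : ℂ) * I ≠ 0 :=
        mul_ne_zero (neg_ne_zero.2 (Nat.cast_ne_zero.2 n.succ_ne_zero)) I_ne_zero
      have e : ∀ t : ℝ, exp (-((t : ℂ) * I)) * exp (-(n * t * I))
          = exp (-((n + 1 : ℕ) : ℂ) * I * t) := by
        intro t
        rw [← Complex.exp_add]; congr 1; push_cast; ring
      simp only [circleCoeff, e]
      rw [integral_exp_mul_complex hc]
      have : exp (-((n + 1 : ℕ) : ℂ) * I * ((2 * Real.pi : ℝ) : ℂ)) = 1 := by
        rw [Complex.exp_eq_one_iff]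
        exact ⟨-((n + 1 : ℕ) : ℤ), by push_cast; ring⟩
      rw [this]; simp
    simp only [h2, zero_mul] at h1
    exact h1.unique hasSum_zero
  set φ := arg w with hφ
  set G : ℝ → ℂ := fun t => (h t - h φ) * exp (-(t * I)) / (1 - w * exp (-(t * I))) with hG
  have hne := fun t => one_sub_ne_zero_of_norm_lt hw t
  have hGc : Continuous G := by
    rw [hG]
    exact Continuous.div (by fun_prop) (by fun_prop) hne
  have hsplit : ∫ t in (0 : ℝ)..(2 * Real.pi), h t * exp (-(t * I)) / (1 - w * exp (-(t * I)))
      = ∫ t in (0 : ℝ)..(2 * Real.pi), G t := by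
    have e : ∀ t, G t = h t * exp (-(t * I)) / (1 - w * exp (-(t * I)))
        - h φ * (exp (-(t * I)) / (1 - w * exp (-(t * I)))) := by
      intro t; simp only [hG]; ring
    have c1 : Continuous fun t : ℝ => h t * exp (-(t * I)) / (1 - w * exp (-(t * I))) :=
      Continuous.div (by fun_prop) (by fun_prop) hne
    have c2 : Continuous fun t : ℝ => h φ * (exp (-(t * I)) / (1 - w * exp (-(t * I)))) :=
      continuous_const.mul (Continuous.div (by fun_prop) (by fun_prop) hne)
    simp only [e]
    rw [intervalIntegral.integral_sub (c1.intervalIntegrable _ _) (c2.intervalIntegrable _ _),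
      intervalIntegral.integral_const_mul, hzero, mul_zero, sub_zero]
  have hGp : Function.Periodic G (2 * Real.pi) := by
    intro t
    have : exp (-(((t + 2 * Real.pi : ℝ) : ℂ) * I)) = exp (-(t * I)) := by
      rw [Complex.exp_eq_exp_iff_exists_int]
      exact ⟨-1, by push_cast; ring⟩
    simp only [hG, hp t, this]
  have hshift : ∫ t in (0 : ℝ)..(2 * Real.pi), G t = ∫ s in (-Real.pi)..Real.pi, G (φ + s) := by
    rw [intervalIntegral.integral_comp_add_left (fun x => G x)]
    have := hGp.intervalIntegral_add_eq 0 (φ + -Real.pi)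
    rw [zero_add] at this
    rw [this]; congr 1; ring
  rw [hsplit, hshift]
  refine intervalIntegral.norm_integral_le_of_norm_le (by linarith)
    (Eventually.of_forall fun s hs => ?_)
    ((intervalIntegrable_abs_rpow (by linarith) _ hpi.le).const_mul _)
  have hs' : |s| ≤ Real.pi := abs_le.2 ⟨hs.1.le, hs.2⟩
  simp only [hG]
  have hwe : w * exp (-(((φ + s : ℝ) : ℂ) * I)) = (‖w‖ : ℂ) * exp (-(s * I)) := by
    conv_lhs => rw [← Complex.norm_mul_exp_arg_mul_I w]
    rw [mul_assoc, ← Complex.exp_add]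
    congr 2
    push_cast; ring
  rw [norm_div, norm_mul, norm_exp_neg_mul_I, mul_one, hwe]
  have hlow := abs_div_pi_le_norm_one_sub (norm_nonneg w) hs'
  have hnum := hol (φ + s) φ
  rw [add_sub_cancel_left] at hnum
  rcases eq_or_ne s 0 with rfl | h0
  · simp only [add_zero, sub_self, norm_zero, zero_div]
    positivity
  have hs0 : 0 < |s| := abs_pos.2 h0
  rw [div_le_iff₀ (lt_of_lt_of_le (by positivity) hlow)]
  calc _ ≤ K * |s| ^ δ := hnum
    _ = K * Real.pi * |s| ^ (δ - 1) * (|s| / Real.pi) := by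
      rw [Real.rpow_sub_one hs0.ne']; field_simp
    _ ≤ _ := mul_le_mul_of_nonneg_left hlow (by positivity)

/-! ### Boundary regularity of power series -/

/-- The bounded series S is the derivative of w D(w), where D is the derivative of the original
series. Integration from 0 gives |wD| ≤ B|w|, so D is bounded by B. Then D' = (S - D)/w is bounded
for |w| ≥ 1/2, and the coefficient bound serves for |w| ≤ 1/2; a bounded derivative on the convex
disk gives the Lipschitz estimate. -/
lemma exists_bound_tsum_deriv {a : ℕ → ℂ} {C B : ℝ}
    (ha : ∀ n : ℕ, ‖((n + 1 : ℕ) : ℂ) * (((n + 1 : ℕ) : ℂ) * a (n + 1))‖ ≤ C)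
    (hS : ∀ w : ℂ, ‖w‖ < 1 →
      ‖∑' n : ℕ, (((n + 1 : ℕ) : ℂ) * (((n + 1 : ℕ) : ℂ) * a (n + 1))) * w ^ n‖ ≤ B) :
    (∀ w : ℂ, ‖w‖ < 1 → ‖∑' n : ℕ, (((n + 1 : ℕ) : ℂ) * a (n + 1)) * w ^ n‖ ≤ B) ∧
    ∃ L, 0 ≤ L ∧ ∀ w z : ℂ, ‖w‖ < 1 → ‖z‖ < 1 →
      ‖(∑' n : ℕ, (((n + 1 : ℕ) : ℂ) * a (n + 1)) * w ^ n)
        - ∑' n : ℕ, (((n + 1 : ℕ) : ℂ) * a (n + 1)) * z ^ n‖ ≤ L * ‖w - z‖ := by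
  set D : ℂ → ℂ := fun w => ∑' n : ℕ, (((n + 1 : ℕ) : ℂ) * a (n + 1)) * w ^ n with hD
  set S : ℂ → ℂ := fun w =>
    ∑' n : ℕ, (((n + 1 : ℕ) : ℂ) * (((n + 1 : ℕ) : ℂ) * a (n + 1))) * w ^ n with hSdef
  set P : ℂ → ℂ := fun w => ∑' n : ℕ, ((n : ℂ) * a n) * w ^ n with hP
  have hC0 : 0 ≤ C := (norm_nonneg _).trans (ha 0)
  have hd : ∀ n : ℕ, ‖((n + 1 : ℕ) : ℂ) * a (n + 1)‖ ≤ C := by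
    intro n
    refine le_trans ?_ (ha n)
    conv_rhs => rw [norm_mul]
    rw [Complex.norm_natCast]
    refine le_mul_of_one_le_left (norm_nonneg _) ?_
    exact_mod_cast Nat.le_add_left 1 n
  have hp : ∀ n : ℕ, ‖(n : ℂ) * a n‖ ≤ C := by
    intro n
    cases n with
    | zero => simpa using hC0
    | succ m => exact hd m
  have he : ∀ n : ℕ, ‖((n + 1 : ℕ) : ℂ) * (((n + 1 + 1 : ℕ) : ℂ) * a (n + 1 + 1))‖ ≤ C := by
    intro n
    refine le_trans ?_ (ha (n + 1))
    rw [norm_mul, norm_mul _ (((n + 1 + 1 : ℕ) : ℂ) * a (n + 1 + 1)), Complex.norm_natCast,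
      Complex.norm_natCast]
    refine mul_le_mul_of_nonneg_right ?_ (norm_nonneg _)
    exact_mod_cast Nat.le_succ _
  have hPd : ∀ w, ‖w‖ < 1 → HasDerivAt P (S w) w := fun w hw => hasDerivAt_tsum_mul_pow hp hw
  set E : ℂ → ℂ := fun w =>
    ∑' n : ℕ, (((n + 1 : ℕ) : ℂ) * (((n + 1 + 1 : ℕ) : ℂ) * a (n + 1 + 1))) * w ^ n with hE
  have hDd : ∀ w, ‖w‖ < 1 → HasDerivAt D (E w) w := fun w hw => hasDerivAt_tsum_mul_pow hd hw
  have hPD : ∀ w, ‖w‖ < 1 → P w = w * D w := by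
    intro w hw
    simp only [hP, hD]
    rw [(summable_mul_pow hp hw).tsum_eq_zero_add, ← tsum_mul_left]
    simp only [Nat.cast_zero, zero_mul, zero_add]
    exact tsum_congr fun n => by ring
  have hconv : Convex ℝ (Metric.ball (0 : ℂ) 1) := convex_ball _ _
  have hmem : ∀ w : ℂ, w ∈ Metric.ball (0 : ℂ) 1 ↔ ‖w‖ < 1 := fun w => mem_ball_zero_iff
  have hPle : ∀ w, ‖w‖ < 1 → ‖P w‖ ≤ B * ‖w‖ := by
    intro w hw
    have := hconv.norm_image_sub_le_of_norm_hasDerivWithin_le (f := P) (f' := S) (C := B)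
      (fun z hz => (hPd z ((hmem z).1 hz)).hasDerivWithinAt)
      (fun z hz => hS z ((hmem z).1 hz)) (Metric.mem_ball_self one_pos) ((hmem w).2 hw)
    have h0 : P 0 = 0 := by rw [hPD 0 (by simp), zero_mul]
    simpa [h0] using this
  have hSE : ∀ w, ‖w‖ < 1 → S w = D w + w * E w := by
    intro w hw
    have h1 : HasDerivAt (fun w => w * D w) (1 * D w + w * E w) w :=
      (hasDerivAt_id w).mul (hDd w hw)
    have h2 : P =ᶠ[𝓝 w] fun w => w * D w := by
      filter_upwards [Metric.isOpen_ball.mem_nhds ((hmem w).2 hw)] with z hz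
      exact hPD z ((hmem z).1 hz)
    have := (hPd w hw).unique (h1.congr_of_eventuallyEq h2)
    rwa [one_mul] at this
  have hDle : ∀ w, ‖w‖ < 1 → ‖D w‖ ≤ B := by
    intro w hw
    rcases eq_or_ne w 0 with rfl | h0
    · have := hS 0 hw
      have e := hSE 0 hw
      rw [zero_mul, add_zero] at e
      rwa [← e]
    · have h1 := hPle w hw
      rw [hPD w hw, norm_mul, mul_comm] at h1
      exact le_of_mul_le_mul_right h1 (norm_pos_iff.2 h0)
  have hB0 : 0 ≤ B := (norm_nonneg _).trans (hDle 0 (by simp))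
  have hEle : ∀ w, ‖w‖ < 1 → ‖E w‖ ≤ 4 * B + 2 * C := by
    intro w hw
    rcases le_total (1 / 2) ‖w‖ with h | h
    · have h1 : ‖w‖ * ‖E w‖ ≤ 2 * B := by
        rw [← norm_mul, ← sub_eq_of_eq_add' (hSE w hw)]
        exact (norm_sub_le _ _).trans (by linarith [hS w hw, hDle w hw])
      nlinarith [norm_nonneg (E w)]
    · have hg : HasSum (fun n : ℕ => C * (1 / 2 : ℝ) ^ n) (C * 2) :=
        hasSum_geometric_two.mul_left C
      have : ‖E w‖ ≤ C * 2 := by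
        refine tsum_of_norm_bounded hg fun n => ?_
        rw [norm_mul, norm_pow]
        exact mul_le_mul (he n) (pow_le_pow_left₀ (norm_nonneg _) h n) (by positivity) hC0
      linarith
  refine ⟨hDle, 4 * B + 2 * C, by positivity, fun w z hw hz => ?_⟩
  exact hconv.norm_image_sub_le_of_norm_hasDerivWithin_le (f := D) (f' := E)
    (fun z hz => (hDd z ((hmem z).1 hz)).hasDerivWithinAt)
    (fun z hz => hEle z ((hmem z).1 hz)) ((hmem z).2 hz) ((hmem w).2 hw)

lemma exists_limit_of_lipschitz {D : ℂ → ℂ} {s : Set ℂ} {L : ℝ} (hL : 0 ≤ L)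
    (hD : ∀ w ∈ s, ∀ z ∈ s, ‖D w - D z‖ ≤ L * ‖w - z‖) {p : ℂ} (hp : p ∈ closure s) :
    ∃ f, Tendsto D (𝓝[s] p) (𝓝 f) ∧ ∀ w ∈ s, ‖D w - f‖ ≤ L * ‖w - p‖ := by
  have hne : (𝓝[s] p).NeBot := mem_closure_iff_nhdsWithin_neBot.1 hp
  have hlip : LipschitzOnWith ⟨L, hL⟩ D s :=
    LipschitzOnWith.of_dist_le_mul fun w hw z hz => by
      rw [dist_eq_norm, dist_eq_norm]; exact hD w hw z hz
  have hc : Cauchy (map D (𝓝[s] p)) :=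
    (cauchy_nhds.mono nhdsWithin_le_nhds).map_of_le hlip.uniformContinuousOn
      (le_principal_iff.2 self_mem_nhdsWithin)
  obtain ⟨f, hf⟩ := CompleteSpace.complete hc
  refine ⟨f, hf, fun w hw => ?_⟩
  have h1 : Tendsto (fun z => ‖D w - D z‖) (𝓝[s] p) (𝓝 ‖D w - f‖) :=
    (tendsto_const_nhds.sub hf).norm
  have h2 : Tendsto (fun z => L * ‖w - z‖) (𝓝[s] p) (𝓝 (L * ‖w - p‖)) := by
    refine Tendsto.mono_left ?_ nhdsWithin_le_nhds
    exact Continuous.tendsto (by fun_prop) p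
  refine le_of_tendsto_of_tendsto h1 h2 ?_
  filter_upwards [self_mem_nhdsWithin] with z hz using hD w hw z hz

/-- A mean-zero real function with summable Fourier series is the boundary value of the real part
of the corresponding power series. -/
lemma re_tsum_circleCoeff {G : ℝ → ℝ} (hG : Continuous G)
    (hp : Function.Periodic G (2 * Real.pi))
    (h0 : ∫ t in (0 : ℝ)..(2 * Real.pi), G t = 0)
    (hs : Summable fun n => circleCoeff (fun t => (G t : ℂ)) n) (t : ℝ) :
    (∑' n, circleCoeff (fun t => (G t : ℂ)) n / Real.pi * exp (t * I) ^ n).re = G t := by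
  have : Fact (0 < 2 * Real.pi) := ⟨Real.two_pi_pos⟩
  have hpi : (Real.pi : ℂ) ≠ 0 := ofReal_ne_zero.2 Real.pi_ne_zero
  have hpc : Function.Periodic (fun t => (G t : ℂ)) (2 * Real.pi) := fun t => by
    simp only [hp t]
  let f : C(AddCircle (2 * Real.pi), ℂ) := ⟨hpc.lift, by
    exact Continuous.quotient_lift (f := fun t => (G t : ℂ)) (continuous_ofReal.comp hG) _⟩
  have hf : ∀ s : ℝ, f (s : AddCircle (2 * Real.pi)) = (G s : ℂ) := fun s => rfl
  have hcoef : ∀ n : ℕ, fourierCoeff f n = circleCoeff (fun t => (G t : ℂ)) n / (2 * Real.pi) := by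
    intro n
    have e : ∫ s in (0 : ℝ)..(2 * Real.pi), fourier (-(n : ℤ)) (s : AddCircle (2 * Real.pi)) •
        f (s : AddCircle (2 * Real.pi)) = circleCoeff (fun t => (G t : ℂ)) n := by
      refine intervalIntegral.integral_congr fun s _ => ?_
      rw [fourier_coe_apply, hf, smul_eq_mul, mul_comm]
      congr 2
      push_cast
      field_simp
    rw [fourierCoeff_eq_intervalIntegral f n 0, zero_add, e, Complex.real_smul]
    push_cast
    ring
  have hcoef' : ∀ n : ℕ, fourierCoeff f (-n : ℤ) = conj (fourierCoeff f n) := by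
    intro n
    rw [fourierCoeff_eq_intervalIntegral f n 0, fourierCoeff_eq_intervalIntegral f _ 0, zero_add,
      Complex.real_smul, Complex.real_smul, map_mul, conj_ofReal]
    congr 1
    rw [intervalIntegral.integral_of_le Real.two_pi_pos.le,
      intervalIntegral.integral_of_le Real.two_pi_pos.le, ← integral_conj]
    refine integral_congr_ae (Eventually.of_forall fun s => ?_)
    simp only [smul_eq_mul, map_mul, hf, conj_ofReal]
    rw [← fourier_neg]
  have hc0 : fourierCoeff f 0 = 0 := by
    have := hcoef 0
    rw [Nat.cast_zero] at this
    rw [this, circleCoeff]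
    simp [intervalIntegral.integral_ofReal, h0]
  have hsum : Summable (fourierCoeff f) := by
    refine Summable.of_nat_of_neg ?_ ?_
    · simp only [hcoef]; exact hs.div_const _
    · simp only [hcoef', hcoef]; exact (hs.div_const _).star
  have key := (has_pointwise_sum_fourier_series_of_summable hsum (t : AddCircle (2 * Real.pi)))
  -- Pairing n with -n counts the index 0 twice, which is harmless because the mean vanishes.
  have key2 := key.nat_add_neg
  rw [hc0, zero_smul, add_zero, hf] at key2
  have hterm : ∀ n : ℕ, fourierCoeff f n • fourier (n : ℤ) (t : AddCircle (2 * Real.pi))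
      + fourierCoeff f (-n : ℤ) • fourier (-n : ℤ) (t : AddCircle (2 * Real.pi))
      = ((circleCoeff (fun t => (G t : ℂ)) n / Real.pi * exp (t * I) ^ n).re : ℂ) := by
    intro n
    rw [hcoef', fourier_neg, smul_eq_mul, smul_eq_mul, ← map_mul, Complex.add_conj, hcoef,
      fourier_coe_apply, ← Complex.exp_nat_mul]
    have e : circleCoeff (fun t => (G t : ℂ)) n / Real.pi * exp (n * (t * I))
        = (2 : ℝ) * (circleCoeff (fun t => (G t : ℂ)) n / (2 * Real.pi)
          * exp (2 * Real.pi * I * (n : ℤ) * t / (2 * Real.pi : ℝ))) := by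
      have : 2 * (Real.pi : ℂ) * I * (n : ℤ) * t / (2 * Real.pi : ℝ) = n * (t * I) := by
        push_cast; field_simp
      rw [this]; push_cast; field_simp
    rw [e, re_ofReal_mul]
  simp only [hterm] at key2
  have key3 := Complex.hasSum_ofReal.1 key2
  have hs' : Summable fun n => circleCoeff (fun t => (G t : ℂ)) n / Real.pi * exp (t * I) ^ n := by
    refine Summable.of_norm ?_
    simp only [norm_mul, norm_pow, Complex.norm_exp_ofReal_mul_I, one_pow, mul_one]
    exact (hs.div_const _).norm
  exact (Complex.hasSum_re hs'.hasSum).unique key3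

lemma circleCoeff_succ (h : ℝ → ℂ) (n : ℕ) :
    circleCoeff h (n + 1) = circleCoeff (fun t => h t * exp (-(t * I))) n := by
  refine intervalIntegral.integral_congr fun t _ => ?_
  beta_reduce
  rw [mul_assoc (h t), ← Complex.exp_add]
  congr 2
  push_cast; ring

lemma exists_norm_circleCoeff_le {h : ℝ → ℂ} (hh : Continuous h) :
    ∃ B, ∀ n, ‖circleCoeff h n‖ ≤ B := by
  obtain ⟨B, hB⟩ := (isCompact_uIcc (a := (0 : ℝ)) (b := 2 * Real.pi)).exists_bound_of_continuousOn
    hh.continuousOn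
  refine ⟨B * |2 * Real.pi - 0|, fun n => intervalIntegral.norm_integral_le_of_norm_le_const
    fun t ht => ?_⟩
  have := norm_exp_neg_mul_I (n * t)
  push_cast at this
  rw [norm_mul, this, mul_one]
  exact hB t (uIoc_subset_uIcc ht)

/-- The regularity of the power series whose real part has mean-zero `C^{2,δ}` boundary values. -/
lemma exists_powerSeries_extension {G : ℝ → ℝ} {δ : ℝ} (hδ : 0 < δ) (hG : ContDiff ℝ 2 G)
    (hp : Function.Periodic G (2 * Real.pi))
    (hol : ∃ K : ℝ, ∀ s t : ℝ, |iteratedDeriv 2 G s - iteratedDeriv 2 G t| ≤ K * |s - t| ^ δ)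
    (h0 : ∫ t in (0 : ℝ)..(2 * Real.pi), G t = 0) :
    ∃ (P D : ℂ → ℂ) (f : ℂ) (B L : ℝ), 0 ≤ L ∧ ‖f‖ ≤ B ∧
      ContinuousOn P (Metric.closedBall 0 1) ∧
      (∀ t : ℝ, (P (exp (t * I))).re = G t) ∧
      (∀ w : ℂ, ‖w‖ < 1 → P w = 1 / Real.pi *
        ∫ t in (0 : ℝ)..(2 * Real.pi), (G t : ℂ) / (1 - w * exp (-(t * I)))) ∧
      (∀ w : ℂ, ‖w‖ < 1 → HasDerivAt P (D w) w) ∧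
      (∀ w : ℂ, ‖w‖ < 1 → ‖D w‖ ≤ B) ∧
      (∀ w : ℂ, ‖w‖ < 1 → ‖D w - f‖ ≤ L * ‖w + 1‖) := by
  obtain ⟨K, hK⟩ := hol
  have hpi : (Real.pi : ℂ) ≠ 0 := ofReal_ne_zero.2 Real.pi_ne_zero
  have hi2 : iteratedDeriv 2 G = deriv (deriv G) := by
    rw [iteratedDeriv_succ, iteratedDeriv_one]
  rw [hi2] at hK
  have hG1 : ContDiff ℝ 1 (deriv G) := by
    have : ContDiff ℝ (1 + 1) G := by simpa [one_add_one_eq_two] using hG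
    exact (contDiff_succ_iff_deriv.1 this).2.2
  have hd0 : ∀ t, HasDerivAt G (deriv G t) t := fun t =>
    (hG.differentiable (by norm_num) t).hasDerivAt
  have hd1 : ∀ t, HasDerivAt (deriv G) (deriv (deriv G) t) t := fun t =>
    (hG1.differentiable (by norm_num) t).hasDerivAt
  have hc2 : Continuous (deriv (deriv G)) := hG1.continuous_deriv le_rfl
  have hp1 : Function.Periodic (deriv G) (2 * Real.pi) := fun t => by
    rw [← deriv_comp_add_const]; congr 1; funext s; exact hp s
  have hp2 : Function.Periodic (deriv (deriv G)) (2 * Real.pi) := fun t => by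
    rw [← deriv_comp_add_const]; congr 1; funext s; exact hp1 s
  set h : ℝ → ℂ := fun t => (G t : ℂ) with hh
  set γ : ℝ → ℂ := fun t => ((deriv (deriv G) t : ℝ) : ℂ) with hγ
  have hhc : Continuous h := continuous_ofReal.comp hG.continuous
  have hγc : Continuous γ := continuous_ofReal.comp hc2
  -- Two integrations by parts: the coefficients of G are O(n⁻²), hence summable, and n² times them
  -- are those of the Hölder continuous function G''.
  have hcoef : ∀ n : ℕ, circleCoeff γ n = -((n : ℂ) * (n * circleCoeff h n)) := by
    intro n
    rw [circleCoeff_deriv (h := fun t => ((deriv G t : ℝ) : ℂ)) (fun t => (hd1 t).ofReal_comp) hγc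
      (fun t => by simp only [hp1 t]),
      circleCoeff_deriv (h := h) (fun t => (hd0 t).ofReal_comp)
        (continuous_ofReal.comp hG1.continuous) (fun t => by simp only [hh, hp t])]
    linear_combination (n : ℂ) ^ 2 * circleCoeff h n * I_mul_I
  obtain ⟨C, hC⟩ := exists_norm_circleCoeff_le hγc
  have hC0 : 0 ≤ C := (norm_nonneg _).trans (hC 0)
  set b : ℕ → ℂ := fun n => circleCoeff h n / Real.pi with hb
  have hb2 : ∀ n : ℕ, (n : ℂ) * (n * b n) = -(circleCoeff γ n) / Real.pi := by
    intro n; rw [hcoef]; simp only [hb]; ring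
  have hpin : ‖(Real.pi : ℂ)‖ = Real.pi := by
    rw [Complex.norm_real, Real.norm_of_nonneg Real.pi_pos.le]
  have hb2n : ∀ n : ℕ, ‖(n : ℂ) * (n * b n)‖ ≤ C / Real.pi := by
    intro n
    rw [hb2, norm_div, norm_neg, hpin]
    exact div_le_div_of_nonneg_right (hC n) Real.pi_pos.le
  have hb0 : b 0 = 0 := by
    simp only [hb, circleCoeff, hh]
    simp [intervalIntegral.integral_ofReal, h0]
  have hbn : ∀ n : ℕ, ‖b (n + 1)‖ ≤ C / Real.pi * (1 / ((n + 1 : ℕ) : ℝ) ^ 2) := by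
    intro n
    have := hb2n (n + 1)
    rw [norm_mul, norm_mul, Complex.norm_natCast] at this
    have hn : (0 : ℝ) < ((n + 1 : ℕ) : ℝ) := by positivity
    rw [mul_one_div, le_div_iff₀ (by positivity)]
    linarith
  have hbs : Summable fun n => ‖b n‖ := by
    refine (summable_nat_add_iff 1).1 (Summable.of_nonneg_of_le (fun _ => norm_nonneg _) hbn ?_)
    exact ((summable_nat_add_iff 1).2
      (Real.summable_one_div_nat_pow.2 one_lt_two)).mul_left _
  have hbb : ∀ n, ‖b n‖ ≤ ∑' n, ‖b n‖ := fun n => hbs.le_tsum n fun _ _ => norm_nonneg _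
  have hholγ : ∀ s t, ‖γ s - γ t‖ ≤ |K| * |s - t| ^ δ := by
    intro s t
    simp only [hγ]
    rw [← ofReal_sub, Complex.norm_real, Real.norm_eq_abs]
    exact (hK s t).trans (mul_le_mul_of_nonneg_right (le_abs_self K) (by positivity))
  obtain ⟨B, hB⟩ := exists_norm_cauchyIntegral_le hγc (fun t => by simp only [hγ, hp2 t]) hδ
    (abs_nonneg K) hholγ
  have hS : ∀ w : ℂ, ‖w‖ < 1 →
      ‖∑' n : ℕ, (((n + 1 : ℕ) : ℂ) * (((n + 1 : ℕ) : ℂ) * b (n + 1))) * w ^ n‖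
        ≤ B / Real.pi := by
    intro w hw
    have h1 := hasSum_circleCoeff (h := fun t => γ t * exp (-(t * I))) (by fun_prop) hw
    have h2 : ∀ n : ℕ, (((n + 1 : ℕ) : ℂ) * (((n + 1 : ℕ) : ℂ) * b (n + 1))) * w ^ n
        = (-1 / (Real.pi : ℂ)) * (circleCoeff (fun t => γ t * exp (-(t * I))) n * w ^ n) := by
      intro n
      rw [hb2, circleCoeff_succ]; ring
    simp only [h2]
    rw [tsum_mul_left, h1.tsum_eq, norm_mul, norm_div, norm_neg, norm_one, hpin,
      one_div, ← div_eq_inv_mul]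
    exact div_le_div_of_nonneg_right (hB w hw) Real.pi_pos.le
  obtain ⟨hD, Lc, hL0, hL⟩ := exists_bound_tsum_deriv (a := b) (fun n => hb2n (n + 1)) hS
  set D : ℂ → ℂ := fun w => ∑' n : ℕ, (((n + 1 : ℕ) : ℂ) * b (n + 1)) * w ^ n with hDdef
  -- The point -1 corresponds to the touching point, the origin, under w = (x - re)/re.
  have hcl : (-1 : ℂ) ∈ closure (Metric.ball (0 : ℂ) 1) := by
    rw [closure_ball _ one_ne_zero]; simp
  obtain ⟨f, hf, hfL⟩ := exists_limit_of_lipschitz hL0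
    (fun w hw z hz => hL w z (mem_ball_zero_iff.1 hw) (mem_ball_zero_iff.1 hz)) hcl
  have hne : (𝓝[Metric.ball (0 : ℂ) 1] (-1)).NeBot := mem_closure_iff_nhdsWithin_neBot.1 hcl
  refine ⟨fun w => ∑' n, b n * w ^ n, D, f, B / Real.pi, Lc, hL0, ?_, ?_, ?_, ?_, ?_, hD, ?_⟩
  · refine le_of_tendsto hf.norm ?_
    filter_upwards [self_mem_nhdsWithin] with z hz using hD z (mem_ball_zero_iff.1 hz)
  · refine continuousOn_tsum (fun n => by fun_prop) hbs fun n w hw => ?_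
    rw [norm_mul, norm_pow]
    exact mul_le_of_le_one_right (norm_nonneg _)
      (pow_le_one₀ (norm_nonneg _) (mem_closedBall_zero_iff.1 hw))
  · refine re_tsum_circleCoeff hG.continuous hp h0 ?_
    have := hbs.of_norm.mul_right (Real.pi : ℂ)
    simpa only [hb, div_mul_cancel₀ _ hpi] using this
  · intro w hw
    have h1 := (hasSum_circleCoeff hhc hw).mul_left (1 / (Real.pi : ℂ))
    rw [← h1.tsum_eq]
    exact tsum_congr fun n => by simp only [hb]; ring
  · exact fun w hw => hasDerivAt_tsum_mul_pow hbb hw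
  · intro w hw
    have := hfL w (mem_ball_zero_iff.2 hw)
    rwa [sub_neg_eq_add] at this

/-- The kernel is ⟪a, ν⟫/‖a‖² = Re(ν/a) with a = re e^(it)(1 - we^(-it)) and ν = e^(it); the radius
cancels against the arc length. This identifies `H_d` with the real part of the power series. -/
lemma doubleLayer_circleMap {re : ℝ} (hre : 0 < re) {g : ℂ → ℝ}
    (hg : Continuous fun t => g (circleMap re re t)) {w : ℂ} (hw : ‖w‖ < 1) :
    2 * doubleLayer re re g (re + re * w) = (1 / (Real.pi : ℂ) *
      ∫ t in (0 : ℝ)..(2 * Real.pi),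
        (g (circleMap re re t) : ℂ) / (1 - w * exp (-(t * I)))).re := by
  have e : ∀ t : ℝ, inner ℝ (circleMap (re : ℂ) re t - (re + re * w))
        (re⁻¹ • (circleMap (re : ℂ) re t - re)) / ‖circleMap (re : ℂ) re t - (re + re * w)‖ ^ 2
        * g (circleMap re re t) * re
      = reCLM ((g (circleMap re re t) : ℂ) / (1 - w * exp (-(t * I)))) := by
    intro t
    have hre' : (re : ℂ) ≠ 0 := ofReal_ne_zero.2 hre.ne'
    have hE : exp (t * I) ≠ 0 := exp_ne_zero _
    have hne : 1 - w * exp (-(t * I)) ≠ 0 := one_sub_ne_zero_of_norm_lt hw t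
    set a : ℂ := circleMap (re : ℂ) re t - (re + re * w) with ha
    have ha' : a = re * exp (t * I) * (1 - w * exp (-(t * I))) := by
      rw [ha, circleMap, Complex.exp_neg]; field_simp; ring
    have hb : re⁻¹ • (circleMap (re : ℂ) re t - re) = exp (t * I) := by
      rw [circleMap, Complex.real_smul]; push_cast; field_simp; ring
    have ha0 : a ≠ 0 := by rw [ha']; exact mul_ne_zero (mul_ne_zero hre' hE) hne
    have h1 : inner ℝ a (exp (t * I)) / ‖a‖ ^ 2 = (exp (t * I) / a).re := by
      rw [Complex.inner, div_eq_mul_inv (exp (t * I)), Complex.inv_def, ← mul_assoc,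
        re_mul_ofReal, ← Complex.normSq_eq_norm_sq, div_eq_mul_inv]
    rw [hb, h1, reCLM_apply]
    have h2 : (g (circleMap re re t) : ℂ) / (1 - w * exp (-(t * I)))
        = ((g (circleMap re re t) * re : ℝ) : ℂ) * (exp (t * I) / a) := by
      rw [ha']; push_cast; field_simp
    rw [h2, re_ofReal_mul]; ring
  have hc : Continuous fun t : ℝ => (g (circleMap re re t) : ℂ) / (1 - w * exp (-(t * I))) :=
    Continuous.div (continuous_ofReal.comp hg) (by fun_prop) (one_sub_ne_zero_of_norm_lt hw)
  simp only [doubleLayer, e]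
  rw [reCLM.intervalIntegral_comp_comm (hc.intervalIntegrable _ _)]
  have : (1 / (Real.pi : ℂ)) = ((1 / Real.pi : ℝ) : ℂ) := by push_cast; rfl
  rw [this, re_ofReal_mul, reCLM_apply, ← mul_assoc]
  congr 1
  field_simp

theorem exists_isHolomorphicExtension {re δ : ℝ} (hre : 0 < re) (hδ : 0 < δ) {g : ℂ → ℝ}
    (hg : IsC2Holder δ (re : ℂ) re g)
    (hmean : ∫ t in (0 : ℝ)..(2 * Real.pi), g (circleMap (re : ℂ) re t) = 0) :
    ∃ (F : ℂ → ℂ) (f₀ : ℂ) (C K : ℝ), IsHolomorphicExtension re g F ∧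
      (∀ x ∈ Metric.ball (re : ℂ) re, 2 * doubleLayer re re g x = (F x).re) ∧
      (∀ x ∈ Metric.ball (re : ℂ) re, ‖deriv F x‖ ≤ C) ∧ ‖f₀‖ ≤ C ∧ 0 ≤ K ∧
      ∀ x ∈ Metric.ball (re : ℂ) re, ‖deriv F x - f₀‖ ≤ K * ‖x‖ := by
  obtain ⟨hG, hol⟩ := hg
  obtain ⟨P, D, f, B, L, hL0, hfB, hPc, hPb, hPi, hPd, hDB, hDL⟩ :=
    exists_powerSeries_extension hδ hG
      (fun t => by simp only [periodic_circleMap (re : ℂ) re t]) hol hmean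
  have hre' : (re : ℂ) ≠ 0 := ofReal_ne_zero.2 hre.ne'
  have hren : ‖(re : ℂ)‖ = re := by rw [Complex.norm_real, Real.norm_of_nonneg hre.le]
  have hw : ∀ x ∈ Metric.ball (re : ℂ) re, ‖(x - re) / re‖ < 1 := by
    intro x hx
    rw [norm_div, hren, div_lt_one hre]
    exact mem_ball_iff_norm.1 hx
  have hwx : ∀ x : ℂ, (re : ℂ) + re * ((x - re) / re) = x := by
    intro x; field_simp; ring
  have hFd : ∀ x ∈ Metric.ball (re : ℂ) re,
      HasDerivAt (fun x : ℂ => P ((x - re) / re)) (D ((x - re) / re) * (1 / re)) x := by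
    intro x hx
    exact (hPd _ (hw x hx)).comp x (((hasDerivAt_id x).sub_const (re : ℂ)).div_const (re : ℂ))
  refine ⟨fun x => P ((x - re) / re), f / re, B / re, L / re ^ 2, ⟨?_, ?_, ?_⟩, ?_, ?_, ?_,
    by positivity, ?_⟩
  · exact fun x hx => (hFd x hx).differentiableAt.differentiableWithinAt
  · refine hPc.comp (by fun_prop) fun x hx => ?_
    rw [mem_closedBall_zero_iff, norm_div, hren, div_le_one hre]
    exact mem_closedBall_iff_norm.1 hx
  · intro x hx
    have : x ∈ Set.range (circleMap (re : ℂ) re) := by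
      rw [range_circleMap, abs_of_pos hre]; exact hx
    obtain ⟨t, rfl⟩ := this
    rw [← hPb t]
    congr 2
    rw [circleMap]; field_simp; ring
  · intro x hx
    have := doubleLayer_circleMap hre hG.continuous (hw x hx)
    rw [hwx] at this
    rw [this]
    beta_reduce
    rw [hPi _ (hw x hx)]
  · intro x hx
    rw [(hFd x hx).deriv, norm_mul, norm_div, norm_one, hren, mul_one_div]
    exact div_le_div_of_nonneg_right (hDB _ (hw x hx)) hre.le
  · rw [norm_div, hren]
    exact div_le_div_of_nonneg_right hfB hre.le
  · intro x hx
    have h1 := hDL _ (hw x hx)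
    have h2 : (x - re) / re + 1 = x / re := by field_simp; ring
    rw [h2, norm_div, hren] at h1
    rw [(hFd x hx).deriv, mul_one_div, ← sub_div, norm_div, hren, div_le_iff₀ hre]
    refine h1.trans (le_of_eq ?_)
    field_simp

/-! ### The singular function in complex form -/

/-- The function `L((α - z) / (α + z); β)` from which the singular function is assembled. -/
def lerchPole (α β : ℝ) (z : ℂ) : ℂ := lerchL ((α - z) / (α + z)) β

lemma pole_add_ne_zero {α : ℝ} (hα : 0 < α) {z : ℂ} (hz : 0 < z.re) : (α : ℂ) + z ≠ 0 := by
  intro h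
  have := congrArg Complex.re h
  simp at this
  linarith

/-- In the coordinate e^(-(ξ + iθ)) the translation is multiplication by its multiplier. -/
lemma sub_mob_div_add_mob {α μ : ℝ} (hα : 0 < α) (h0 : 0 < μ) (h1 : μ < 1) {z : ℂ}
    (hz : 0 < z.re) :
    (α - mob α (iterParam μ 1) z) / (α + mob α (iterParam μ 1) z) =
      μ * ((α - z) / (α + z)) := by
  have hα' : (α : ℂ) ≠ 0 := ofReal_ne_zero.2 hα.ne'
  have hκ := one_add_mul_ne_zero (iterParam_nonneg h0 h1 1) (div_re_nonneg hα hz.le)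
  have hs := pole_add_ne_zero hα hz
  have hμ : (1 : ℂ) + μ ≠ 0 := by exact_mod_cast (by linarith : 1 + μ ≠ 0)
  have hi : (iterParam μ 1 : ℂ) = (1 - μ) / (1 + μ) := by rw [iterParam_one]; push_cast; rfl
  set κ : ℂ := (iterParam μ 1 : ℂ) with hκdef
  have hden : (1 : ℂ) + κ * (z / α) = (α + κ * z) / α := by field_simp
  have hd : (α : ℂ) + κ * z ≠ 0 := by
    intro h
    rw [hden, h, zero_div] at hκ
    exact hκ rfl
  have e0 : mob α (iterParam μ 1) z = α * (z + α * κ) / (α + κ * z) := by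
    rw [mob, ← hκdef, hden, div_div_eq_mul_div, ← mul_div_assoc]
    congr 1
    field_simp
  have e1 : (α : ℂ) - mob α (iterParam μ 1) z = α * ((1 - κ) * (α - z)) / (α + κ * z) := by
    rw [e0, eq_div_iff hd, sub_mul, div_mul_cancel₀ _ hd]; ring
  have e2 : (α : ℂ) + mob α (iterParam μ 1) z = α * ((1 + κ) * (α + z)) / (α + κ * z) := by
    rw [e0, eq_div_iff hd, add_mul, div_mul_cancel₀ _ hd]; ring
  have e3 : 1 - κ = μ * (1 + κ) := by rw [hi]; field_simp; ring
  have e4 : 1 + κ ≠ 0 := by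
    rw [hi]
    have : (1 : ℂ) + (1 - μ) / (1 + μ) = 2 / (1 + μ) := by field_simp; ring
    rw [this]; exact div_ne_zero two_ne_zero hμ
  rw [e1, e2, e3]
  field_simp

lemma exp_neg_bipolar {α : ℝ} {z : ℂ} (h₁ : (α : ℂ) - z ≠ 0) (h₂ : (α : ℂ) + z ≠ 0) :
    exp (-((bipolarXi α z : ℝ) : ℂ) - I * (bipolarTheta α z : ℂ)) = (α - z) / (α + z) := by
  have hu : ((α : ℂ) + z) / (α - z) ≠ 0 := div_ne_zero h₂ h₁
  have e : -((bipolarXi α z : ℝ) : ℂ) - I * (bipolarTheta α z : ℂ)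
      = -Complex.log ((α + z) / (α - z)) := by
    rw [Complex.log, bipolarXi, bipolarTheta]; ring
  rw [e, Complex.exp_neg, Complex.exp_log hu, inv_div]

lemma exp_conj_bipolar {α : ℝ} {z : ℂ} (h₁ : (α : ℂ) - z ≠ 0) (h₂ : (α : ℂ) + z ≠ 0) :
    exp (((bipolarXi α z : ℝ) : ℂ) - I * (bipolarTheta α z : ℂ)) =
      conj (((α : ℂ) + z) / (α - z)) := by
  have hu : ((α : ℂ) + z) / (α - z) ≠ 0 := div_ne_zero h₂ h₁
  have e : ((bipolarXi α z : ℝ) : ℂ) - I * (bipolarTheta α z : ℂ)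
      = conj (Complex.log ((α + z) / (α - z))) := by
    rw [Complex.log, bipolarXi, bipolarTheta]
    simp only [map_add, map_mul, conj_ofReal, conj_I]
    ring
  rw [e, Complex.exp_conj, Complex.exp_log hu]

section

variable {ri re ε : ℝ} {z : ℂ}

lemma bipolarXi_lt_xiI_iff (hri : 0 < ri) (h0 : 0 < ε) (h1 : ε < re - ri) (hz : 0 < z.re)
    (hza : (poleDist ri re ε : ℂ) - z ≠ 0) :
    bipolarXi (poleDist ri re ε) z < xiI ri re ε ↔ ri < ‖z - ci ri re ε‖ := by
  have h := circleConfig hri h0 h1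
  have hα := h.pole_pos
  have hc := h.pole_lt
  have hs := pole_add_ne_zero hα hz
  set α := poleDist ri re ε
  set c := ci ri re ε
  have hp := pencil_identity h.c_sq z
  have ha : 0 < ‖(α : ℂ) - z‖ := norm_pos_iff.2 hza
  have hb : 0 < ‖(α : ℂ) + z‖ := norm_pos_iff.2 hs
  have h2 : (2 * bipolarXi α z < 2 * xiI ri re ε) ↔
      (c + α) * ‖(α : ℂ) - z‖ ^ 2 - (c - α) * ‖(α : ℂ) + z‖ ^ 2 > 0 := by
    rw [← neg_lt_neg_iff, ← Real.exp_lt_exp, exp_neg_two_xiI hri h0 h1]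
    have e : Real.exp (-(2 * bipolarXi α z)) = ‖(α : ℂ) - z‖ ^ 2 / ‖(α : ℂ) + z‖ ^ 2 := by
      have hpos : 0 < ‖((α : ℂ) + z) / (α - z)‖ := norm_pos_iff.2 (div_ne_zero hs hza)
      rw [bipolarXi, Real.exp_neg, two_mul, Real.exp_add, Real.exp_log hpos, norm_div]
      field_simp
    rw [e, div_lt_div_iff₀ (by linarith) (by positivity)]
    constructor <;> intro h' <;> linarith
  rw [← mul_lt_mul_iff_right₀ (two_pos : (0 : ℝ) < 2), h2, hp, gt_iff_lt,
    mul_pos_iff_of_pos_left (by linarith), sub_pos, sq_lt_sq₀ hri.le (norm_nonneg _)]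

/-- The shift of ξ by 2ξᵢ - 2ξₑ in the definition is the translation. At the pole both Lerch
arguments vanish, in agreement with the prescribed value 0. -/
lemma qd_eq_inner (hri : 0 < ri) (h0 : 0 < ε) (h1 : ε < re - ri) (β : ℝ) (hz : 0 < z.re)
    (hzr : ‖z - ci ri re ε‖ < ri) :
    qd ri re ε β z =
      lerchPole (poleDist ri re ε) β
          (mob (poleDist ri re ε) (iterParam (multiplier ri re ε) 1) z) -
        lerchPole (poleDist ri re ε) β z := by
  have h := circleConfig hri h0 h1
  have hα := h.pole_pos
  have hs := pole_add_ne_zero hα hz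
  rw [lerchPole, lerchPole, sub_mob_div_add_mob hα h.mult_pos h.mult_lt_one hz]
  by_cases hza : z = (poleDist ri re ε : ℂ)
  · simp only [qd, if_pos hza]
    rw [hza]; simp
  have hza' : (poleDist ri re ε : ℂ) - z ≠ 0 := fun e => hza (sub_eq_zero.1 e).symm
  have hξ : ¬ bipolarXi (poleDist ri re ε) z < xiI ri re ε := by
    rw [bipolarXi_lt_xiI_iff hri h0 h1 hz hza']; exact not_lt.2 hzr.le
  simp only [qd, if_neg hza, if_neg hξ]
  rw [exp_neg_bipolar hza' hs, ← exp_neg_bipolar hza' hs, multiplier, ofReal_exp, ← Complex.exp_add]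
  congr 3
  push_cast; ring

/-- The reflection ξ ↦ 2ξᵢ - ξ at fixed θ is the inversion in ∂D. -/
lemma qd_eq_outer (hri : 0 < ri) (h0 : 0 < ε) (h1 : ε < re - ri) (β : ℝ) (hz : 0 < z.re)
    (hzr : ri < ‖z - ci ri re ε‖) :
    qd ri re ε β z =
      lerchPole (poleDist ri re ε) β
          (mob (poleDist ri re ε) (iterParam (multiplier ri re ε) 1) z) -
        lerchPole (poleDist ri re ε) β (inversionReal (ci ri re ε) ri z) := by
  have h := circleConfig hri h0 h1
  have hα := h.pole_pos
  have hs := pole_add_ne_zero hα hz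
  have hc := h.pole_lt
  have hc2 := h.c_sq
  -- The pole lies in the inclusion, since (c - α)² < c² - α² = ri².
  have hza' : (poleDist ri re ε : ℂ) - z ≠ 0 := by
    intro e
    rw [← sub_eq_zero.1 e, ← ofReal_sub, Complex.norm_real, Real.norm_of_nonpos (by linarith)]
      at hzr
    nlinarith
  have hza : z ≠ (poleDist ri re ε : ℂ) := fun e => hza' (by rw [e, sub_self])
  have hξ := (bipolarXi_lt_xiI_iff hri h0 h1 hz hza').2 hzr
  rw [lerchPole, lerchPole, sub_mob_div_add_mob hα h.mult_pos h.mult_lt_one hz]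
  simp only [qd, if_neg hza, if_pos hξ]
  have hinv : ((poleDist ri re ε : ℂ) - inversionReal (ci ri re ε) ri z) /
      (poleDist ri re ε + inversionReal (ci ri re ε) ri z) =
      exp (-((2 * xiI ri re ε - bipolarXi (poleDist ri re ε) z : ℝ) : ℂ)
        - I * (bipolarTheta (poleDist ri re ε) z : ℂ)) := by
    have e : -((2 * xiI ri re ε - bipolarXi (poleDist ri re ε) z : ℝ) : ℂ)
        - I * (bipolarTheta (poleDist ri re ε) z : ℂ) = ((-(2 * xiI ri re ε) : ℝ) : ℂ) +
          ((bipolarXi (poleDist ri re ε) z : ℝ) - I * (bipolarTheta (poleDist ri re ε) z : ℂ)) := by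
      push_cast; ring
    rw [e, Complex.exp_add, exp_conj_bipolar hza' hs, ← ofReal_exp, exp_neg_two_xiI hri h0 h1]
    set α := poleDist ri re ε
    set c := ci ri re ε
    have hzc : conj z - (c : ℂ) ≠ 0 := by
      intro e
      have e' : conj (z - (c : ℂ)) = 0 := by rw [map_sub, conj_ofReal, e]
      rw [map_eq_zero] at e'
      rw [e', norm_zero] at hzr
      linarith
    have hw1 : (α : ℂ) - conj z ≠ 0 := by
      intro e
      apply hza'
      have := congrArg conj e
      simpa using this
    have hw2 : (α : ℂ) + conj z ≠ 0 := by
      intro e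
      apply hs
      have := congrArg conj e
      simpa using this
    have hca : (c : ℂ) + α ≠ 0 := by exact_mod_cast (by linarith : c + α ≠ 0)
    have hr2 : (ri : ℂ) ^ 2 = c ^ 2 - α ^ 2 := by
      rw [eq_sub_iff_add_eq, add_comm]; exact_mod_cast hc2.symm
    have e1 : (α : ℂ) - inversionReal c ri z =
        -((c - α) * (conj z + α)) / (conj z - c) := by
      rw [inversionReal, map_sub, conj_ofReal, hr2]; field_simp; ring
    have e2 : (α : ℂ) + inversionReal c ri z =
        -((c + α) * (α - conj z)) / (conj z - c) := by
      rw [inversionReal, map_sub, conj_ofReal, hr2]; field_simp; ring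
    rw [e1, e2, map_div₀, map_add, map_sub, conj_ofReal, ofReal_div, ofReal_sub, ofReal_add]
    field_simp
    ring
  rw [hinv, ← exp_neg_bipolar hza' hs, multiplier, ofReal_exp, ← Complex.exp_add]
  congr 3
  push_cast; ring

end

/-! ### Uniform gradient bounds -/

section

variable {ri re ε k C K : ℝ} {g : ℂ → ℝ} {F : ℂ → ℂ} {f₀ : ℂ}

lemma IsHolomorphicExtension.norm_deriv_translated_le (hF : IsHolomorphicExtension re g F)
    (hC : ∀ x ∈ Metric.ball (re : ℂ) re, ‖deriv F x‖ ≤ C) {z : ℂ}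
    (hz : z ∈ Metric.ball (ce ri re ε : ℂ) re) : ‖deriv (translated ri re ε F) z‖ ≤ C := by
  rw [(hF.hasDerivAt_translated hz).deriv]
  exact hC _ (sub_x0_mem_ball.2 hz)

lemma IsHolomorphicExtension.norm_imageSeriesDeriv_sub_le (hF : IsHolomorphicExtension re g F)
    (hC : ∀ x ∈ Metric.ball (re : ℂ) re, ‖deriv F x‖ ≤ C) (hf : ‖f₀‖ ≤ C) (hK0 : 0 ≤ K)
    (hK : ∀ x ∈ Metric.ball (re : ℂ) re, ‖deriv F x - f₀‖ ≤ K * ‖x‖) (hri : 0 < ri)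
    (hre : ri < re) (h0 : 0 < ε) (h1 : ε ≤ (re - ri) / 2) (hk : 0 < k) {z : ℂ}
    (hz : z ∈ Metric.ball (ce ri re ε : ℂ) re) :
    ‖imageSeriesDeriv (poleDist ri re ε) (multiplier ri re ε) (tau k) (translated ri re ε F) z
      - f₀ * linSeriesDeriv (poleDist ri re ε) (multiplier ri re ε) (tau k) z‖ ≤
      2 * C + K * ((re ^ 2 + ri ^ 2) / (re - ri) * (Real.pi / 2 + 2)) := by
  have h1' : ε < re - ri := by linarith
  have h := circleConfig hri h0 h1'
  have hx0 : ‖(x0 ri re ε : ℂ)‖ ≤ poleDist ri re ε := by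
    rw [Complex.norm_real, Real.norm_of_nonneg (x0_nonneg hri h0 h1')]
    exact x0_le_poleDist hri h0 h1'
  have key := NearlyTouchingDisks.norm_imageSeriesDeriv_sub_le (F := translated ri re ε F)
    (f₀ := f₀) (y₀ := x0 ri re ε) h.pole_pos h.isTranslationDomain_ball h.mult_pos h.mult_lt_one
    (abs_tau_lt_one hk) (fun z hz => hF.norm_deriv_translated_le hC hz) hf hK0 hx0
    (fun z hz => by
      rw [(hF.hasDerivAt_translated hz).deriv]
      exact hK _ (sub_x0_mem_ball.2 hz)) hz
  have hpi := Real.pi_pos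
  have := mul_le_mul_of_nonneg_left (mul_le_mul_of_nonneg_right
    (poleDist_div_iterParam_le hri h0 h1 hre) (by positivity : 0 ≤ Real.pi / 2 + 2)) hK0
  linarith

lemma IsHolomorphicExtension.norm_imageSeriesDeriv_le_of_ge (hF : IsHolomorphicExtension re g F)
    (hC : ∀ x ∈ Metric.ball (re : ℂ) re, ‖deriv F x‖ ≤ C) (hC0 : 0 ≤ C) (hri : 0 < ri)
    (hre : ri < re) (h0 : (re - ri) / 2 ≤ ε) (h1 : ε < re - ri) (hk : 0 < k) {z : ℂ}
    (hz : z ∈ Metric.ball (ce ri re ε : ℂ) re) :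
    ‖imageSeriesDeriv (poleDist ri re ε) (multiplier ri re ε) (tau k) (translated ri re ε F) z‖ ≤
      C + C * ((re ^ 2 + ri ^ 2) / ((re - ri) * √(ri * re))) := by
  have h := circleConfig hri (by linarith) h1
  refine (norm_imageSeriesDeriv_le h.pole_pos h.isTranslationDomain_ball h.mult_pos h.mult_lt_one
    (abs_tau_lt_one hk) (fun z hz => hF.norm_deriv_translated_le hC hz) hz).trans ?_
  have := mul_le_mul_of_nonneg_left (inv_iterParam_le_of_ge hri hre h0 h1) hC0
  linarith

lemma tau_pos (hk : 1 < k) : 0 < tau k := div_pos (by linarith) (by linarith)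

lemma neg_one_lt_tau (hk : 0 < k) : -1 < tau k := (abs_lt.1 (abs_tau_lt_one hk)).1

lemma tau_neg (hk : 0 < k) (hk1 : k < 1) : tau k ≤ 0 :=
  (div_neg_of_neg_of_pos (by linarith) (by linarith)).le

lemma betaParam_eq (hk : 1 < k) :
    betaParam ri re ε k = -Real.log (tau k) * (rStar ri re / (2 * √ε)) / 2 := by
  rw [betaParam, abs_of_pos (tau_pos hk)]
  ring

lemma betaParam_nonneg (hri : 0 < ri) (hre : ri < re) (hk : 1 < k) :
    0 ≤ betaParam ri re ε k := by
  have hτ := tau_pos hk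
  have hτ1 := (abs_lt.1 (abs_tau_lt_one (by linarith : 0 < k))).2
  have := Real.log_neg hτ hτ1
  have := (rStar_pos hri hre).le
  rw [betaParam_eq hk]
  have : 0 ≤ -Real.log (tau k) := by linarith
  positivity

/-- Two regimes, whence the maximum: for ε ≤ (re - ri)/2 the derivative of `F` is frozen and the
alternating sum is bounded; for larger ε the crude bound suffices. -/
lemma IsHolomorphicExtension.exists_norm_imageSeriesDeriv_le (hF : IsHolomorphicExtension re g F)
    (hC : ∀ x ∈ Metric.ball (re : ℂ) re, ‖deriv F x‖ ≤ C) (hf : ‖f₀‖ ≤ C) (hK0 : 0 ≤ K)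
    (hK : ∀ x ∈ Metric.ball (re : ℂ) re, ‖deriv F x - f₀‖ ≤ K * ‖x‖) (hri : 0 < ri)
    (hre : ri < re) :
    ∃ B, ∀ ε k : ℝ, 0 < ε → ε < re - ri → 0 < k → k < 1 →
      ∀ z ∈ Metric.ball (ce ri re ε : ℂ) re,
        ‖imageSeriesDeriv (poleDist ri re ε) (multiplier ri re ε) (tau k)
          (translated ri re ε F) z‖ ≤ B := by
  have hC0 : 0 ≤ C := (norm_nonneg _).trans hf
  refine ⟨max (2 * C + K * ((re ^ 2 + ri ^ 2) / (re - ri) * (Real.pi / 2 + 2))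
    + C * (Real.pi + 2)) (C + C * ((re ^ 2 + ri ^ 2) / ((re - ri) * √(ri * re)))),
    fun ε k h0 h1 hk hk1 z hz => ?_⟩
  rcases le_total ε ((re - ri) / 2) with hε | hε
  · refine le_max_of_le_left ?_
    have h := circleConfig hri h0 h1
    have t1 := hF.norm_imageSeriesDeriv_sub_le hC hf hK0 hK hri hre h0 hε hk hz
    have t2 := norm_linSeriesDeriv_le_of_nonpos h.pole_pos
      (h.isTranslationDomain_ball.re_nonneg z hz) h.mult_pos h.mult_lt_one (neg_one_lt_tau hk)
      (tau_neg hk hk1)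
    have t3 : ‖f₀ * linSeriesDeriv (poleDist ri re ε) (multiplier ri re ε) (tau k) z‖
        ≤ C * (Real.pi + 2) := by
      rw [norm_mul]
      exact mul_le_mul hf t2 (norm_nonneg _) hC0
    have t4 := norm_add_le (imageSeriesDeriv (poleDist ri re ε) (multiplier ri re ε) (tau k)
      (translated ri re ε F) z - f₀ * linSeriesDeriv (poleDist ri re ε) (multiplier ri re ε)
        (tau k) z) (f₀ * linSeriesDeriv (poleDist ri re ε) (multiplier ri re ε) (tau k) z)
    rw [sub_add_cancel] at t4
    linarith
  · exact le_max_of_le_right (hF.norm_imageSeriesDeriv_le_of_ge hC hC0 hri hre hε h1 hk hz)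

/-- The same two regimes. For small ε the frozen sum is compared with the Lerch term; for larger ε
the Lerch term is itself bounded, because 1/α is. -/
lemma IsHolomorphicExtension.exists_norm_imageSeriesDeriv_sub_lerch_le
    (hF : IsHolomorphicExtension re g F)
    (hC : ∀ x ∈ Metric.ball (re : ℂ) re, ‖deriv F x‖ ≤ C) (hf : ‖f₀‖ ≤ C) (hK0 : 0 ≤ K)
    (hK : ∀ x ∈ Metric.ball (re : ℂ) re, ‖deriv F x - f₀‖ ≤ K * ‖x‖) (hri : 0 < ri)
    (hre : ri < re) :
    ∃ B, ∀ ε k : ℝ, 0 < ε → ε < re - ri → 1 < k →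
      ∀ z ∈ Metric.ball (ce ri re ε : ℂ) re,
        ‖imageSeriesDeriv (poleDist ri re ε) (multiplier ri re ε) (tau k)
            (translated ri re ε F) z
          - f₀ * (((rStar ri re ^ 2 : ℝ) : ℂ) / 2 * (1 / (2 * poleDist ri re ε)
            * mobDerivLaplace (poleDist ri re ε) (betaParam ri re ε k) z))‖ ≤ B := by
  have hC0 : 0 ≤ C := (norm_nonneg _).trans hf
  obtain ⟨E₁, E₂, y₀, hy₀, hE⟩ := exists_gap_asymptotics hri hre
  refine ⟨max (2 * C + K * ((re ^ 2 + ri ^ 2) / (re - ri) * (Real.pi / 2 + 2))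
    + C * (Real.pi + 2 + 2 * (E₁ + E₁ * (E₁ / y₀ + 1)) + 2 * E₂))
    (C + C * ((re ^ 2 + ri ^ 2) / ((re - ri) * √(ri * re)))
      + C * (rStar ri re ^ 2 * (2 / √(ri * re)))),
    fun ε k h0 h1 hk z hz => ?_⟩
  have hk0 : 0 < k := by linarith
  have h := circleConfig hri h0 h1
  have hα := h.pole_pos
  have hz0 := h.isTranslationDomain_ball.re_nonneg z hz
  rcases le_total ε ((re - ri) / 2) with hε | hε
  · refine le_max_of_le_left ?_
    obtain ⟨hY, hE1, hE2⟩ := hE ε h0 hε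
    have t1 := hF.norm_imageSeriesDeriv_sub_le hC hf hK0 hK hri hre h0 hε hk0 hz
    have t2 := norm_linSeriesDeriv_sub_lerch_le (R := rStar ri re ^ 2) hα hz0
      (xi_gap_pos hri h0 h1) (tau_pos hk)
      (abs_lt.1 (abs_tau_lt_one hk0)).2 hy₀ hY hE1 hE2
    rw [← betaParam_eq hk, ← multiplier] at t2
    have t3 := mul_le_mul hf t2 (norm_nonneg _) hC0
    rw [← norm_mul, mul_sub] at t3
    have t4 := norm_add_le (imageSeriesDeriv (poleDist ri re ε) (multiplier ri re ε) (tau k)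
      (translated ri re ε F) z - f₀ * linSeriesDeriv (poleDist ri re ε) (multiplier ri re ε)
        (tau k) z) (f₀ * linSeriesDeriv (poleDist ri re ε) (multiplier ri re ε) (tau k) z -
          f₀ * (((rStar ri re ^ 2 : ℝ) : ℂ) / 2 * (1 / (2 * poleDist ri re ε)
            * mobDerivLaplace (poleDist ri re ε) (betaParam ri re ε k) z)))
    rw [sub_add_sub_cancel] at t4
    linarith
  · refine le_max_of_le_right ?_
    have t1 := hF.norm_imageSeriesDeriv_le_of_ge hC hC0 hri hre hε h1 hk0 hz
    refine (norm_sub_le _ _).trans (add_le_add t1 ?_)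
    rw [norm_mul]
    refine mul_le_mul hf ?_ (norm_nonneg _) hC0
    have t2 := norm_mobDerivLaplace_le hα hz0 (betaParam_nonneg (ε := ε) hri hre hk)
    have t3 := inv_poleDist_le_of_ge hri hre hε h1
    rw [norm_mul, norm_mul, norm_div, norm_div, norm_mul, Complex.norm_real, Complex.norm_real,
      Real.norm_of_nonneg (by positivity), Real.norm_of_nonneg hα.le, norm_one, Complex.norm_two]
    calc _ ≤ rStar ri re ^ 2 / 2 * (1 / (2 * poleDist ri re ε) * 4) := by gcongr
      _ = rStar ri re ^ 2 * (1 / poleDist ri re ε) := by ring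
      _ ≤ _ := by gcongr

/-! ### The remainder -/

/-- The image series with its singular part removed. -/
def regularSeries (ri re ε k : ℝ) (F : ℂ → ℂ) (f₀ z : ℂ) : ℂ :=
  imageSeries (poleDist ri re ε) (multiplier ri re ε) (tau k) (translated ri re ε F) z
    - f₀ * (((rStar ri re ^ 2 : ℝ) : ℂ) / 2 *
      lerchPole (poleDist ri re ε) (betaParam ri re ε k) z)

lemma IsHolomorphicExtension.hasDerivAt_regularSeries (hF : IsHolomorphicExtension re g F)
    (f₀ : ℂ) (hri : 0 < ri) (hre : ri < re) (h0 : 0 < ε) (h1 : ε < re - ri) (hk : 1 < k) {z : ℂ}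
    (hz : z ∈ Metric.ball (ce ri re ε : ℂ) re) :
    HasDerivAt (regularSeries ri re ε k F f₀)
      (imageSeriesDeriv (poleDist ri re ε) (multiplier ri re ε) (tau k) (translated ri re ε F) z
        - f₀ * (((rStar ri re ^ 2 : ℝ) : ℂ) / 2 * (1 / (2 * poleDist ri re ε)
          * mobDerivLaplace (poleDist ri re ε) (betaParam ri re ε k) z))) z := by
  have h := circleConfig hri h0 h1
  exact (hF.hasDerivAt_imageSeries hri h0 h1 (by linarith) hz).sub
    (((hasDerivAt_lerchL_comp h.pole_pos (betaParam_nonneg hri hre hk)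
      (h.re_pos (Metric.ball_subset_closedBall hz))).const_mul _).const_mul _)

/-- Inside and outside D, `q_d` has the form N ∘ T - N, respectively with N reflected, for N the
Lerch function: exactly the shape in which the image series enters `glued`. The constants are Re f₀
and -Im f₀ because the singular term is a real multiple of Re(f₀ q_d). -/
lemma remainder_imageSolution (F : ℂ → ℂ) (f₀ : ℂ) (hri : 0 < ri) (h0 : 0 < ε)
    (h1 : ε < re - ri) {x : ℂ} (hx : x ∈ outerDisk re \ interface ri ε) :
    remainder ri re ε k f₀.re (-f₀.im) (imageSolution ri re ε k F) x =
      glued (poleDist ri re ε) (ci ri re ε) ri (multiplier ri re ε) (tau k)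
        (translated ri re ε F) (regularSeries ri re ε k F f₀) (x + x0 ri re ε) := by
  have h := circleConfig hri h0 h1
  have hz := h.re_pos (Metric.ball_subset_closedBall (add_x0_mem_ball (ri := ri) (ε := ε).2 hx.1))
  have hne : ‖x + x0 ri re ε - ci ri re ε‖ ≠ ri := by
    rw [add_x0_sub_ci]
    exact fun e => hx.2 (mem_sphere_iff_norm.2 e)
  rw [remainder, imageSolution]
  set z := x + x0 ri re ε
  have e : ∀ q : ℂ, rStar ri re ^ 2 * tau k / 2 * (f₀.re * q.re + -f₀.im * q.im) =
      (tau k * (f₀ * (((rStar ri re ^ 2 : ℝ) : ℂ) / 2 * q))).re := by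
    intro q
    have : (tau k * (f₀ * (((rStar ri re ^ 2 : ℝ) : ℂ) / 2 * q))) =
        ((rStar ri re ^ 2 * tau k / 2 : ℝ) : ℂ) * (f₀ * q) := by push_cast; ring
    rw [this, re_ofReal_mul, mul_re]
    ring
  rw [e]
  rcases lt_or_gt_of_ne hne with hlt | hgt
  · rw [glued_of_le hlt.le, glued_of_le hlt.le, qd_eq_inner hri h0 h1 _ hz hlt, ← sub_re]
    congr 1
    simp only [innerPart, regularSeries]
    ring
  · rw [glued_of_ge hri hgt.le, glued_of_ge hri hgt.le, qd_eq_outer hri h0 h1 _ hz hgt,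
      outerPart_re, outerPart_re, ← sub_re]
    congr 1
    simp only [regularSeries]
    ring

lemma hasGradientAt_comp_add_const {f : ℂ → ℝ} {w x : ℂ} (a : ℂ) (h : HasGradientAt f w (x + a)) :
    HasGradientAt (fun x => f (x + a)) w x := by
  rw [hasGradientAt_iff_hasFDerivAt] at h ⊢
  exact (hasFDerivAt_comp_add_right a).2 h

lemma isOpen_outerDisk_diff_interface (ri re ε : ℝ) :
    IsOpen (outerDisk re \ interface ri ε) :=
  Metric.isOpen_ball.sdiff Metric.isClosed_sphere

lemma norm_gradient_le_of_eqOn_glued {N : ℂ → ℂ} {u : ℂ → ℝ} {A B : ℝ} (hri : 0 < ri)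
    (h0 : 0 < ε) (h1 : ε < re - ri) (hk : 0 < k) (hF : IsHolomorphicExtension re g F)
    (hA : ∀ x ∈ Metric.ball (re : ℂ) re, ‖deriv F x‖ ≤ A)
    {N' : ℂ → ℂ} (hN : ∀ z ∈ Metric.ball (ce ri re ε : ℂ) re, HasDerivAt N (N' z) z)
    (hB : ∀ z ∈ Metric.ball (ce ri re ε : ℂ) re, ‖N' z‖ ≤ B)
    (hu : ∀ x ∈ outerDisk re \ interface ri ε,
      u x = glued (poleDist ri re ε) (ci ri re ε) ri (multiplier ri re ε) (tau k)
        (translated ri re ε F) N (x + x0 ri re ε)) {x : ℂ}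
    (hx : x ∈ outerDisk re \ interface ri ε) :
    DifferentiableAt ℝ u x ∧ ‖gradient u x‖ ≤ A + 2 * B := by
  have h := circleConfig hri h0 h1
  have hne : ‖x + x0 ri re ε - ci ri re ε‖ ≠ ri := by
    rw [add_x0_sub_ci]
    exact fun e => hx.2 (mem_sphere_iff_norm.2 e)
  obtain ⟨w, hw, hwle⟩ := norm_gradient_glued_le (τ := tau k) h (abs_tau_lt_one hk).le
    (hF.differentiableOn_translated (ri := ri) (ε := ε))
    (fun z hz => (hN z hz).differentiableAt.differentiableWithinAt)
    (fun z hz => hF.norm_deriv_translated_le hA hz)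
    (fun z hz => by rw [(hN z hz).deriv]; exact hB z hz) (add_x0_mem_ball.2 hx.1) hne
  have hg : HasGradientAt u w x := by
    refine (hasGradientAt_comp_add_const _ hw).congr_of_eventuallyEq ?_
    filter_upwards [(isOpen_outerDisk_diff_interface ri re ε).mem_nhds hx] with y hy
    exact hu y hy
  exact ⟨hg.differentiableAt, by rwa [hg.gradient]⟩

lemma tendsto_gradient_re {u : ℂ → ℝ} (hF : IsHolomorphicExtension re g F)
    (hu : ∀ x ∈ Metric.ball (re : ℂ) re, u x = (F x).re)
    (hK : ∀ x ∈ Metric.ball (re : ℂ) re, ‖deriv F x - f₀‖ ≤ K * ‖x‖) :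
    Tendsto (gradient u) (𝓝[outerDisk re] 0) (𝓝 (conj f₀)) := by
  have hgrad : ∀ x ∈ Metric.ball (re : ℂ) re, gradient u x = conj (deriv F x) := by
    intro x hx
    have h := (hF.differentiableOn.differentiableAt (Metric.isOpen_ball.mem_nhds hx)).hasDerivAt
    refine ((hasGradientAt_re h).congr_of_eventuallyEq ?_).gradient
    filter_upwards [Metric.isOpen_ball.mem_nhds hx] with y hy using hu y hy
  have hlim : Tendsto (fun x : ℂ => K * ‖x‖) (𝓝[outerDisk re] 0) (𝓝 0) := by
    have : Tendsto (fun x : ℂ => K * ‖x‖) (𝓝 0) (𝓝 (K * ‖(0 : ℂ)‖)) :=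
      (by fun_prop : Continuous fun x : ℂ => K * ‖x‖).tendsto 0
    rw [norm_zero, mul_zero] at this
    exact this.mono_left nhdsWithin_le_nhds
  rw [tendsto_iff_norm_sub_tendsto_zero]
  refine squeeze_zero' (Eventually.of_forall fun _ => norm_nonneg _) ?_ hlim
  filter_upwards [self_mem_nhdsWithin] with x hx
  rw [hgrad x hx, ← map_sub, Complex.norm_conj]
  exact hK x hx

end

end

end NearlyTouchingDisks

/-! ### Proof of the theorem: existence, the case k < 1 and the case k > 1. -/

theorem mainTheorem6 (ri re : ℝ) (hri : 0 < ri) (hre : ri < re)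
    (δ : ℝ) (hδ : 1 / 2 < δ) (g : ℂ → ℝ)
    (hg : NearlyTouchingDisks.IsC2Holder δ (re : ℂ) re g)
    (hmean : ∫ t in (0 : ℝ)..(2 * Real.pi), g (circleMap (re : ℂ) re t) = 0) :
    (∀ ε k : ℝ, 0 < ε → ε < re - ri → 0 < k →
      ∃ v : ℂ → ℝ, NearlyTouchingDisks.IsSolution ri re ε k g v) ∧
    (∃ C : ℝ, ∀ ε k : ℝ, 0 < ε → ε < re - ri → 0 < k → k < 1 →
      ∀ v : ℂ → ℝ, NearlyTouchingDisks.IsSolution ri re ε k g v →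
        ∀ x ∈ NearlyTouchingDisks.outerDisk re \ NearlyTouchingDisks.interface ri ε,
          DifferentiableAt ℝ v x ∧ ‖gradient v x‖ ≤ C) ∧
    (∃ C₁ C₂ : ℝ,
      Tendsto (gradient fun x : ℂ => 2 * NearlyTouchingDisks.doubleLayer (re : ℂ) re g x)
        (𝓝[NearlyTouchingDisks.outerDisk re] 0) (𝓝 ((C₁ : ℂ) + (C₂ : ℂ) * Complex.I)) ∧
      ∃ C : ℝ, ∀ ε k : ℝ, 0 < ε → ε < re - ri → 1 < k →
        ∀ v : ℂ → ℝ, NearlyTouchingDisks.IsSolution ri re ε k g v →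
          ∀ x ∈ NearlyTouchingDisks.outerDisk re \ NearlyTouchingDisks.interface ri ε,
            DifferentiableAt ℝ (NearlyTouchingDisks.remainder ri re ε k C₁ C₂ v) x ∧
              ‖gradient (NearlyTouchingDisks.remainder ri re ε k C₁ C₂ v) x‖ ≤ C) := by
  open NearlyTouchingDisks in
  obtain ⟨F, f₀, A, K, hF, hdl, hA, hf, hK0, hK⟩ :=
    exists_isHolomorphicExtension (hri.trans hre) (by linarith) hg hmean
  have heq : ∀ {ε k : ℝ} {v : ℂ → ℝ}, 0 < ε → ε < re - ri → 0 < k → IsSolution ri re ε k g v →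
      ∀ x ∈ outerDisk re \ interface ri ε, v x = imageSolution ri re ε k F x :=
    fun h0 h1 hk hv x hx => hv.eqOn hri h0 h1 hk (isSolution_imageSolution hF hri h0 h1 hk)
      (Metric.ball_subset_closedBall hx.1)
  refine ⟨fun ε k h0 h1 hk => ⟨_, isSolution_imageSolution hF hri h0 h1 hk⟩, ?_,
    f₀.re, -f₀.im, ?_, ?_⟩
  · obtain ⟨B, hB⟩ := hF.exists_norm_imageSeriesDeriv_le hA hf hK0 hK hri hre
    exact ⟨A + 2 * B, fun ε k h0 h1 hk hk1 v hv x hx =>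
      norm_gradient_le_of_eqOn_glued hri h0 h1 hk hF hA
        (fun z hz => hF.hasDerivAt_imageSeries hri h0 h1 hk hz) (hB ε k h0 h1 hk hk1)
        (heq h0 h1 hk hv) hx⟩
  · have := tendsto_gradient_re hF hdl hK
    convert this using 2
    -- The limit of the gradient is the conjugate of f₀, that is C₁ + C₂ i.
    apply Complex.ext <;> simp
  · obtain ⟨B, hB⟩ := hF.exists_norm_imageSeriesDeriv_sub_lerch_le hA hf hK0 hK hri hre
    refine ⟨A + 2 * B, fun ε k h0 h1 hk v hv x hx => ?_⟩
    have hk0 : 0 < k := by linarith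
    refine norm_gradient_le_of_eqOn_glued hri h0 h1 hk0 hF hA
      (fun z hz => hF.hasDerivAt_regularSeries f₀ hri hre h0 h1 hk hz) (hB ε k h0 h1 hk)
      (fun y hy => ?_) hx
    rw [← remainder_imageSolution F f₀ hri h0 h1 hy, remainder, remainder, heq h0 h1 hk0 hv y hy]
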